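/- Let the Weighted Efficient Domination problem (WED) be the following. An instance consists of a finite simple undirected graph $G=(V,E)$ and vertex weights $\omega:V\to\mathbb{N}\cup\{\infty\}$. A set $D\subseteq V$ is an efficient dominating set (e.d.s.) of $G$ if every vertex $v\in V$ is dominated by exactly one vertex of $D$, that is, $|D\cap N[v]|=1$ for the closed neighborhood $N[v]$ of every $v\in V$. The task is to find an e.d.s. of minimum finite total weight $\sum_{v\in D}\omega(v)$, or to determine that $G$ has no e.d.s. of finite total weight. A graph is $H$-free if none of its induced subgraphs is isomorphic to $H$, and it is chordal if it has no induced cycle with four or more vertices. Let $K_3+P_2$ be the disjoint union of a triangle and an edge, and let co-$P$ be the complement of the graph $P$ that consists of an induced cycle $C_4$ and a fifth vertex adjacent to exactly one vertex of the cycle. Then WED is solvable in polynomial time (in the binary length of the input) for $(K_3+P_2)$-free chordal graphs, and WED is solvable in polynomial time for co-$P$-free chordal graphs. -/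

import Mathlib

/-! ### Graphs -/

namespace WED

/-- `G` is `H`-free: no induced subgraph of `G` is isomorphic to `H`. -/
def HFree {W V : Type*} (H : SimpleGraph W) (G : SimpleGraph V) : Prop :=
  ¬ H.IsIndContained G

/-- `G` is chordal: it has no induced (chordless) cycle with four or more vertices. -/
def IsChordal {V : Type*} (G : SimpleGraph V) : Prop :=
  ∀ k : ℕ, 4 ≤ k → HFree (SimpleGraph.cycleGraph k) G

/-- `K₃ + P₂`, the disjoint union of a triangle and a path with two vertices. -/
def K3P2 : SimpleGraph (Fin 3 ⊕ Fin 2) :=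
  SimpleGraph.sum (SimpleGraph.completeGraph (Fin 3)) (SimpleGraph.pathGraph 2)

/-- The graph `P`: a chordless cycle `0, 1, 2, 3` and a fifth vertex `4` that is adjacent to
exactly one vertex of the cycle, namely `0`. -/
def graphP : SimpleGraph (Fin 5) :=
  SimpleGraph.fromEdgeSet
    {s(0, 1), s(1, 2), s(2, 3), s(3, 0), s(0, 4)}

/-- `co-P`, the complement of `P`. -/
def coP : SimpleGraph (Fin 5) := graphPᶜ

/-! ### Weighted efficient domination -/

/-- `D` is an efficient dominating set of `G`: every vertex is dominated by exactly one vertex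
of `D`, where a vertex dominates itself and its neighbours. -/
def IsEDS {V : Type*} (G : SimpleGraph V) (D : Finset V) : Prop :=
  ∀ v : V, ∃! d : V, d ∈ D ∧ (d = v ∨ G.Adj d v)

/-- An instance of WED: a finite graph on the vertices `0, …, n - 1` and vertex weights in
`ℕ ∪ {∞}`. -/
structure Instance where
  /-- number of vertices -/
  n : ℕ
  /-- the graph -/
  graph : SimpleGraph (Fin n)
  /-- the vertex weights -/
  weight : Fin n → ℕ∞

/-- Total weight of a vertex set. -/
noncomputable def Instance.total (I : Instance) (D : Finset (Fin I.n)) : ℕ∞ :=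
  ∑ v ∈ D, I.weight v

/-- The correct answers to an instance: an efficient dominating set of finite weight that has
minimum weight among all efficient dominating sets, or `none` if there is no efficient
dominating set of finite weight. -/
def Instance.IsAnswer (I : Instance) : Option (Finset (Fin I.n)) → Prop
  | some D => IsEDS I.graph D ∧ I.total D ≠ ⊤ ∧
      ∀ D' : Finset (Fin I.n), IsEDS I.graph D' → I.total D ≤ I.total D'
  | none => ∀ D : Finset (Fin I.n), IsEDS I.graph D → I.total D = ⊤

/-! ### Random access machine with logarithmic cost

The memory consists of banks `0, 1, 2, …`, each with cells `0, 1, 2, …` that hold natural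
numbers. Banks are addressed by constants of the program only (so a program uses finitely many
of them), cells inside a bank by computed addresses. The cost of evaluating an expression counts
the binary lengths of all addresses, constants, operands and results that occur in it. -/

/-- Memory contents: `s a i` is the content of cell `i` of bank `a`. -/
abbrev Mem : Type := ℕ → ℕ → ℕ

/-- Expressions. -/
inductive Expr : Type
  /-- a constant -/
  | lit (c : ℕ) : Expr
  /-- the content of the cell of bank `a` with the given address -/
  | cell (a : ℕ) (addr : Expr) : Expr
  /-- sum -/
  | add (e f : Expr) : Expr
  /-- truncated difference -/
  | sub (e f : Expr) : Expr
  /-- product -/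
  | mul (e f : Expr) : Expr

/-- The value of an expression. -/
def Expr.eval (s : Mem) : Expr → ℕ
  | lit c => c
  | cell a addr => s a (addr.eval s)
  | add e f => e.eval s + f.eval s
  | sub e f => e.eval s - f.eval s
  | mul e f => e.eval s * f.eval s

/-- The cost of evaluating an expression: every node costs one plus the binary length of its
value. -/
def Expr.cost (s : Mem) : Expr → ℕ
  | lit c => Nat.size c + 1
  | cell a addr => addr.cost s + (Nat.size (s a (addr.eval s)) + 1)
  | add e f => e.cost s + f.cost s + (Nat.size (e.eval s + f.eval s) + 1)
  | sub e f => e.cost s + f.cost s + (Nat.size (e.eval s - f.eval s) + 1)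
  | mul e f => e.cost s + f.cost s + (Nat.size (e.eval s * f.eval s) + 1)

/-- Programs. -/
inductive Prog : Type
  /-- do nothing -/
  | skip : Prog
  /-- write the value of `e` to the cell of bank `a` with address `addr` -/
  | store (a : ℕ) (addr e : Expr) : Prog
  /-- sequential composition -/
  | seq (p q : Prog) : Prog
  /-- run `p` if `b` is nonzero, and `q` otherwise -/
  | ite (b : Expr) (p q : Prog) : Prog
  /-- run `p` as long as `b` is nonzero -/
  | loop (b : Expr) (p : Prog) : Prog

/-- The memory after writing `x` to cell `i` of bank `a`. -/
def Mem.write (s : Mem) (a i x : ℕ) : Mem :=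
  fun a' i' => if a' = a ∧ i' = i then x else s a' i'

/-- `Exec p s s' t`: started in memory `s`, the program `p` halts in memory `s'`, at total
cost `t`. -/
inductive Exec : Prog → Mem → Mem → ℕ → Prop
  | skip (s : Mem) : Exec Prog.skip s s 1
  | store (s : Mem) (a : ℕ) (addr e : Expr) :
      Exec (Prog.store a addr e) s (s.write a (addr.eval s) (e.eval s))
        (addr.cost s + e.cost s + 1)
  | seq {p q : Prog} {s s' s'' : Mem} {t t' : ℕ} (hp : Exec p s s' t) (hq : Exec q s' s'' t') :
      Exec (Prog.seq p q) s s'' (t + t')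
  | iteTrue {b : Expr} {p q : Prog} {s s' : Mem} {t : ℕ} (hb : b.eval s ≠ 0)
      (hp : Exec p s s' t) : Exec (Prog.ite b p q) s s' (b.cost s + 1 + t)
  | iteFalse {b : Expr} {p q : Prog} {s s' : Mem} {t : ℕ} (hb : b.eval s = 0)
      (hq : Exec q s s' t) : Exec (Prog.ite b p q) s s' (b.cost s + 1 + t)
  | loopTrue {b : Expr} {p : Prog} {s s' s'' : Mem} {t t' : ℕ} (hb : b.eval s ≠ 0)
      (hp : Exec p s s' t) (hl : Exec (Prog.loop b p) s' s'' t') :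
      Exec (Prog.loop b p) s s'' (b.cost s + 1 + t + t')
  | loopFalse {b : Expr} {p : Prog} {s : Mem} (hb : b.eval s = 0) :
      Exec (Prog.loop b p) s s (b.cost s + 1)

/-- A program run has at most one outcome and one cost. -/
theorem Exec.unique {p : Prog} {s s₁ : Mem} {t₁ : ℕ} (h₁ : Exec p s s₁ t₁) :
    ∀ {s₂ : Mem} {t₂ : ℕ}, Exec p s s₂ t₂ → s₁ = s₂ ∧ t₁ = t₂ := by
  induction h₁ with
  | skip s => intro s₂ t₂ h; cases h; exact ⟨rfl, rfl⟩
  | store s a addr e => intro s₂ t₂ h; cases h; exact ⟨rfl, rfl⟩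
  | seq hp hq ihp ihq =>
    intro s₂ t₂ h
    cases h with
    | seq hp' hq' =>
      obtain ⟨rfl, rfl⟩ := ihp hp'
      obtain ⟨rfl, rfl⟩ := ihq hq'
      exact ⟨rfl, rfl⟩
  | iteTrue hb hp ih =>
    intro s₂ t₂ h
    cases h with
    | iteTrue hb' hp' => obtain ⟨rfl, rfl⟩ := ih hp'; exact ⟨rfl, rfl⟩
    | iteFalse hb' hq' => exact absurd hb' hb
  | iteFalse hb hq ih =>
    intro s₂ t₂ h
    cases h with
    | iteTrue hb' hp' => exact absurd hb hb'
    | iteFalse hb' hq' => obtain ⟨rfl, rfl⟩ := ih hq'; exact ⟨rfl, rfl⟩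
  | loopTrue hb hp hl ihp ihl =>
    intro s₂ t₂ h
    cases h with
    | loopTrue hb' hp' hl' =>
      obtain ⟨rfl, rfl⟩ := ihp hp'
      obtain ⟨rfl, rfl⟩ := ihl hl'
      exact ⟨rfl, rfl⟩
    | loopFalse hb' => exact absurd hb' hb
  | loopFalse hb =>
    intro s₂ t₂ h
    cases h with
    | loopTrue hb' hp' hl' => exact absurd hb hb'
    | loopFalse hb' => exact ⟨rfl, rfl⟩

/-! ### Solving WED on a graph class in polynomial time -/

open Classical in
/-- The encoding of an instance: the number of vertices, then the adjacency matrix row by row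
(as zeros and ones), then the weights, where `∞` is encoded by `0` and `k : ℕ` by `k + 1`. -/
noncomputable def Instance.encode (I : Instance) : List ℕ :=
  I.n ::
    ((List.finRange I.n).flatMap fun u =>
      (List.finRange I.n).map fun v => if I.graph.Adj u v then 1 else 0) ++
    (List.finRange I.n).map fun v => if I.weight v = ⊤ then 0 else (I.weight v).toNat + 1

/-- The length of an input: the sum of the binary lengths of its entries, with one separator
symbol for each entry. -/
def inputLength (l : List ℕ) : ℕ := (l.map fun x => Nat.size x + 1).sum

/-- The initial memory: the input is in the first cells of bank `0`, all other cells hold `0`. -/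
def initMem (l : List ℕ) : Mem := fun a i => if a = 0 then l.getD i 0 else 0

/-- The answer in bank `1`: if cell `0` holds `0`, then the answer is `none`; otherwise it is
the set of all vertices `v` for which cell `v + 1` does not hold `0`. -/
def answer (n : ℕ) (s : Mem) : Option (Finset (Fin n)) :=
  if s 1 0 = 0 then none else some (Finset.univ.filter fun v : Fin n => s 1 (v.val + 1) ≠ 0)

/-- WED is solvable in polynomial time on the graph class `C`: one program answers every
instance whose graph is in `C` correctly, in time polynomial in the length of the input. -/
def SolvableInPolyTime (C : ∀ n : ℕ, SimpleGraph (Fin n) → Prop) : Prop :=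
  ∃ (p : Prog) (T : Polynomial ℕ), ∀ I : Instance, C I.n I.graph →
    ∃ (s : Mem) (t : ℕ), Exec p (initMem I.encode) s t ∧
      t ≤ T.eval (inputLength I.encode) ∧ I.IsAnswer (answer I.n s)

end WED

/-! ### Chordality, the two forbidden subgraphs, and the square of a graph -/

namespace WED

open SimpleGraph

variable {V : Type*} {G : SimpleGraph V}

/-! An efficient dominating set (e.d.s.) is a dominating set that is independent in the square of
the graph (`isEDS_iff`). Closed neighbourhoods of vertices independent in the square are disjoint.
So if `M` exceeds every finite total weight and `v` gets the new weight `|N[v]| * M - ω(v)`, a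
maximum weight independent set of the square, within the vertices of finite weight, dominates as
many vertices as possible and, subject to that, has least `ω` (`Instance.isAnswer_of_sum_le`).

Such a set can be found when every nonempty induced subgraph of the square has a simplicial vertex.
Frank's primal-dual algorithm eliminates simplicial vertices, each time subtracting the residual
weight of the eliminated vertex from its remaining neighbours in the square, and stacks the vertices
whose residual weight was positive. It then selects greedily from the top of the stack. The cliques
met on the way form a dual solution that certifies optimality (`FrankState.step`,
`FrankSelection.sum_le`).

The graph-theoretic core is that a graph of either class which has an e.d.s. `D` has such a square
(`K3P2Free.squareChordal`, `CoPFree.squareChordal`). A triangle-free chordal component is a tree,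
and there a deepest vertex of the given set is simplicial. Otherwise a triangle is fixed, through a
vertex of `D` if possible. The forbidden subgraph and chordality tie all other vertices closely to
it: a vertex of the given set is either attached so simply that one vertex dominates everything
close to it, or belongs to a family of pairwise close vertices. Graphs without an e.d.s. need no
structure, since the program checks the set that it has found.

For the running time, the program is written with bounded loops only, and stored values are linear
expressions. Number lengths then grow polynomially, and a polynomial time bound is read off the
syntax (`LP.exec_compile`). -/

theorem cycleGraph_adj_val {k : ℕ} {i j : Fin (k + 2)} :
    (cycleGraph (k + 2)).Adj i j ↔ i.val + 1 = j.val ∨ j.val + 1 = i.val ∨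
      (i.val = 0 ∧ j.val = k + 1) ∨ (j.val = 0 ∧ i.val = k + 1) := by
  have key : ∀ i j : Fin (k + 2), (i - j).val = 1 ↔
      j.val + 1 = i.val ∨ (i.val = 0 ∧ j.val = k + 1) := by
    intro i j
    have hi := i.isLt
    have hj := j.isLt
    rcases le_or_gt j i with h | h
    · rw [Fin.coe_sub_iff_le.2 h]
      have : j.val ≤ i.val := h
      omega
    · rw [Fin.coe_sub_iff_lt.2 h]
      have : i.val < j.val := h
      omega
  rw [cycleGraph_adj', key, key]
  tauto

/-- In a chordal graph, two nonadjacent neighbours of `c` cannot be joined outside the closed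
neighbourhood of `c`. -/
theorem IsChordal.not_reachable (hG : IsChordal G) {c a b : V} (ha : G.Adj c a) (hb : G.Adj c b)
    (hne : a ≠ b) (hab : ¬ G.Adj a b) {A : Set V}
    (hA : ∀ v ∈ A, v = a ∨ v = b ∨ (v ≠ c ∧ ¬ G.Adj c v)) (haA : a ∈ A) (hbA : b ∈ A) :
    ¬ (G.induce A).Reachable ⟨a, haA⟩ ⟨b, hbA⟩ := by
  intro hr
  obtain ⟨p, hp⟩ := hr.exists_walk_length_eq_dist
  have hpath := p.isPath_of_length_eq_dist hp
  set k := p.length with hk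
  have hk2 : 1 < k := by
    rw [hp]
    exact hr.one_lt_dist_of_ne_of_not_adj (fun h => hne (congrArg Subtype.val h)) hab
  let q : ℕ → V := fun i => (p.getVert i).1
  have q0 : q 0 = a := by simp [q]
  have qk : q k = b := by simp [q, hk]
  have qinj : ∀ i ≤ k, ∀ j ≤ k, q i = q j → i = j := fun i hi j hj h =>
    hpath.getVert_injOn hi hj (Subtype.ext h)
  have qstep : ∀ i < k, G.Adj (q i) (q (i + 1)) := fun i hi => p.adj_getVert_succ hi
  -- A chord would shortcut the walk, which has minimum length.
  have qadj : ∀ i j, i < j → j ≤ k → G.Adj (q i) (q j) → j = i + 1 := by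
    intro i j hij hj hadj
    by_contra hne
    have hadj' : (G.induce A).Adj (p.getVert i) (p.getVert j) := hadj
    have := dist_le ((p.take i).append (Walk.cons hadj' (p.drop j)))
    rw [← hp] at this
    simp only [Walk.length_append, Walk.length_cons, Walk.take_length, Walk.drop_length] at this
    omega
  have qc : ∀ i ≤ k, (G.Adj c (q i) ↔ i = 0 ∨ i = k) := by
    intro i hi
    constructor
    · intro h
      rcases hA _ (p.getVert i).2 with h' | h' | h'
      · exact Or.inl (qinj i hi 0 (Nat.zero_le _) (h'.trans q0.symm))
      · exact Or.inr (qinj i hi k le_rfl (h'.trans qk.symm))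
      · exact absurd h h'.2
    · rintro (rfl | rfl)
      · rwa [q0]
      · rwa [qk]
  have qne : ∀ i ≤ k, q i ≠ c := by
    intro i hi h
    rcases hA _ (p.getVert i).2 with h' | h' | h'
    · exact ha.ne (h.symm.trans h')
    · exact hb.ne (h.symm.trans h')
    · exact h'.1 h
  have qadj' : ∀ i ≤ k, ∀ j ≤ k, (G.Adj (q i) (q j) ↔ i + 1 = j ∨ j + 1 = i) := by
    intro i hi j hj
    constructor
    · intro h
      rcases lt_trichotomy i j with hij | rfl | hij
      · exact Or.inl (qadj i j hij hj h).symm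
      · exact absurd h (G.irrefl)
      · exact Or.inr (qadj j i hij hi h.symm).symm
    · rintro (rfl | rfl)
      · exact qstep i hj
      · exact (qstep j hi).symm
  -- The `k + 1` path vertices followed by `c` form an induced cycle; its length is at least four
  -- because `k ≥ 2`.
  let f : Fin (k + 2) → V := fun i => if i.val ≤ k then q i.val else c
  have finj : Function.Injective f := by
    intro i j h
    have hi := i.isLt
    have hj := j.isLt
    apply Fin.ext
    by_cases h1 : i.val ≤ k <;> by_cases h2 : j.val ≤ k <;> simp only [f, h1, h2, if_true, if_false] at h
    · exact qinj _ h1 _ h2 h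
    · exact absurd h (qne _ h1)
    · exact absurd h.symm (qne _ h2)
    · omega
  refine hG (k + 2) (by omega) ⟨⟨⟨f, finj⟩, ?_⟩⟩
  intro i j
  have hi := i.isLt
  have hj := j.isLt
  rw [cycleGraph_adj_val]
  change G.Adj (f i) (f j) ↔ _
  by_cases h1 : i.val ≤ k <;> by_cases h2 : j.val ≤ k <;> simp only [f, h1, h2, if_true, if_false]
  · rw [qadj' _ h1 _ h2]; omega
  · rw [G.adj_comm, qc _ h1]; omega
  · rw [qc _ h2]; omega
  · simp only [SimpleGraph.irrefl, false_iff]; omega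

theorem IsChordal.not_c4 (hG : IsChordal G) {c a b z : V} (ha : G.Adj c a) (hb : G.Adj c b)
    (hne : a ≠ b) (hab : ¬ G.Adj a b) (haz : G.Adj a z) (hzb : G.Adj z b) (hzc : z ≠ c)
    (hcz : ¬ G.Adj c z) : False := by
  refine hG.not_reachable ha hb hne hab (A := {a, b, z}) ?_ (by simp) (by simp) ?_
  · rintro v (rfl | rfl | rfl)
    · simp
    · simp
    · exact Or.inr (Or.inr ⟨hzc, hcz⟩)
  · have h1 : (G.induce {a, b, z}).Adj ⟨a, by simp⟩ ⟨z, by simp⟩ := haz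
    have h2 : (G.induce {a, b, z}).Adj ⟨z, by simp⟩ ⟨b, by simp⟩ := hzb
    exact h1.reachable.trans h2.reachable

/-- Only the chords at `c` and the chord `ab` are excluded; `az` and `yb` may be edges, so no
further case distinction is needed where this is applied. -/
theorem IsChordal.not_c5 (hG : IsChordal G) {c a b y z : V} (ha : G.Adj c a) (hb : G.Adj c b)
    (hne : a ≠ b) (hab : ¬ G.Adj a b) (hay : G.Adj a y) (hyz : G.Adj y z) (hzb : G.Adj z b)
    (hyc : y ≠ c) (hcy : ¬ G.Adj c y) (hzc : z ≠ c) (hcz : ¬ G.Adj c z) : False := by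
  refine hG.not_reachable ha hb hne hab (A := {a, b, y, z}) ?_ (by simp) (by simp) ?_
  · rintro v (rfl | rfl | rfl | rfl)
    · simp
    · simp
    · exact Or.inr (Or.inr ⟨hyc, hcy⟩)
    · exact Or.inr (Or.inr ⟨hzc, hcz⟩)
  · have h1 : (G.induce {a, b, y, z}).Adj ⟨a, by simp⟩ ⟨y, by simp⟩ := hay
    have h2 : (G.induce {a, b, y, z}).Adj ⟨y, by simp⟩ ⟨z, by simp⟩ := hyz
    have h3 : (G.induce {a, b, y, z}).Adj ⟨z, by simp⟩ ⟨b, by simp⟩ := hzb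
    exact (h1.reachable.trans h2.reachable).trans h3.reachable

theorem HFree.k3p2 (hG : HFree K3P2 G) {x y z u v : V} (hxy : G.Adj x y) (hxz : G.Adj x z)
    (hyz : G.Adj y z) (huv : G.Adj u v) (hxu : ¬ G.Adj x u) (hxv : ¬ G.Adj x v)
    (hyu : ¬ G.Adj y u) (hyv : ¬ G.Adj y v) (hzu : ¬ G.Adj z u) (hzv : ¬ G.Adj z v) : False := by
  have d1 : x ≠ u := fun h => hyu (h ▸ hxy.symm)
  have d2 : x ≠ v := fun h => hyv (h ▸ hxy.symm)
  have d3 : y ≠ u := fun h => hxu (h ▸ hxy)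
  have d4 : y ≠ v := fun h => hxv (h ▸ hxy)
  have d5 : z ≠ u := fun h => hxu (h ▸ hxz)
  have d6 : z ≠ v := fun h => hxv (h ▸ hxz)
  have e1 := hxy.ne
  have e2 := hxz.ne
  have e3 := hyz.ne
  have e4 := huv.ne
  have s1 : ∀ {a b : V}, ¬ G.Adj a b → ¬ G.Adj b a := fun h h' => h h'.symm
  refine hG ⟨⟨⟨Sum.elim ![x, y, z] ![u, v], ?_⟩, ?_⟩⟩
  · rintro (i | i) (j | j) h <;> fin_cases i <;> fin_cases j <;>
      first
      | rfl
      | (exfalso; revert h; simp [d1, d2, d3, d4, d5, d6, e1, e2, e3, e4, d1.symm, d2.symm, d3.symm,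
          d4.symm, d5.symm, d6.symm, e1.symm, e2.symm, e3.symm, e4.symm])
  · intro i j
    change G.Adj (Sum.elim ![x, y, z] ![u, v] i) (Sum.elim ![x, y, z] ![u, v] j) ↔ _
    rcases i with i | i <;> rcases j with j | j <;> fin_cases i <;> fin_cases j <;>
      simp [K3P2, pathGraph_adj, hxy, hxy.symm, hxz, hxz.symm, hyz, hyz.symm, huv, huv.symm, hxu,
        hxv, hyu, hyv, hzu, hzv, s1 hxu, s1 hxv, s1 hyu, s1 hyv, s1 hzu, s1 hzv]

/-- The complement of `P` is a triangle `a b c` with a path `a p q` hanging at `a`. All distinctness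
follows from the adjacencies. -/
theorem HFree.coP (hG : HFree WED.coP G) {a b c p q : V} (hab : G.Adj a b) (hac : G.Adj a c)
    (hbc : G.Adj b c) (hap : G.Adj a p) (hpq : G.Adj p q) (hbp : ¬ G.Adj b p) (hcp : ¬ G.Adj c p)
    (haq : ¬ G.Adj a q) (hbq : ¬ G.Adj b q) (hcq : ¬ G.Adj c q) : False := by
  have d1 : b ≠ p := fun h => hcp (h ▸ hbc.symm)
  have d2 : c ≠ p := fun h => hbp (h ▸ hbc)
  have d3 : a ≠ q := fun h => hbq (h ▸ hab.symm)
  have d4 : b ≠ q := fun h => haq (h ▸ hab)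
  have d5 : c ≠ q := fun h => haq (h ▸ hac)
  have e1 := hab.ne
  have e2 := hac.ne
  have e3 := hbc.ne
  have e4 := hap.ne
  have e5 := hpq.ne
  have s1 : ∀ {a b : V}, ¬ G.Adj a b → ¬ G.Adj b a := fun h h' => h h'.symm
  -- The non-edges `qb`, `bp`, `pc`, `cq` are the four-cycle of `P`, and the non-edge `qa` is its
  -- pendant edge.
  refine hG ⟨⟨⟨![q, b, p, c, a], ?_⟩, ?_⟩⟩
  · intro i j h
    fin_cases i <;> fin_cases j <;>
      first
      | rfl
      | (exfalso; revert h; simp [d1, d2, d3, d4, d5, e1, e2, e3, e4, e5, d1.symm, d2.symm, d3.symm,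
          d4.symm, d5.symm, e1.symm, e2.symm, e3.symm, e4.symm, e5.symm])
  · intro i j
    change G.Adj (![q, b, p, c, a] i) (![q, b, p, c, a] j) ↔ _
    fin_cases i <;> fin_cases j <;>
      simp [WED.coP, graphP, hab, hab.symm, hac, hac.symm, hbc, hbc.symm, hap, hap.symm, hpq,
        hpq.symm, hbp, hcp, haq, hbq, hcq, s1 hbp, s1 hcp, s1 haq, s1 hbq, s1 hcq]

/-- `u` and `v` have intersecting closed neighbourhoods. -/
def Close (G : SimpleGraph V) (u v : V) : Prop :=
  ∃ w, (w = u ∨ G.Adj w u) ∧ (w = v ∨ G.Adj w v)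

theorem Close.refl (G : SimpleGraph V) (u : V) : Close G u u := ⟨u, Or.inl rfl, Or.inl rfl⟩

theorem Close.symm {u v : V} (h : Close G u v) : Close G v u :=
  let ⟨w, h1, h2⟩ := h
  ⟨w, h2, h1⟩

theorem _root_.SimpleGraph.Adj.close {u v : V} (h : G.Adj u v) : Close G u v :=
  ⟨u, Or.inl rfl, Or.inr h⟩

/-- `v ∈ S` is a simplicial vertex of the subgraph induced by `S` in the square of `G`. -/
def SimplicialIn (G : SimpleGraph V) (S : Finset V) (v : V) : Prop :=
  v ∈ S ∧ ∀ a ∈ S, ∀ b ∈ S, Close G v a → Close G v b → Close G a b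

/-- Every nonempty induced subgraph of the square of `G` has a simplicial vertex. -/
def SquareChordal (G : SimpleGraph V) : Prop :=
  ∀ S : Finset V, S.Nonempty → ∃ v, SimplicialIn G S v

/-- Any two vertices in the closed neighbourhood of `m` are close through `m`. The choice of `m` is
the whole content of each application. -/
theorem simplicialIn_of_star {S : Finset V} {v m : V} (hv : v ∈ S)
    (h : ∀ a ∈ S, Close G v a → m = a ∨ G.Adj m a) : SimplicialIn G S v :=
  ⟨hv, fun a ha b hb hva hvb => ⟨m, h a ha hva, h b hb hvb⟩⟩

theorem simplicialIn_of_forall {S : Finset V} {v : V} (hv : v ∈ S)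
    (h : ∀ a ∈ S, ∀ b ∈ S, Close G a b) : SimplicialIn G S v :=
  ⟨hv, fun a ha b hb _ _ => h a ha b hb⟩

end WED

/-! ### Efficient dominating sets, and components without triangles -/

namespace WED

open SimpleGraph

variable {V : Type*} {G : SimpleGraph V}

theorem IsEDS.eq {D : Finset V} (hD : IsEDS G D) {d d' v : V} (hd : d ∈ D) (hd' : d' ∈ D)
    (h : d = v ∨ G.Adj d v) (h' : d' = v ∨ G.Adj d' v) : d = d' :=
  (hD v).unique ⟨hd, h⟩ ⟨hd', h'⟩

theorem IsEDS.not_adj {D : Finset V} (hD : IsEDS G D) {d d' : V} (hd : d ∈ D) (hd' : d' ∈ D) :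
    ¬ G.Adj d d' := fun h => h.ne (hD.eq hd hd' (Or.inr h) (Or.inl rfl))

theorem IsEDS.not_mem_of_adj {D : Finset V} (hD : IsEDS G D) {d v : V} (hd : d ∈ D)
    (h : G.Adj d v) : v ∉ D := fun hv => hD.not_adj hd hv h

theorem IsEDS.exists_adj {D : Finset V} (hD : IsEDS G D) {v : V} (hv : v ∉ D) :
    ∃ d ∈ D, G.Adj d v := by
  obtain ⟨d, ⟨hd, rfl | h⟩, -⟩ := hD v
  · exact absurd hd hv
  · exact ⟨d, hd, h⟩

theorem dist_le_dist_succ {r u v : V} (hr : G.Reachable r u) (h : G.Adj u v) :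
    G.dist r v ≤ G.dist r u + 1 := by
  obtain ⟨p, hp⟩ := hr.exists_walk_length_eq_dist
  simpa [hp] using dist_le (p.concat h)

theorem exists_adj_dist_succ {r v : V} (hr : G.Reachable r v) (hne : v ≠ r) :
    ∃ u, G.Adj u v ∧ G.dist r u + 1 = G.dist r v := by
  obtain ⟨p, hp⟩ := hr.symm.exists_walk_length_eq_dist
  cases p with
  | nil => exact absurd rfl hne
  | @cons _ u _ h p =>
    refine ⟨u, h.symm, le_antisymm ?_ (dist_le_dist_succ (hr.trans h.reachable) h.symm)⟩
    rw [dist_comm (u := r) (v := v), ← hp, dist_comm]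
    simpa using dist_le p

/-- In a chordal graph without triangles in the component of `r`, each vertex of this component
has at most one neighbour that is not farther from `r`. -/
theorem IsChordal.eq_of_dist_le (hG : IsChordal G) {r : V}
    (htri : ∀ x y z, G.Reachable r x → G.Adj x y → G.Adj x z → ¬ G.Adj y z)
    {c a b : V} (hc : G.Reachable r c) (ha : G.Adj c a) (hb : G.Adj c b)
    (hda : G.dist r a ≤ G.dist r c) (hdb : G.dist r b ≤ G.dist r c) : a = b := by
  by_contra hne
  have hab : ¬ G.Adj a b := htri c a b hc ha hb
  let A : Set V := {v | v = a ∨ v = b ∨ (v ≠ c ∧ ¬ G.Adj c v)}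
  -- Descending from `a` or `b` towards `r` never enters the closed neighbourhood of `c`: the first
  -- step would close a triangle, and later vertices are too near to `r`. So `a` and `b` are joined
  -- through `r` inside `A`.
  have key : ∀ m, ∀ v, G.dist r v = m → G.Reachable r v → ∀ hv : v ∈ A,
      (v = a ∨ v = b ∨ G.dist r v < G.dist r c) →
      ∃ hr : r ∈ A, (G.induce A).Reachable ⟨v, hv⟩ ⟨r, hr⟩ := by
    intro m
    induction m with
    | zero =>
      intro v hm hr hv _
      obtain rfl := hr.dist_eq_zero_iff.1 hm
      exact ⟨hv, Reachable.refl _⟩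
    | succ m ih =>
      intro v hm hr hv hlt
      have hvr : v ≠ r := by
        rintro rfl
        simp at hm
      obtain ⟨u, huv, hu⟩ := exists_adj_dist_succ hr hvr
      have hru : G.Reachable r u := hr.trans huv.symm.reachable
      have hlt' : G.dist r u < G.dist r c := by
        rcases hlt with rfl | rfl | h <;> omega
      have huA : u ∈ A := by
        refine Or.inr (Or.inr ⟨fun h => by simp [h] at hlt', fun hcu => ?_⟩)
        rcases hlt with rfl | rfl | h
        · exact htri c u v hc hcu ha huv
        · exact htri c u v hc hcu hb huv
        · have := dist_le_dist_succ hru hcu.symm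
          omega
      obtain ⟨hrA, hreach⟩ := ih u (by omega) hru huA (Or.inr (Or.inr hlt'))
      have hadj : (G.induce A).Adj ⟨v, hv⟩ ⟨u, huA⟩ := huv.symm
      exact ⟨hrA, hadj.reachable.trans hreach⟩
  obtain ⟨hr1, h1⟩ := key _ a rfl (hc.trans ha.reachable) (Or.inl rfl) (Or.inl rfl)
  obtain ⟨hr2, h2⟩ := key _ b rfl (hc.trans hb.reachable) (Or.inr (Or.inl rfl))
    (Or.inr (Or.inl rfl))
  exact hG.not_reachable ha hb hne hab (fun v hv => hv) _ _ (h1.trans h2.symm)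

/-- The component of `r` is a tree rooted at `r`. For a deepest vertex of `S` in it, children and
grandchildren lie outside `S`, so the vertices of `S` close to it are in the closed neighbourhood of
its parent. -/
theorem IsChordal.exists_simplicialIn_of_forest (hG : IsChordal G) {r : V}
    (htri : ∀ x y z, G.Reachable r x → G.Adj x y → G.Adj x z → ¬ G.Adj y z)
    {S : Finset V} (hrS : r ∈ S) : ∃ v, SimplicialIn G S v := by
  classical
  obtain ⟨v, hv, hmax⟩ := Finset.exists_max_image (S.filter fun v => G.Reachable r v)
    (fun v => G.dist r v) ⟨r, by simp [hrS]⟩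
  simp only [Finset.mem_filter] at hv hmax
  obtain ⟨hvS, hrv⟩ := hv
  have hreach : ∀ a, Close G v a → G.Reachable r a := by
    rintro a ⟨w, rfl | h1, rfl | h2⟩
    · exact hrv
    · exact hrv.trans h2.reachable
    · exact hrv.trans h1.symm.reachable
    · exact (hrv.trans h1.symm.reachable).trans h2.reachable
  by_cases hvr : v = r
  · subst hvr
    refine ⟨v, simplicialIn_of_star (m := v) hvS fun a ha hva => Or.inl ?_⟩
    have h1 := hmax a ⟨ha, hreach a hva⟩
    simp only [dist_self, Nat.le_zero] at h1
    exact (hreach a hva).dist_eq_zero_iff.1 h1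
  · obtain ⟨p, hpv, hp⟩ := exists_adj_dist_succ hrv hvr
    have hpar : ∀ a, G.Adj v a → G.dist r a ≤ G.dist r v → p = a := fun a h hd =>
      hG.eq_of_dist_le htri hrv hpv.symm h (by omega) hd
    refine ⟨v, simplicialIn_of_star (m := p) hvS fun a ha hva => ?_⟩
    have hda := hmax a ⟨ha, hreach a hva⟩
    obtain ⟨w, rfl | h1, rfl | h2⟩ := hva
    · exact Or.inr hpv
    · exact Or.inl (hpar _ h2 hda)
    · exact Or.inl (hpar _ h1.symm hda)
    -- A common neighbour `w` is the parent of `v`, or it is farther from `r` and then `v` and `a`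
    -- are both its unique parent.
    · by_cases hw : G.dist r w ≤ G.dist r v
      · obtain rfl := hpar w h1.symm hw
        exact Or.inr h2
      · have := hG.eq_of_dist_le htri (hrv.trans h1.symm.reachable) h1 h2 (by omega) (by omega)
        exact Or.inr (this ▸ hpv)

end WED

/-! ### Chordal graphs without K₃ + P₂ -/

namespace WED

open SimpleGraph

variable {V : Type*} {G : SimpleGraph V}

/-- Each edge between a vertex outside the closed neighbourhood of `d` and its dominator must touch
or see every triangle. Applied to `d x y`, this makes the neighbourhoods of the other vertices of
`D` cliques. Applied to the remaining triangles, it makes their vertices close to almost everything;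
vertices in no such triangle are attached at a single vertex. -/
theorem K3P2Free.simplicialIn_of_triangle (hG : IsChordal G) (hF : HFree K3P2 G) {D : Finset V}
    (hD : IsEDS G D) {d x y : V} (hd : d ∈ D) (hdx : G.Adj d x) (hdy : G.Adj d y)
    (hxy : G.Adj x y) {S : Finset V} (hS : S.Nonempty) : ∃ v, SimplicialIn G S v := by
  have notx : ∀ {d'}, d' ∈ D → d' ≠ d → ¬ G.Adj d' x := fun h hne h' =>
    hne (hD.eq h hd (Or.inr h') (Or.inr hdx))
  have noty : ∀ {d'}, d' ∈ D → d' ≠ d → ¬ G.Adj d' y := fun h hne h' =>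
    hne (hD.eq h hd (Or.inr h') (Or.inr hdy))
  have hxD := hD.not_mem_of_adj hd hdx
  have hyD := hD.not_mem_of_adj hd hdy
  -- Otherwise `v` and its dominator would form an edge anticomplete to the triangle `d x y`.
  have hM : ∀ v, v ∉ D → ¬ G.Adj d v → G.Adj x v ∨ G.Adj y v := by
    intro v hv hdv
    obtain ⟨e, he, hev⟩ := hD.exists_adj hv
    have hed : e ≠ d := fun h => hdv (h ▸ hev)
    by_contra! hcon
    exact hF.k3p2 hdx hdy hxy hev (hD.not_adj hd he) hdv (fun h => notx he hed h.symm) hcon.1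
      (fun h => noty he hed h.symm) hcon.2
  have hnd : ∀ {e z}, e ∈ D → e ≠ d → G.Adj e z → z ∉ D ∧ ¬ G.Adj d z := fun he hne h =>
    ⟨hD.not_mem_of_adj he h, fun h' => hne (hD.eq he hd (Or.inr h) (Or.inr h'))⟩
  -- Two nonadjacent neighbours of `e` would be joined through `x` and `y`, which `e` does not see,
  -- so a four- or five-cycle contradicts chordality.
  have hclq : ∀ e ∈ D, e ≠ d → ∀ z z', G.Adj e z → G.Adj e z' → z ≠ z' → G.Adj z z' := by
    intro e he hed z z' hz hz' hne
    by_contra hcon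
    have hex := notx he hed
    have hey := noty he hed
    have hxe : x ≠ e := fun h => hxD (h ▸ he)
    have hye : y ≠ e := fun h => hyD (h ▸ he)
    obtain ⟨h1, h2⟩ := hnd he hed hz
    obtain ⟨h3, h4⟩ := hnd he hed hz'
    rcases hM z h1 h2 with h | h <;> rcases hM z' h3 h4 with h' | h'
    · exact hG.not_c4 hz hz' hne hcon h.symm h' hxe hex
    · exact hG.not_c5 hz hz' hne hcon h.symm hxy h' hxe hex hye hey
    · exact hG.not_c5 hz hz' hne hcon h.symm hxy.symm h' hye hey hxe hex
    · exact hG.not_c4 hz hz' hne hcon h.symm h' hye hey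
  let R : V → Prop := fun v => v ∈ D → v = d
  let Tri : V → Prop := fun w => ∃ q r, G.Adj w q ∧ G.Adj w r ∧ G.Adj q r ∧ R w ∧ R q ∧ R r
  -- The edge from `v` to its dominator `e` sees the triangle. A triangle vertex seeing `e` lies in
  -- the clique of neighbours of `e`, hence equals or sees `v`.
  have hTri : ∀ w, Tri w → ∀ v, v ∉ D → ¬ G.Adj d v → Close G w v := by
    rintro w ⟨q, r, hwq, hwr, hqr, hw, hq, hr⟩ v hv hdv
    obtain ⟨e, he, hev⟩ := hD.exists_adj hv
    have hed : e ≠ d := fun h => hdv (h ▸ hev)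
    have aux : ∀ t, R t → G.Adj t e → t = v ∨ G.Adj t v := by
      intro t _ hte
      by_cases h : t = v
      · exact Or.inl h
      · exact Or.inr (hclq e he hed t v hte.symm hev h)
    have step : ∀ t, (t = w ∨ G.Adj t w) → (t = v ∨ G.Adj t v) → Close G w v :=
      fun t h h' => ⟨t, h, h'⟩
    by_contra hcon
    have n1 : ¬ G.Adj w v := fun h => hcon (step w (Or.inl rfl) (Or.inr h))
    have n2 : ¬ G.Adj q v := fun h => hcon (step q (Or.inr hwq.symm) (Or.inr h))
    have n3 : ¬ G.Adj r v := fun h => hcon (step r (Or.inr hwr.symm) (Or.inr h))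
    have n4 : ¬ G.Adj w e := fun h => hcon (step w (Or.inl rfl) (aux w hw h))
    have n5 : ¬ G.Adj q e := fun h => hcon (step q (Or.inr hwq.symm) (aux q hq h))
    have n6 : ¬ G.Adj r e := fun h => hcon (step r (Or.inr hwr.symm) (aux r hr h))
    exact hF.k3p2 hwq hwr hqr hev n4 n1 n5 n2 n6 n3
  -- `v` sees `x` or `y`; if that vertex is not `w` itself, the four-cycle through `d`, `w`, `v`
  -- forces it to see `w`.
  have hnb : ∀ w v, G.Adj d w → G.Adj w v → v ∉ D → ¬ G.Adj d v → ∃ u, G.Adj d u ∧ G.Adj w u := by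
    intro w v hdw hwv hv hdv
    by_contra! hcon
    have aux : ∀ t, G.Adj d t → G.Adj t v → ¬ t = w → ¬ G.Adj w t → False := fun t hdt htv h1 h2 =>
      hG.not_c4 hdw hdt (Ne.symm h1) h2 hwv htv.symm (fun h => hv (h ▸ hd)) hdv
    rcases hM v hv hdv with h | h
    · by_cases hxw : x = w
      · exact hcon y hdy (hxw ▸ hxy)
      · exact aux x hdx h hxw (hcon x hdx)
    · by_cases hyw : y = w
      · exact hcon x hdx (hyw ▸ hxy.symm)
      · exact aux y hdy h hyw (hcon y hdy)
  have hRadj : ∀ {v}, G.Adj d v → R v := fun h h' => absurd h' (hD.not_mem_of_adj hd h)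
  have hcl : ∀ w u, G.Adj d w → G.Adj d u → G.Adj w u → ∀ v, R v → Close G w v := by
    intro w u hdw hdu hwu v hv
    by_cases hvD : v ∈ D
    · exact hv hvD ▸ hdw.symm.close
    · by_cases hdv : G.Adj d v
      · exact ⟨d, Or.inr hdw, Or.inr hdv⟩
      · exact hTri w ⟨d, u, hdw.symm, hwu, hdu, hRadj hdw, fun _ => rfl, hRadj hdu⟩ v hvD hdv
  -- A second neighbour `u` satisfying `R` would either form a triangle with `w` and `t`, contrary
  -- to `¬ Tri w`, or lie on a chordless four-cycle.
  have hclM : ∀ w, w ∉ D → ¬ G.Adj d w → ¬ Tri w →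
      ∃ t, (t = x ∨ t = y) ∧ G.Adj t w ∧ ∀ u, R u → G.Adj w u → u = t := by
    intro w hw hdw hT
    have hRw : R w := fun h => absurd h hw
    have aux : ∀ t t', G.Adj d t → G.Adj d t' → G.Adj t t' → G.Adj t w →
        (∀ v, v ∉ D → ¬ G.Adj d v → G.Adj t v ∨ G.Adj t' v) → ∀ u, R u → G.Adj w u → u = t := by
      intro t t' hdt hdt' htt' htw hM' u hu hwu
      by_contra hne
      have htu : ¬ G.Adj t u := fun h => hT ⟨t, u, htw.symm, hwu, h, hRw, hRadj hdt, hu⟩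
      have ht'w : ¬ G.Adj w t' := fun h =>
        hT ⟨t, t', htw.symm, h, htt', hRw, hRadj hdt, hRadj hdt'⟩
      by_cases hdu : G.Adj d u
      · exact hG.not_c4 htw.symm hwu (Ne.symm hne) htu hdt.symm hdu (fun h => hw (h ▸ hd))
          (fun h => hdw h.symm)
      · have huD : u ∉ D := fun h => hdw ((hu h) ▸ hwu.symm)
        rcases hM' u huD hdu with h | h
        · exact htu h
        · exact hG.not_c4 htw.symm hwu (Ne.symm hne) htu htt' h (fun h => hdw (h ▸ hdt')) ht'w
    rcases hM w hw hdw with h | h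
    · exact ⟨x, Or.inl rfl, h, aux x y hdx hdy hxy h hM⟩
    · exact ⟨y, Or.inr rfl, h, aux y x hdy hdx hxy.symm h fun v h1 h2 => (hM v h1 h2).symm⟩
  -- vertices that are close to each other
  let K : V → Prop := fun a => a = d ∨ (G.Adj d a ∧ ∃ u, G.Adj d u ∧ G.Adj a u) ∨
    (a ∉ D ∧ ¬ G.Adj d a ∧ Tri a)
  have hKR : ∀ a, K a → R a := by
    rintro a (rfl | ⟨h, -⟩ | ⟨h, -⟩)
    · exact fun _ => rfl
    · exact hRadj h
    · exact fun h' => absurd h' h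
  have hK : ∀ a b, K a → K b → Close G a b := by
    intro a b ha hb
    have hdK : ∀ b, K b → Close G d b := by
      rintro b (rfl | ⟨h, -⟩ | ⟨h1, h2, -⟩)
      · exact Close.refl _ _
      · exact h.close
      · exact hTri d ⟨x, y, hdx, hdy, hxy, fun _ => rfl, hRadj hdx, hRadj hdy⟩ b h1 h2
    rcases ha with rfl | ⟨h, u, hu, hau⟩ | ⟨h1, h2, h3⟩
    · exact hdK b hb
    · exact hcl a u h hu hau b (hKR b hb)
    · rcases hb with rfl | ⟨h', u, hu, hbu⟩ | ⟨h1', h2', h3'⟩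
      · exact (hdK a (Or.inr (Or.inr ⟨h1, h2, h3⟩))).symm
      · exact (hcl b u h' hu hbu a fun h => absurd h h1).symm
      · exact hTri a h3 b h1' h2'
  -- A vertex `e` of `D` other than `d` is itself simplicial: with two neighbours, all vertices
  -- close to it except `e` satisfy `K`; with at most one, a star suffices.
  by_cases hA : ∃ e ∈ S, e ∈ D ∧ e ≠ d
  · obtain ⟨e, heS, he, hed⟩ := hA
    by_cases h1 : ∃ z z', G.Adj e z ∧ G.Adj e z' ∧ z ≠ z'
    · obtain ⟨z, z', hz, hz', hzz⟩ := h1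
      have hKe : ∀ a, Close G e a → a ≠ e → K a := by
        intro a hca hae
        obtain ⟨m, hem, ham⟩ : ∃ m, G.Adj e m ∧ (m = a ∨ G.Adj m a) := by
          obtain ⟨m, rfl | h1, h2⟩ := hca
          · exact ⟨a, h2.resolve_left hae.symm, Or.inl rfl⟩
          · exact ⟨m, h1.symm, h2⟩
        obtain ⟨hmD, hdm⟩ := hnd he hed hem
        have haD : a ∉ D := by
          rcases ham with rfl | h
          · exact hmD
          · exact fun h' => hae (hD.eq h' he (Or.inr h.symm) (Or.inr hem))
        by_cases hda : G.Adj d a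
        · have hma : G.Adj m a := ham.resolve_left fun h => hdm (h ▸ hda)
          exact Or.inr (Or.inl ⟨hda, hnb a m hda hma.symm hmD hdm⟩)
        · refine Or.inr (Or.inr ⟨haD, hda, ?_⟩)
          by_contra hT
          obtain ⟨t, ht, -, ht'⟩ := hclM a haD hda hT
          -- If `a` is a neighbour of `e`, the second neighbour of `e` serves, since these
          -- neighbours form a clique. Then `m'` would be `x` or `y`, which `e` does not see.
          obtain ⟨m', hem', hm'a⟩ : ∃ m', G.Adj e m' ∧ G.Adj a m' := by
            rcases ham with rfl | h
            · by_cases h : m = z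
              · exact ⟨z', hz', hclq e he hed m z' hem hz' (h ▸ hzz)⟩
              · exact ⟨z, hz, hclq e he hed m z hem hz h⟩
            · exact ⟨m, hem, h.symm⟩
          have := ht' m' (fun h => absurd h (hnd he hed hem').1) hm'a
          rcases ht with rfl | rfl
          · exact notx he hed (this ▸ hem')
          · exact noty he hed (this ▸ hem')
      refine ⟨e, heS, fun a _ b _ ha hb => ?_⟩
      by_cases hae : a = e
      · exact hae ▸ hb
      · by_cases hbe : b = e
        · exact hbe ▸ ha.symm
        · exact hK a b (hKe a ha hae) (hKe b hb hbe)
    · push Not at h1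
      by_cases h2 : ∃ m, G.Adj e m
      · obtain ⟨m, hem⟩ := h2
        refine ⟨e, simplicialIn_of_star (m := m) heS fun a _ ha => ?_⟩
        obtain ⟨w, rfl | h3, rfl | h4⟩ := ha
        · exact Or.inr hem.symm
        · exact Or.inl (h1 _ _ hem h4)
        · exact Or.inl (h1 _ _ hem h3.symm)
        · exact Or.inr (h1 _ _ hem h3.symm ▸ h4)
      · push Not at h2
        refine ⟨e, simplicialIn_of_star (m := e) heS fun a _ ha => ?_⟩
        obtain ⟨w, rfl | h3, h4⟩ := ha
        · exact h4
        · exact absurd h3.symm (h2 w)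
  · push Not at hA
    have hSR : ∀ a ∈ S, R a := fun a ha => hA a ha
    -- Such a `w` is a leaf attached to `d`.
    by_cases hB : ∃ w ∈ S, G.Adj d w ∧ ¬ ∃ u, G.Adj d u ∧ G.Adj w u
    · obtain ⟨w, hwS, hdw, hno⟩ := hB
      have hwd : ∀ u, G.Adj w u → u = d := by
        intro u hwu
        by_contra hne
        by_cases huD : u ∈ D
        · exact hne (hD.eq huD hd (Or.inr hwu.symm) (Or.inr hdw))
        · by_cases hdu : G.Adj d u
          · exact hno ⟨u, hdu, hwu⟩
          · exact hno (hnb w u hdw hwu huD hdu)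
      refine ⟨w, simplicialIn_of_star (m := d) hwS fun a _ ha => ?_⟩
      obtain ⟨m, rfl | h3, rfl | h4⟩ := ha
      · exact Or.inr hdw
      · exact Or.inl (hwd _ h4).symm
      · exact Or.inl (hwd _ h3.symm).symm
      · exact Or.inr (hwd _ h3.symm ▸ h4)
    -- The centre is the only neighbour `t` of `w` satisfying `R`. A common neighbour in `D` makes
    -- `w` and `a` adjacent by `hclq`, so again `a = t`.
    · by_cases hC : ∃ w ∈ S, w ∉ D ∧ ¬ G.Adj d w ∧ ¬ Tri w
      · obtain ⟨w, hwS, hwD, hdw, hT⟩ := hC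
        obtain ⟨t, -, htw, ht⟩ := hclM w hwD hdw hT
        refine ⟨w, simplicialIn_of_star (m := t) hwS fun a haS ha => ?_⟩
        have hRa := hSR a haS
        obtain ⟨m, rfl | h3, rfl | h4⟩ := ha
        · exact Or.inr htw
        · exact Or.inl (ht _ hRa h4).symm
        · exact Or.inl (ht _ hRa h3.symm).symm
        · by_cases hmR : R m
          · exact Or.inr (ht _ hmR h3.symm ▸ h4)
          · obtain ⟨hmD, hmd⟩ : m ∈ D ∧ m ≠ d := by
              simpa [R] using hmR
            by_cases haw : w = a
            · exact Or.inr (haw ▸ htw)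
            · exact Or.inl (ht _ hRa (hclq m hmD hmd w a h3 h4 haw)).symm
      · obtain ⟨v, hv⟩ := hS
        have hSK : ∀ a ∈ S, K a := by
          intro a ha
          by_cases haD : a ∈ D
          · exact Or.inl (hSR a ha haD)
          · by_cases hda : G.Adj d a
            · refine Or.inr (Or.inl ⟨hda, ?_⟩)
              by_contra h
              exact hB ⟨a, ha, hda, h⟩
            · refine Or.inr (Or.inr ⟨haD, hda, ?_⟩)
              by_contra h
              exact hC ⟨a, ha, haD, hda, h⟩
        exact ⟨v, simplicialIn_of_forall hv fun a ha b hb => hK a b (hSK a ha) (hSK b hb)⟩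

/-- Since no vertex of `D` is in a triangle, vertices outside `D` and away from the triangle `x y z`
are leaves, and each vertex of `D` has at most one neighbour in the closed neighbourhood of the
triangle. The latter forces the vertices of all triangles to be pairwise close. -/
theorem K3P2Free.simplicialIn_of_not_triangle (hG : IsChordal G) (hF : HFree K3P2 G)
    {D : Finset V} (hD : IsEDS G D)
    (hno : ∀ d ∈ D, ∀ x y, G.Adj d x → G.Adj d y → ¬ G.Adj x y)
    {x y z : V} (hxy : G.Adj x y) (hxz : G.Adj x z) (hyz : G.Adj y z)
    {S : Finset V} (hS : S.Nonempty) : ∃ v, SimplicialIn G S v := by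
  -- closed neighbourhood of a triangle
  let N : V → V → V → V → Prop := fun p q r v =>
    (p = v ∨ G.Adj p v) ∨ (q = v ∨ G.Adj q v) ∨ (r = v ∨ G.Adj r v)
  have hxD : x ∉ D := fun h => hno x h y z hxy hxz hyz
  have hyD : y ∉ D := fun h => hno y h x z hxy.symm hyz hxz
  have hzD : z ∉ D := fun h => hno z h x y hxz.symm hyz.symm hxy
  -- two neighbours of a vertex outside the triangle that are joined through the triangle
  have join : ∀ c u v, c ≠ x → c ≠ y → c ≠ z → G.Adj c u → G.Adj c v → u ≠ v → ¬ G.Adj u v →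
      N x y z u → N x y z v → ∃ t, (t = x ∨ t = y ∨ t = z) ∧ G.Adj c t := by
    intro c u v hcx hcy hcz hcu hcv hne huv hu hv
    by_contra! hcon
    have n1 := hcon x (by simp)
    have n2 := hcon y (by simp)
    have n3 := hcon z (by simp)
    have hu' : G.Adj u x ∨ G.Adj u y ∨ G.Adj u z := by
      rcases hu with (rfl | h) | (rfl | h) | (rfl | h)
      · exact absurd hcu n1
      · exact Or.inl h.symm
      · exact absurd hcu n2
      · exact Or.inr (Or.inl h.symm)
      · exact absurd hcu n3
      · exact Or.inr (Or.inr h.symm)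
    have hv' : G.Adj x v ∨ G.Adj y v ∨ G.Adj z v := by
      rcases hv with (rfl | h) | (rfl | h) | (rfl | h)
      · exact absurd hcv n1
      · exact Or.inl h
      · exact absurd hcv n2
      · exact Or.inr (Or.inl h)
      · exact absurd hcv n3
      · exact Or.inr (Or.inr h)
    rcases hu' with h | h | h <;> rcases hv' with h' | h' | h'
    · exact hG.not_c4 hcu hcv hne huv h h' hcx.symm n1
    · exact hG.not_c5 hcu hcv hne huv h hxy h' hcx.symm n1 hcy.symm n2
    · exact hG.not_c5 hcu hcv hne huv h hxz h' hcx.symm n1 hcz.symm n3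
    · exact hG.not_c5 hcu hcv hne huv h hxy.symm h' hcy.symm n2 hcx.symm n1
    · exact hG.not_c4 hcu hcv hne huv h h' hcy.symm n2
    · exact hG.not_c5 hcu hcv hne huv h hyz h' hcy.symm n2 hcz.symm n3
    · exact hG.not_c5 hcu hcv hne huv h hxz.symm h' hcz.symm n3 hcx.symm n1
    · exact hG.not_c5 hcu hcv hne huv h hyz.symm h' hcz.symm n3 hcy.symm n2
    · exact hG.not_c4 hcu hcv hne huv h h' hcz.symm n3
  have hNT : ∀ t, (t = x ∨ t = y ∨ t = z) → N x y z t := by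
    rintro t (rfl | rfl | rfl)
    · exact Or.inl (Or.inl rfl)
    · exact Or.inr (Or.inl (Or.inl rfl))
    · exact Or.inr (Or.inr (Or.inl rfl))
  have hNadj : ∀ t v, (t = x ∨ t = y ∨ t = z) → G.Adj t v → N x y z v := by
    rintro t v (rfl | rfl | rfl) h
    · exact Or.inl (Or.inr h)
    · exact Or.inr (Or.inl (Or.inr h))
    · exact Or.inr (Or.inr (Or.inr h))
  have hTD : ∀ t, (t = x ∨ t = y ∨ t = z) → t ∉ D := by
    rintro t (rfl | rfl | rfl)
    · exact hxD
    · exact hyD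
    · exact hzD
  -- All neighbours of `v` lie in `N x y z`, as a K₃ + P₂ would appear otherwise. A second neighbour
  -- besides `d` is not adjacent to `d`, so `join` would make `v` see the triangle.
  have hleaf : ∀ v, v ∉ D → ¬ N x y z v → ∃ d ∈ D, G.Adj d v ∧ ∀ u, G.Adj v u → u = d := by
    intro v hv hN
    obtain ⟨d, hd, hdv⟩ := hD.exists_adj hv
    refine ⟨d, hd, hdv, fun u hvu => ?_⟩
    by_contra hne
    have nv : ∀ t, (t = x ∨ t = y ∨ t = z) → ¬ G.Adj t v := fun t ht h => hN (hNadj t v ht h)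
    have hadj : ∀ w, G.Adj v w → N x y z w := by
      intro w hvw
      by_contra hNw
      have nw : ∀ t, (t = x ∨ t = y ∨ t = z) → ¬ G.Adj t w := fun t ht h => hNw (hNadj t w ht h)
      exact hF.k3p2 hxy hxz hyz hvw (nv x (by simp)) (nw x (by simp)) (nv y (by simp))
        (nw y (by simp)) (nv z (by simp)) (nw z (by simp))
    have hvT : ∀ t, (t = x ∨ t = y ∨ t = z) → v ≠ t := fun t ht h => hN (h ▸ hNT t ht)
    obtain ⟨t, ht, hvt⟩ := join v d u (hvT x (by simp)) (hvT y (by simp)) (hvT z (by simp))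
      hdv.symm hvu (Ne.symm hne) (fun h => hno d hd v u hdv h hvu) (hadj d hdv.symm) (hadj u hvu)
    exact nv t ht hvt.symm
  -- If `d` sees a triangle vertex `t`, another neighbour in `N x y z` gives a chordless four-cycle;
  -- this is `aux`. In general, two such neighbours are nonadjacent and `join` supplies that `t`.
  have huniq : ∀ d ∈ D, ∀ u v, G.Adj d u → G.Adj d v → N x y z u → N x y z v → u = v := by
    have aux : ∀ d ∈ D, ∀ t v, (t = x ∨ t = y ∨ t = z) → G.Adj d t → G.Adj d v → N x y z v →
        t = v := by
      intro d hd t v ht hdt hdv hv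
      by_contra hne
      have htv := hno d hd t v hdt hdv
      have : ∃ t', (t' = x ∨ t' = y ∨ t' = z) ∧ G.Adj t t' ∧ G.Adj t' v := by
        rcases ht with rfl | rfl | rfl <;>
          rcases hv with (rfl | h) | (rfl | h) | (rfl | h) <;>
          first
          | exact absurd rfl hne
          | exact absurd h htv
          | exact absurd hxy htv
          | exact absurd hxz htv
          | exact absurd hyz htv
          | exact absurd hxy.symm htv
          | exact absurd hxz.symm htv
          | exact absurd hyz.symm htv
          | exact ⟨x, by simp, hxy.symm, h⟩
          | exact ⟨x, by simp, hxz.symm, h⟩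
          | exact ⟨y, by simp, hxy, h⟩
          | exact ⟨y, by simp, hyz.symm, h⟩
          | exact ⟨z, by simp, hxz, h⟩
          | exact ⟨z, by simp, hyz, h⟩
      obtain ⟨t', ht', htt', ht'v⟩ := this
      exact hG.not_c4 hdt hdv hne htv htt' ht'v (fun h => hTD t' ht' (h ▸ hd))
        (fun h => hno d hd t t' hdt h htt')
    intro d hd u v hdu hdv hu hv
    by_contra hne
    obtain ⟨t, ht, hdt⟩ := join d u v (fun h => hxD (h ▸ hd)) (fun h => hyD (h ▸ hd))
      (fun h => hzD (h ▸ hd)) hdu hdv hne (hno d hd u v hdu hdv) hu hv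
    exact hne ((aux d hd t u ht hdt hdu hu).symm.trans (aux d hd t v ht hdt hdv hv))
  have htriN : ∀ p q r, G.Adj p q → G.Adj p r → G.Adj q r → p ∉ D ∧ N x y z p := by
    intro p q r hpq hpr hqr
    have hp : p ∉ D := fun h => hno p h q r hpq hpr hqr
    refine ⟨hp, ?_⟩
    by_contra hN
    obtain ⟨d, hd, -, h⟩ := hleaf p hp hN
    exact hqr.ne ((h q hpq).trans (h r hpr).symm)
  -- The edge from `v` to its dominator `d` sees the triangle `p q r`. A triangle vertex seeing `d`
  -- lies in `N x y z` by `htriN`, hence equals `v` by `huniq`.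
  have hdom : ∀ p q r, G.Adj p q → G.Adj p r → G.Adj q r → ∀ v, v ∉ D → N x y z v →
      Close G p v := by
    intro p q r hpq hpr hqr v hv hvN
    obtain ⟨d, hd, hdv⟩ := hD.exists_adj hv
    have aux : ∀ t, N x y z t → G.Adj t d → t = v := fun t ht h => huniq d hd t v h.symm hdv ht hvN
    have step : ∀ t, (t = p ∨ G.Adj t p) → (t = v ∨ G.Adj t v) → Close G p v :=
      fun t h h' => ⟨t, h, h'⟩
    have hp := (htriN p q r hpq hpr hqr).2
    have hq := (htriN q p r hpq.symm hqr hpr).2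
    have hr := (htriN r p q hpr.symm hqr.symm hpq).2
    by_contra hcon
    have n1 : ¬ G.Adj p v := fun h => hcon (step p (Or.inl rfl) (Or.inr h))
    have n2 : ¬ G.Adj q v := fun h => hcon (step q (Or.inr hpq.symm) (Or.inr h))
    have n3 : ¬ G.Adj r v := fun h => hcon (step r (Or.inr hpr.symm) (Or.inr h))
    have n4 : ¬ G.Adj p d := fun h => hcon (step p (Or.inl rfl) (Or.inl (aux p hp h)))
    have n5 : ¬ G.Adj q d := fun h => hcon (step q (Or.inr hpq.symm) (Or.inl (aux q hq h)))
    have n6 : ¬ G.Adj r d := fun h => hcon (step r (Or.inr hpr.symm) (Or.inl (aux r hr h)))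
    exact hF.k3p2 hpq hpr hqr hdv n4 n1 n5 n2 n6 n3
  by_cases hA : ∃ v ∈ S, v ∉ D ∧ ¬ N x y z v
  · obtain ⟨v, hvS, hv, hN⟩ := hA
    obtain ⟨d, hd, hdv, h⟩ := hleaf v hv hN
    refine ⟨v, simplicialIn_of_star (m := d) hvS fun a _ ha => ?_⟩
    obtain ⟨w, rfl | h3, rfl | h4⟩ := ha
    · exact Or.inr hdv
    · exact Or.inl (h _ h4).symm
    · exact Or.inl (h _ h3.symm).symm
    · exact Or.inr (h _ h3.symm ▸ h4)
  have hSN : ∀ v ∈ S, v ∉ D → N x y z v := fun v hv hvD => by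
    by_contra h
    exact hA ⟨v, hv, hvD, h⟩
  -- The leaves are gone from `S`. The centre is the unique neighbour of `d` in `N x y z`, or `d`
  -- itself if there is none.
  by_cases hB : ∃ d ∈ S, d ∈ D
  · obtain ⟨d, hdS, hd⟩ := hB
    have hfar : ∀ m a, G.Adj d m → G.Adj m a → a ≠ d → N x y z m := by
      intro m a hdm hma hne
      by_contra hN
      obtain ⟨e, -, -, h⟩ := hleaf m (hD.not_mem_of_adj hd hdm) hN
      exact hne ((h a hma).trans (h d hdm.symm).symm)
    by_cases h1 : ∃ m, G.Adj d m ∧ N x y z m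
    · obtain ⟨m, hdm, hm⟩ := h1
      refine ⟨d, simplicialIn_of_star (m := m) hdS fun a haS ha => ?_⟩
      obtain ⟨w, rfl | h3, rfl | h4⟩ := ha
      · exact Or.inr hdm.symm
      · exact Or.inl (huniq _ hd _ _ hdm h4 hm (hSN _ haS (hD.not_mem_of_adj hd h4)))
      · exact Or.inl (huniq _ hd _ _ hdm h3.symm hm (hSN _ haS (hD.not_mem_of_adj hd h3.symm)))
      · by_cases had : a = d
        · exact Or.inr (had ▸ hdm.symm)
        · exact Or.inr (huniq d hd _ _ hdm h3.symm hm (hfar w a h3.symm h4 had) ▸ h4)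
    · push Not at h1
      refine ⟨d, simplicialIn_of_star (m := d) hdS fun a haS ha => ?_⟩
      obtain ⟨w, rfl | h3, h4⟩ := ha
      · exact h4
      · rcases h4 with rfl | h4
        · exact Or.inr h3.symm
        · by_cases had : a = d
          · exact Or.inl had.symm
          · exact absurd (hfar w a h3.symm h4 had) (h1 w h3.symm)
  push Not at hB
  have hSN' : ∀ v ∈ S, N x y z v := fun v hv => hSN v hv (hB v hv)
  -- A vertex in no triangle has exactly one neighbour `t` in `N x y z`, and `t` is the centre. If
  -- there is no such vertex, `hdom` makes all of `S` pairwise close.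
  by_cases hC : ∃ w ∈ S, ∀ q r, G.Adj w q → G.Adj w r → ¬ G.Adj q r
  · obtain ⟨w, hwS, hw⟩ := hC
    have hwD := hB w hwS
    have hwT : ∀ t, (t = x ∨ t = y ∨ t = z) → w ≠ t := by
      rintro t (rfl | rfl | rfl) rfl
      · exact hw y z hxy hxz hyz
      · exact hw x z hxy.symm hyz hxz
      · exact hw x y hxz.symm hyz.symm hxy
    obtain ⟨t, ht, htw⟩ : ∃ t, (t = x ∨ t = y ∨ t = z) ∧ G.Adj t w := by
      rcases hSN' w hwS with (h | h) | (h | h) | (h | h)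
      · exact absurd h.symm (hwT x (by simp))
      · exact ⟨x, by simp, h⟩
      · exact absurd h.symm (hwT y (by simp))
      · exact ⟨y, by simp, h⟩
      · exact absurd h.symm (hwT z (by simp))
      · exact ⟨z, by simp, h⟩
    have hadjT : ∀ t', (t' = x ∨ t' = y ∨ t' = z) → t' ≠ t → G.Adj t t' := by
      rintro t' ht' hne
      rcases ht with rfl | rfl | rfl <;> rcases ht' with rfl | rfl | rfl <;>
        first
        | exact absurd rfl hne
        | exact hxy
        | exact hxz
        | exact hyz
        | exact hxy.symm
        | exact hxz.symm
        | exact hyz.symm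
    have huw : ∀ u, N x y z u → G.Adj w u → t = u := by
      intro u hu hwu
      by_contra hne
      have htu : ¬ G.Adj t u := hw t u htw.symm hwu
      obtain ⟨t', ht', ht'u⟩ : ∃ t', (t' = x ∨ t' = y ∨ t' = z) ∧ (t' = u ∨ G.Adj t' u) := by
        rcases hu with h | h | h
        · exact ⟨x, by simp, h⟩
        · exact ⟨y, by simp, h⟩
        · exact ⟨z, by simp, h⟩
      have htt' : t' ≠ t := by
        rintro rfl
        exact ht'u.elim hne htu
      have h1 := hadjT t' ht' htt'
      have h2 : G.Adj t' u := ht'u.resolve_left fun h => htu (h ▸ h1)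
      exact hG.not_c4 htw.symm hwu hne htu h1 h2 (hwT t' ht').symm
        (fun h => hw t t' htw.symm h h1)
    refine ⟨w, simplicialIn_of_star (m := t) hwS fun a haS ha => ?_⟩
    have haN := hSN' a haS
    obtain ⟨m, rfl | h3, rfl | h4⟩ := ha
    · exact Or.inr htw
    · exact Or.inl (huw _ haN h4)
    · exact Or.inl (huw _ haN h3.symm)
    · by_cases hmD : m ∈ D
      · exact Or.inr (huniq m hmD w a h3 h4 (hSN' w hwS) haN ▸ htw)
      · by_cases hmN : N x y z m
        · exact Or.inr (huw m hmN h3.symm ▸ h4)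
        · obtain ⟨e, he, -, h⟩ := hleaf m hmD hmN
          exact absurd (h w h3 ▸ he) hwD
  · push Not at hC
    obtain ⟨v, hv⟩ := hS
    refine ⟨v, simplicialIn_of_forall hv fun a ha b hb => ?_⟩
    obtain ⟨q, r, h1, h2, h3⟩ := hC a ha
    exact hdom a q r h1 h2 h3 b (hB b hb) (hSN' b hb)

theorem K3P2Free.squareChordal (hG : IsChordal G) (hF : HFree K3P2 G) {D : Finset V}
    (hD : IsEDS G D) : SquareChordal G := by
  intro S hS
  by_cases hT : ∃ x y z, G.Adj x y ∧ G.Adj x z ∧ G.Adj y z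
  · by_cases hd : ∃ d ∈ D, ∃ x y, G.Adj d x ∧ G.Adj d y ∧ G.Adj x y
    · obtain ⟨d, hd, x, y, h1, h2, h3⟩ := hd
      exact simplicialIn_of_triangle hG hF hD hd h1 h2 h3 hS
    · push Not at hd
      obtain ⟨x, y, z, h1, h2, h3⟩ := hT
      exact simplicialIn_of_not_triangle hG hF hD hd h1 h2 h3 hS
  · push Not at hT
    obtain ⟨r, hr⟩ := hS
    exact hG.exists_simplicialIn_of_forest (fun x y z _ => hT x y z) hr

end WED

/-! ### Chordal graphs without co-P -/

namespace WED

open SimpleGraph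

variable {V : Type*} {G : SimpleGraph V}

theorem Close.reachable {u v : V} (h : Close G u v) : G.Reachable u v := by
  obtain ⟨w, rfl | h1, rfl | h2⟩ := h
  · exact Reachable.refl _
  · exact h2.reachable
  · exact h1.symm.reachable
  · exact h1.symm.reachable.trans h2.reachable

theorem forall_of_reachable {P : V → Prop} {r v : V} (hr : P r)
    (hP : ∀ u w, P u → G.Adj u w → P w) (h : G.Reachable r v) : P v := by
  obtain ⟨p⟩ := h
  induction p with
  | nil => exact hr
  | cons h p ih => exact ih (hP _ _ hr h)

/-- The triangle `d x y` forces the component of `d` to have radius at most three about `d`, with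
`x` and `y` adjacent to every vertex at distance two. A vertex of `S` at distance three is
simplicial; without one, the only obstacles are vertices around `d` that see nothing at distance
two. -/
theorem CoPFree.simplicialIn_of_triangle (hG : IsChordal G) (hF : HFree coP G) {D : Finset V}
    (hD : IsEDS G D) {d x y : V} (hd : d ∈ D) (hdx : G.Adj d x) (hdy : G.Adj d y)
    (hxy : G.Adj x y) {S : Finset V} {s : V} (hs : s ∈ S) (hds : G.Reachable d s) :
    ∃ v, SimplicialIn G S v := by
  -- the vertices at distance two and three from `d`
  let N2 : V → Prop := fun v => v ≠ d ∧ ¬ G.Adj d v ∧ ∃ c, G.Adj d c ∧ G.Adj c v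
  let N3 : V → Prop := fun w => w ≠ d ∧ ¬ G.Adj d w ∧ ¬ N2 w ∧ ∃ z, N2 z ∧ G.Adj z w
  have hDN2 : ∀ e ∈ D, ¬ N2 e := by
    rintro e he ⟨hed, -, c, hdc, hce⟩
    exact hed (hD.eq he hd (Or.inr hce.symm) (Or.inr hdc))
  have hN2D : ∀ z, N2 z → ∃ e ∈ D, G.Adj e z ∧ e ≠ d ∧ ∀ c, (d = c ∨ G.Adj d c) → ¬ G.Adj c e := by
    intro z hz
    obtain ⟨e, he, hez⟩ := hD.exists_adj fun h => hDN2 z h hz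
    have hed : e ≠ d := fun h => hz.2.1 (h ▸ hez)
    refine ⟨e, he, hez, hed, ?_⟩
    rintro c (rfl | hc) hce
    · exact hD.not_adj hd he hce
    · exact hed (hD.eq he hd (Or.inr hce.symm) (Or.inr hc))
  -- Otherwise the triangle `p d q` with the path from `p` through `z` to its dominator is a co-P.
  have hedge : ∀ z p q, N2 z → G.Adj d p → G.Adj p z → G.Adj d q → G.Adj p q → G.Adj q z := by
    intro z p q hz hdp hpz hdq hpq
    obtain ⟨e, he, hez, hed, hc⟩ := hN2D z hz
    by_contra hqz
    exact hF.coP hdp.symm hpq hdq hpz hez.symm hz.2.1 hqz (hc p (Or.inr hdp)) (hc d (Or.inl rfl))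
      (hc q (Or.inr hdq))
  have hN2xy : ∀ z, N2 z → G.Adj x z ∧ G.Adj y z := by
    intro z hz
    suffices h : G.Adj x z ∨ G.Adj y z by
      rcases h with h | h
      · exact ⟨h, hedge z x y hz hdx h hdy hxy⟩
      · exact ⟨hedge z y x hz hdy h hdx hxy.symm, h⟩
    by_contra! hcon
    obtain ⟨c, hdc, hcz⟩ := hz.2.2
    exact hF.coP hdx hdy hxy hdc hcz (fun h => hcon.1 (hedge z c x hz hdc hcz hdx h.symm))
      (fun h => hcon.2 (hedge z c y hz hdc hcz hdy h.symm)) hz.2.1 hcon.1 hcon.2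
  -- Otherwise the triangle `z x y` with the path `z w e` is a co-P. In particular nothing lies at
  -- distance four.
  have hN3 : ∀ w z e, N3 w → N2 z → G.Adj z w → G.Adj w e → e ≠ d → ¬ G.Adj d e → ¬ N2 e →
      G.Adj z e := by
    intro w z e hw hz hzw hwe hed hde he
    by_contra hze
    obtain ⟨hxz, hyz⟩ := hN2xy z hz
    have far : ∀ w, w ≠ d → ¬ G.Adj d w → ¬ N2 w → ∀ c, G.Adj d c → ¬ G.Adj c w :=
      fun w h1 h2 h3 c hc hcw => h3 ⟨h1, h2, c, hc, hcw⟩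
    exact hF.coP hxz.symm hyz.symm hxy hzw hwe (far w hw.1 hw.2.1 hw.2.2.1 x hdx)
      (far w hw.1 hw.2.1 hw.2.2.1 y hdy) hze (far e hed hde he x hdx) (far e hed hde he y hdy)
  let U : V → Prop := fun v => v = d ∨ G.Adj d v ∨ N2 v ∨ N3 v
  have hU : ∀ u w, U u → G.Adj u w → U w := by
    intro u w hu huw
    by_cases h1 : w = d
    · exact Or.inl h1
    by_cases h2 : G.Adj d w
    · exact Or.inr (Or.inl h2)
    by_cases h3 : N2 w
    · exact Or.inr (Or.inr (Or.inl h3))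
    rcases hu with rfl | hu | hu | hu
    · exact absurd huw h2
    · exact absurd ⟨h1, h2, u, hu, huw⟩ h3
    · exact Or.inr (Or.inr (Or.inr ⟨h1, h2, h3, u, hu, huw⟩))
    · obtain ⟨z, hz, hzu⟩ := hu.2.2.2
      exact Or.inr (Or.inr (Or.inr ⟨h1, h2, h3, z, hz, hN3 u z w hu hz hzu huw h1 h2 h3⟩))
  have hU' : ∀ u w, U u → G.Reachable u w → U w := fun u w hu h =>
    forall_of_reachable (P := U) hu hU h
  -- neighbours of a vertex at distance three
  have hN3nb : ∀ w u, N3 w → G.Adj w u → N2 u ∨ N3 u := by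
    intro w u hw hwu
    rcases hU w u (Or.inr (Or.inr (Or.inr hw))) hwu with rfl | h | h
    · exact absurd hwu.symm hw.2.1
    · exact absurd ⟨hw.1, hw.2.1, u, h, hwu.symm⟩ hw.2.2.1
    · exact h
  have hN3N3 : ∀ w z e, N3 w → N2 z → G.Adj z w → G.Adj w e → N3 e → G.Adj z e :=
    fun w z e hw hz hzw hwe he => hN3 w z e hw hz hzw hwe he.1 he.2.1 he.2.2.1
  by_cases hA : ∃ w ∈ S, N3 w
  · obtain ⟨w, hwS, hw⟩ := hA
    have hdomN3 : ∀ w, N3 w → ∃ e ∈ D, N3 e ∧ (e = w ∨ G.Adj e w) := by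
      intro w hw
      obtain ⟨e, ⟨he, hew⟩, -⟩ := hD w
      refine ⟨e, he, ?_, hew⟩
      rcases hew with rfl | h
      · exact hw
      · exact (hN3nb w e hw h.symm).resolve_left (hDN2 e he)
    -- The hard case is a common neighbour `m` at distance two: the dominators of `w` and `a` both
    -- see `m`, so they coincide, and adjacency to `z` passes from `w` over the dominator to `a`.
    have hC : ∀ a, Close G w a → N3 a → ∀ z, N2 z → G.Adj z w → G.Adj z a := by
      intro a hwa ha z hz hzw
      obtain ⟨m, rfl | h1, rfl | h2⟩ := hwa
      · exact hzw
      · exact hN3N3 _ z a hw hz hzw h2 ha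
      · exact hN3N3 _ z _ hw hz hzw h1.symm ha
      · rcases hN3nb w m hw h1.symm with hm | hm
        · obtain ⟨e, he, heN, hew⟩ := hdomN3 w hw
          obtain ⟨e', he', heN', hea⟩ := hdomN3 a ha
          have k1 : G.Adj z e := by
            rcases hew with rfl | h
            · exact hzw
            · exact hN3N3 w z e hw hz hzw h.symm heN
          have k2 : G.Adj m e := by
            rcases hew with rfl | h
            · exact h1
            · exact hN3N3 w m e hw hm h1 h.symm heN
          have k3 : G.Adj m e' := by
            rcases hea with rfl | h
            · exact h2
            · exact hN3N3 a m e' ha hm h2 h.symm heN'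
          obtain rfl := hD.eq he he' (Or.inr k2.symm) (Or.inr k3.symm)
          rcases hea with rfl | h
          · exact k1
          · exact hN3N3 e z a heN hz k1 h ha
        · exact hN3N3 m z a hm hz (hN3N3 w z m hw hz hzw h1.symm hm) h2 ha
    have hC2 : ∀ a, Close G w a → ¬ N3 a → ∃ z, N2 z ∧ G.Adj z w ∧ (z = a ∨ G.Adj z a) := by
      have adj : ∀ a, G.Adj w a → ¬ N3 a → ∃ z, N2 z ∧ G.Adj z w ∧ (z = a ∨ G.Adj z a) :=
        fun a hwa ha => ⟨a, (hN3nb w a hw hwa).resolve_right ha, hwa.symm, Or.inl rfl⟩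
      intro a hwa ha
      obtain ⟨m, rfl | h1, rfl | h2⟩ := hwa
      · exact absurd hw ha
      · exact adj _ h2 ha
      · exact adj _ h1.symm ha
      · rcases hN3nb w m hw h1.symm with hm | hm
        · exact ⟨m, hm, h1, Or.inr h2⟩
        · have haN := (hN3nb m a hm h2).resolve_right ha
          exact ⟨a, haN, hN3N3 m a w hm haN h2.symm h1 hw, Or.inl rfl⟩
    have hx : ∀ z a, N2 z → ¬ N3 a → (z = a ∨ G.Adj z a) → x = a ∨ G.Adj x a := by
      intro z a hz ha hza
      rcases hza with rfl | hza
      · exact Or.inr (hN2xy _ hz).1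
      · rcases hU z a (Or.inr (Or.inr (Or.inl hz))) hza with rfl | h | h | h
        · exact absurd hza.symm hz.2.1
        · by_contra! hcon
          exact hG.not_c4 hdx h hcon.1 hcon.2 (hN2xy z hz).1 hza hz.1 hz.2.1
        · exact Or.inr (hN2xy a h).1
        · exact absurd h ha
    refine ⟨w, hwS, fun a _ b _ ha hb => ?_⟩
    by_cases ha3 : N3 a <;> by_cases hb3 : N3 b
    · obtain ⟨z, hz, hzw⟩ := hw.2.2.2
      exact ⟨z, Or.inr (hC a ha ha3 z hz hzw), Or.inr (hC b hb hb3 z hz hzw)⟩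
    · obtain ⟨z, hz, hzw, hzb⟩ := hC2 b hb hb3
      exact ⟨z, Or.inr (hC a ha ha3 z hz hzw), hzb⟩
    · obtain ⟨z, hz, hzw, hza⟩ := hC2 a ha ha3
      exact ⟨z, hza, Or.inr (hC b hb hb3 z hz hzw)⟩
    · obtain ⟨z, hz, hzw, hza⟩ := hC2 a ha ha3
      obtain ⟨z', hz', hzw', hzb⟩ := hC2 b hb hb3
      exact ⟨x, hx z a hz ha3 hza, hx z' b hz' hb3 hzb⟩
  push Not at hA
  -- Such an `e` sees nothing at distance two, since that would give a four-cycle with `d` and `x`.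
  -- Everything close to `e` is then in the closed neighbourhood of `d`.
  by_cases hB : ∃ e ∈ S, G.Adj d e ∧ ¬ (x = e ∨ G.Adj x e) ∧ ¬ (y = e ∨ G.Adj y e)
  · obtain ⟨e, heS, hde, hxe, hye⟩ := hB
    push Not at hxe
    have hez : ∀ z, N2 z → ¬ G.Adj e z := fun z hz hez =>
      hG.not_c4 hdx hde hxe.1 hxe.2 (hN2xy z hz).1 hez.symm hz.1 hz.2.1
    have henb : ∀ u, G.Adj e u → d = u ∨ G.Adj d u := by
      intro u heu
      by_contra! hcon
      exact hez u ⟨hcon.1.symm, hcon.2, e, hde, heu⟩ heu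
    refine ⟨e, simplicialIn_of_star (m := d) heS fun a _ ha => ?_⟩
    obtain ⟨m, rfl | h1, rfl | h2⟩ := ha
    · exact Or.inr hde
    · exact henb _ h2
    · exact henb _ h1.symm
    · by_contra! hcon
      rcases henb m h1.symm with rfl | hdm
      · exact hcon.2 h2
      · have ha : N2 a := ⟨hcon.1.symm, hcon.2, m, hdm, h2⟩
        exact hez a ha (hedge a m e ha hdm h2 hde h1)
  · push Not at hB
    have hUs := hU' d s (Or.inl rfl) hds
    have hx2 : ∀ a ∈ S, Close G s a → a = d ∨ (G.Adj d a ∧ ((x = a ∨ G.Adj x a) ∨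
        (y = a ∨ G.Adj y a))) ∨ N2 a := by
      intro a ha hsa
      rcases hU' s a hUs hsa.reachable with h | h | h | h
      · exact Or.inl h
      · refine Or.inr (Or.inl ⟨h, ?_⟩)
        by_contra! hcon
        exact (hB a ha h hcon.1).elim (fun h' => hcon.2.1 h') hcon.2.2
      · exact Or.inr (Or.inr h)
      · exact absurd h (hA a ha)
    have key : ∀ a ∈ S, ∀ b ∈ S, Close G s a → Close G s b → N2 b → Close G a b := by
      intro a ha b hb hsa hsb hb2
      obtain ⟨hxb, hyb⟩ := hN2xy b hb2
      rcases hx2 a ha hsa with rfl | ⟨-, h | h⟩ | h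
      · exact ⟨x, Or.inr hdx.symm, Or.inr hxb⟩
      · exact ⟨x, h, Or.inr hxb⟩
      · exact ⟨y, h, Or.inr hyb⟩
      · exact ⟨x, Or.inr (hN2xy a h).1, Or.inr hxb⟩
    refine ⟨s, hs, fun a ha b hb hsa hsb => ?_⟩
    rcases hx2 b hb hsb with h | ⟨h, -⟩ | h
    · rcases hx2 a ha hsa with h' | ⟨h', -⟩ | h'
      · exact ⟨d, Or.inl h'.symm, Or.inl h.symm⟩
      · exact ⟨d, Or.inr h', Or.inl h.symm⟩
      · exact (key b hb a ha hsb hsa h').symm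
    · rcases hx2 a ha hsa with h' | ⟨h', -⟩ | h'
      · exact ⟨d, Or.inl h'.symm, Or.inr h⟩
      · exact ⟨d, Or.inr h', Or.inr h⟩
      · exact (key b hb a ha hsb hsa h').symm
    · exact key a ha b hb hsa hsb h

/-- The component of the triangle consists of the vertices in the closed neighbourhoods of at least
two triangle vertices, and of leaves attached to them. The former are pairwise close because two
pairs from a three-element set intersect. -/
theorem CoPFree.simplicialIn_of_not_triangle (hG : IsChordal G) (hF : HFree coP G)
    {D : Finset V} (hD : IsEDS G D) {r : V}
    (hno : ∀ d ∈ D, G.Reachable r d → ∀ x y, G.Adj d x → G.Adj d y → ¬ G.Adj x y)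
    {x y z : V} (hrx : G.Reachable r x) (hxy : G.Adj x y) (hxz : G.Adj x z) (hyz : G.Adj y z)
    {S : Finset V} (hr : r ∈ S) : ∃ v, SimplicialIn G S v := by
  -- A further neighbour `u` of `d` gives a co-P with path `p d u`, or a chordless four-cycle if `u`
  -- sees `q` or `t`.
  have hleaf : ∀ p q t, G.Reachable r p → G.Adj p q → G.Adj p t → G.Adj q t →
      ∀ d ∈ D, G.Adj d p → ∀ u, G.Adj d u → u = p := by
    intro p q t hrp hpq hpt hqt d hd hdp u hdu
    have hrd : G.Reachable r d := hrp.trans hdp.symm.reachable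
    by_contra hne
    have hup : ¬ G.Adj p u := hno d hd hrd p u hdp hdu
    have hdq : ¬ G.Adj d q := fun h => hno d hd hrd p q hdp h hpq
    have hdt : ¬ G.Adj d t := fun h => hno d hd hrd p t hdp h hpt
    have hqd : q ≠ d := fun h => hdt (h ▸ hqt)
    have htd : t ≠ d := fun h => hdq (h ▸ hqt.symm)
    by_cases hqu : G.Adj q u
    · exact hG.not_c4 hdp hdu (Ne.symm hne) hup hpq hqu hqd hdq
    by_cases htu : G.Adj t u
    · exact hG.not_c4 hdp hdu (Ne.symm hne) hup hpt htu htd hdt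
    exact hF.coP hpq hpt hqt hdp.symm hdu (fun h => hdq h.symm) (fun h => hdt h.symm) hup hqu htu
  -- Otherwise the path from `p` through `u` to the dominator of `u` hangs at the triangle; `hleaf`
  -- shows that this dominator sees no triangle vertex.
  have hnb : ∀ p q t, G.Reachable r p → G.Adj p q → G.Adj p t → G.Adj q t →
      ∀ u, u ∉ D → G.Adj p u → (q = u ∨ G.Adj q u) ∨ (t = u ∨ G.Adj t u) := by
    intro p q t hrp hpq hpt hqt u hu hpu
    by_contra! hcon
    obtain ⟨⟨hqne, hqu⟩, htne, htu⟩ := hcon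
    obtain ⟨d, hd, hdu⟩ := hD.exists_adj hu
    have hpd : ¬ G.Adj p d := fun h =>
      hpu.ne (hleaf p q t hrp hpq hpt hqt d hd h.symm u hdu).symm
    have hqd : ¬ G.Adj q d := fun h =>
      hqne (hleaf q p t (hrp.trans hpq.reachable) hpq.symm hqt hpt d hd h.symm u hdu).symm
    have htd : ¬ G.Adj t d := fun h =>
      htne (hleaf t p q (hrp.trans hpt.reachable) hpt.symm hqt.symm hpq d hd h.symm u hdu).symm
    exact hF.coP hpq hpt hqt hpu hdu.symm hqu htu hpd hqd htd
  let T : V → Prop := fun t => t = x ∨ t = y ∨ t = z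
  have hTadj : ∀ t t', T t → T t' → t ≠ t' → G.Adj t t' := by
    rintro t t' (rfl | rfl | rfl) (rfl | rfl | rfl) hne
    · exact absurd rfl hne
    · exact hxy
    · exact hxz
    · exact hxy.symm
    · exact absurd rfl hne
    · exact hyz
    · exact hxz.symm
    · exact hyz.symm
    · exact absurd rfl hne
  have hTr : ∀ t, T t → G.Reachable r t := by
    rintro t (rfl | rfl | rfl)
    · exact hrx
    · exact hrx.trans hxy.reachable
    · exact hrx.trans hxz.reachable
  have hToth : ∀ t, T t → ∃ t₁ t₂, T t₁ ∧ T t₂ ∧ t ≠ t₁ ∧ t ≠ t₂ ∧ t₁ ≠ t₂ := by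
    rintro t (rfl | rfl | rfl)
    · exact ⟨y, z, by simp [T], by simp [T], hxy.ne, hxz.ne, hyz.ne⟩
    · exact ⟨x, z, by simp [T], by simp [T], hxy.ne.symm, hyz.ne, hxz.ne⟩
    · exact ⟨x, y, by simp [T], by simp [T], hxz.ne.symm, hyz.ne.symm, hxy.ne⟩
  let W : V → Prop := fun u =>
    ∃ t t', T t ∧ T t' ∧ t ≠ t' ∧ (t = u ∨ G.Adj t u) ∧ (t' = u ∨ G.Adj t' u)
  have hTW : ∀ t u, T t → u ∉ D → G.Adj t u → W u := by
    intro t u ht hu htu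
    obtain ⟨t₁, t₂, h1, h2, hne1, hne2, hne⟩ := hToth t ht
    rcases hnb t t₁ t₂ (hTr t ht) (hTadj _ _ ht h1 hne1) (hTadj _ _ ht h2 hne2)
      (hTadj _ _ h1 h2 hne) u hu htu with h | h
    · exact ⟨t, t₁, ht, h1, hne1, Or.inr htu, h⟩
    · exact ⟨t, t₂, ht, h2, hne2, Or.inr htu, h⟩
  have hWtri : ∀ v, W v → ∃ q t, G.Adj v q ∧ G.Adj v t ∧ G.Adj q t ∧ T q ∧ T t := by
    rintro v ⟨t, t', ht, ht', hne, h, h'⟩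
    by_cases hv : T v
    · obtain ⟨t₁, t₂, h1, h2, hne1, hne2, hne⟩ := hToth v hv
      exact ⟨t₁, t₂, hTadj _ _ hv h1 hne1, hTadj _ _ hv h2 hne2, hTadj _ _ h1 h2 hne, h1, h2⟩
    · exact ⟨t, t', (h.resolve_left fun e => hv (e ▸ ht)).symm,
        (h'.resolve_left fun e => hv (e ▸ ht')).symm, hTadj _ _ ht ht' hne, ht, ht'⟩
  have hTWself : ∀ t, T t → W t := by
    intro t ht
    obtain ⟨t₁, t₂, h1, h2, hne1, hne2, hne⟩ := hToth t ht
    exact ⟨t, t₁, ht, h1, hne1, Or.inl rfl, Or.inr (hTadj _ _ h1 ht hne1.symm)⟩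
  have hWW : ∀ a b, W a → W b → Close G a b := by
    rintro a b ⟨t, t', ht, ht', hne, h, h'⟩ ⟨s, s', hs, hs', hnes, k, k'⟩
    have : s = t ∨ s = t' ∨ s' = t ∨ s' = t' := by
      rcases ht with rfl | rfl | rfl <;> rcases ht' with rfl | rfl | rfl <;>
        rcases hs with rfl | rfl | rfl <;> rcases hs' with rfl | rfl | rfl <;>
        first
        | exact Or.inl rfl
        | exact Or.inr (Or.inl rfl)
        | exact Or.inr (Or.inr (Or.inl rfl))
        | exact Or.inr (Or.inr (Or.inr rfl))
        | exact absurd rfl hne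
        | exact absurd rfl hnes
    rcases this with rfl | rfl | rfl | rfl
    · exact ⟨_, h, k⟩
    · exact ⟨_, h', k⟩
    · exact ⟨_, h, k'⟩
    · exact ⟨_, h', k'⟩
  let L : V → Prop := fun v => ∃ m, G.Adj v m ∧ ∀ u, G.Adj v u → u = m
  -- Every vertex of `W` is in a triangle with two vertices of `T`, so `hleaf` and `hnb` also apply
  -- at it: its neighbours in `D` are leaves and the others are again in `W`.
  have hall : ∀ v, G.Reachable x v → (W v ∨ (L v ∧ ∃ m, W m ∧ G.Adj v m)) ∧ G.Reachable r v := by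
    intro v hv
    refine forall_of_reachable
      (P := fun v => (W v ∨ (L v ∧ ∃ m, W m ∧ G.Adj v m)) ∧ G.Reachable r v)
      ⟨Or.inl (hTWself x (Or.inl rfl)), hrx⟩ ?_ hv
    rintro v u ⟨hv | ⟨⟨m, hvm, hm⟩, m', hm', hvm'⟩, hrv⟩ hvu
    · refine ⟨?_, hrv.trans hvu.reachable⟩
      obtain ⟨q, t, hvq, hvt, hqt, hq, ht⟩ := hWtri v hv
      by_cases huD : u ∈ D
      · exact Or.inr ⟨⟨v, hvu.symm, hleaf v q t hrv hvq hvt hqt u huD hvu.symm⟩, v, hv, hvu.symm⟩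
      · left
        rcases hnb v q t hrv hvq hvt hqt u huD hvu with (rfl | h) | (rfl | h)
        · exact hTWself _ hq
        · exact hTW q u hq huD h
        · exact hTWself _ ht
        · exact hTW t u ht huD h
    · exact ⟨Or.inl ((hm u hvu).trans (hm m' hvm').symm ▸ hm'), hrv.trans hvu.reachable⟩
  by_cases hB : ∃ v ∈ S, L v
  · obtain ⟨v, hvS, m, hvm, hm⟩ := hB
    refine ⟨v, simplicialIn_of_star (m := m) hvS fun a _ ha => ?_⟩
    obtain ⟨w, rfl | h3, rfl | h4⟩ := ha
    · exact Or.inr hvm.symm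
    · exact Or.inl (hm _ h4).symm
    · exact Or.inl (hm _ h3.symm).symm
    · exact Or.inr (hm _ h3.symm ▸ h4)
  · push Not at hB
    have hSW : ∀ a ∈ S, Close G r a → W a := fun a ha hra =>
      (hall a (hrx.symm.trans hra.reachable)).1.resolve_right fun h => hB a ha h.1
    exact ⟨r, hr, fun a ha b hb hra hrb => hWW a b (hSW a ha hra) (hSW b hb hrb)⟩

theorem CoPFree.squareChordal (hG : IsChordal G) (hF : HFree coP G) {D : Finset V}
    (hD : IsEDS G D) : SquareChordal G := by
  rintro S ⟨r, hr⟩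
  by_cases hT : ∃ x y z, G.Reachable r x ∧ G.Adj x y ∧ G.Adj x z ∧ G.Adj y z
  · by_cases hd : ∃ d ∈ D, G.Reachable r d ∧ ∃ x y, G.Adj d x ∧ G.Adj d y ∧ G.Adj x y
    · obtain ⟨d, hd, hrd, x, y, h1, h2, h3⟩ := hd
      exact simplicialIn_of_triangle hG hF hD hd h1 h2 h3 hr hrd.symm
    · push Not at hd
      obtain ⟨x, y, z, hrx, h1, h2, h3⟩ := hT
      exact simplicialIn_of_not_triangle hG hF hD hd hrx h1 h2 h3 hr
  · push Not at hT
    exact hG.exists_simplicialIn_of_forest hT hr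

end WED

namespace WED

/-! ### Programs with bounded loops -/

/-- The length of an expression. -/
def Expr.len : Expr → ℕ
  | lit c => Nat.size c + 1
  | cell _ addr => addr.len + 1
  | add e f => e.len + f.len + 1
  | sub e f => e.len + f.len + 1
  | mul e f => e.len + f.len + 1

/-- The expression has no products, except in addresses. -/
def Expr.isLinear : Expr → Bool
  | lit _ => true
  | cell _ _ => true
  | add e f => e.isLinear && f.isLinear
  | sub e f => e.isLinear && f.isLinear
  | mul _ _ => false

/-- All numbers in the memory have binary length at most `L`. -/
def Mem.SizeLE (s : Mem) (L : ℕ) : Prop := ∀ a i, Nat.size (s a i) ≤ L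

theorem Mem.SizeLE.mono {s : Mem} {L L' : ℕ} (h : s.SizeLE L) (hL : L ≤ L') : s.SizeLE L' :=
  fun a i => (h a i).trans hL

theorem Mem.SizeLE.write {s : Mem} {L : ℕ} (h : s.SizeLE L) {a i x : ℕ} (hx : Nat.size x ≤ L) :
    (s.write a i x).SizeLE L := by
  intro b j
  unfold Mem.write
  split_ifs
  · exact hx
  · exact h b j

theorem size_add_le {a b m : ℕ} (ha : Nat.size a ≤ m) (hb : Nat.size b ≤ m) :
    Nat.size (a + b) ≤ m + 1 := by
  rw [Nat.size_le] at *
  rw [pow_succ]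
  omega

theorem size_mul_le (a b : ℕ) : Nat.size (a * b) ≤ Nat.size a + Nat.size b := by
  rw [Nat.size_le, pow_add]
  exact Nat.mul_lt_mul'' (Nat.lt_size_self a) (Nat.lt_size_self b)

theorem Expr.len_pos (e : Expr) : 1 ≤ e.len := by
  cases e <;> simp [Expr.len]

theorem Expr.size_eval_le {s : Mem} {L : ℕ} (hs : s.SizeLE L) (e : Expr) :
    Nat.size (e.eval s) ≤ e.len * (L + 1) := by
  induction e with
  | lit c => simp only [eval, len]; nlinarith
  | cell a addr ih =>
    have := hs a (addr.eval s)
    simp only [eval, len]; nlinarith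
  | add e f he hf =>
    refine (size_add_le (m := e.len * (L + 1) + f.len * (L + 1)) ?_ ?_).trans ?_
    · omega
    · omega
    · simp only [len]; nlinarith
  | sub e f he hf =>
    refine (Nat.size_le_size (Nat.sub_le _ _)).trans (he.trans ?_)
    simp only [len]; nlinarith
  | mul e f he hf =>
    refine (size_mul_le _ _).trans ?_
    simp only [len]; nlinarith

/-- Without products in the value, lengths grow additively. This is what keeps them polynomial under
iteration; repeated squaring would double them in each round. -/
theorem Expr.size_eval_le_of_isLinear {s : Mem} {L : ℕ} (hs : s.SizeLE L) (e : Expr)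
    (he : e.isLinear = true) : Nat.size (e.eval s) ≤ L + e.len := by
  induction e with
  | lit c => simp only [eval, len]; omega
  | cell a addr ih => exact (hs _ _).trans (Nat.le_add_right _ _)
  | add e f ihe ihf =>
    simp only [isLinear, Bool.and_eq_true] at he
    have h1 := ihe he.1
    have h2 := ihf he.2
    refine (size_add_le (m := L + e.len + f.len) ?_ ?_).trans ?_
    · omega
    · omega
    · simp only [len]; omega
  | sub e f ihe ihf =>
    simp only [isLinear, Bool.and_eq_true] at he
    refine (Nat.size_le_size (Nat.sub_le _ _)).trans ((ihe he.1).trans ?_)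
    simp only [len]; omega
  | mul e f => simp [isLinear] at he

theorem Expr.cost_le {s : Mem} {L : ℕ} (hs : s.SizeLE L) (e : Expr) :
    e.cost s ≤ e.len ^ 2 * (L + 2) := by
  have key : ∀ m n k t c c' : ℕ, 1 ≤ m → 1 ≤ n → c ≤ m ^ 2 * (L + 2) → c' ≤ n ^ 2 * (L + 2) →
      t ≤ (m + n + 1) * (L + 1) → c + c' + (t + 1) ≤ (m + n + 1) ^ 2 * (L + 2) := by
    intro m n k t c c' hm hn hc hc' ht
    have : (m + n + 1) * (L + 1) + 1 ≤ (m + n + 1) * (L + 2) := by nlinarith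
    have : m ^ 2 + n ^ 2 + (m + n + 1) ≤ (m + n + 1) ^ 2 := by nlinarith
    nlinarith
  induction e with
  | lit c =>
    simp only [cost, len]
    nlinarith [Nat.zero_le (Nat.size c), Nat.zero_le L, sq_nonneg (Nat.size c)]
  | cell a addr ih =>
    have h1 := hs a (addr.eval s)
    have h2 := addr.len_pos
    simp only [cost, len]
    nlinarith
  | add e f he hf =>
    exact key _ _ 0 _ _ _ e.len_pos f.len_pos he hf ((add e f).size_eval_le hs)
  | sub e f he hf =>
    exact key _ _ 0 _ _ _ e.len_pos f.len_pos he hf ((sub e f).size_eval_le hs)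
  | mul e f he hf =>
    exact key _ _ 0 _ _ _ e.len_pos f.len_pos he hf ((mul e f).size_eval_le hs)

/-- Programs whose only loops are bounded loops: `loop i p` runs `p` for each value
`0, …, n - 1` of the counter in cell `0` of bank `i`, where `n` is the content of cell `0` of
bank `0`. -/
inductive LP : Type
  | skip : LP
  | store (a : ℕ) (addr e : Expr) : LP
  | seq (p q : LP) : LP
  | ite (b : Expr) (p q : LP) : LP
  | loop (i : ℕ) (p : LP) : LP

/-- The memory at the beginning of round `k` of a bounded loop with counter `i` and body `f`. -/
def loopState (f : Mem → Mem) (i : ℕ) (s : Mem) : ℕ → Mem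
  | 0 => s.write i 0 0
  | k + 1 => (f (loopState f i s k)).write i 0 (k + 1)

namespace LP

/-- The effect of a program on the memory. -/
def sem : LP → Mem → Mem
  | skip, s => s
  | store a addr e, s => s.write a (addr.eval s) (e.eval s)
  | seq p q, s => q.sem (p.sem s)
  | ite b p q, s => if b.eval s ≠ 0 then p.sem s else q.sem s
  | loop i p, s => loopState p.sem i s (s 0 0)

/-- Translation into the language of the machine. -/
def compile : LP → Prog
  | skip => Prog.skip
  | store a addr e => Prog.store a addr e
  | seq p q => Prog.seq p.compile q.compile
  | ite b p q => Prog.ite b p.compile q.compile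
  | loop i p => Prog.seq (Prog.store i (Expr.lit 0) (Expr.lit 0))
      (Prog.loop (Expr.sub (Expr.cell 0 (Expr.lit 0)) (Expr.cell i (Expr.lit 0)))
        (Prog.seq p.compile (Prog.store i (Expr.lit 0)
          (Expr.add (Expr.cell i (Expr.lit 0)) (Expr.lit 1)))))

/-- The banks that a program may write to. -/
def writes : LP → List ℕ
  | skip => []
  | store a _ _ => [a]
  | seq p q => p.writes ++ q.writes
  | ite _ p q => p.writes ++ q.writes
  | loop i p => i :: p.writes

/-- The input is not overwritten, stored values are given by linear expressions, and loop
bodies do not change the counter of the loop. -/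
def ok : LP → Bool
  | skip => true
  | store a _ e => a != 0 && e.isLinear
  | seq p q => p.ok && q.ok
  | ite _ p q => p.ok && q.ok
  | loop i p => i != 0 && !(p.writes.contains i) && p.ok

theorem sem_of_not_mem_writes (p : LP) {a : ℕ} (ha : a ∉ p.writes) (s : Mem) :
    p.sem s a = s a := by
  induction p generalizing s with
  | skip => rfl
  | store b addr e =>
    simp only [writes, List.mem_singleton] at ha
    funext i
    simp [sem, Mem.write, ha]
  | seq p q hp hq =>
    simp only [writes, List.mem_append, not_or] at ha
    simp only [sem]
    rw [hq ha.2, hp ha.1]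
  | ite b p q hp hq =>
    simp only [writes, List.mem_append, not_or] at ha
    simp only [sem]
    split_ifs
    · exact hp ha.1 s
    · exact hq ha.2 s
  | loop i p hp =>
    simp only [writes, List.mem_cons, not_or] at ha
    simp only [sem]
    generalize s 0 0 = n
    induction n with
    | zero => funext j; simp [loopState, Mem.write, ha.1]
    | succ n ih =>
      rw [← ih]
      funext j
      simp [loopState, Mem.write, ha.1, hp ha.2]

theorem ok.zero_not_mem_writes {p : LP} (h : p.ok = true) : 0 ∉ p.writes := by
  induction p with
  | skip => simp [writes]
  | store a addr e => simp [ok] at h; simp [writes, Ne.symm h.1]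
  | seq p q hp hq | ite b p q hp hq =>
    simp only [ok, Bool.and_eq_true] at h
    simp [writes, hp h.1, hq h.2]
  | loop i p hp => simp [ok] at h; simp [writes, Ne.symm h.1.1, hp h.2]

theorem loopState_of_not_mem {p : LP} {i a : ℕ} (hi : a ≠ i) (ha : a ∉ p.writes) (s : Mem)
    (k : ℕ) : loopState p.sem i s k a = s a := by
  induction k with
  | zero => funext j; simp [loopState, Mem.write, hi]
  | succ k ih =>
    rw [← ih]
    funext j
    simp [loopState, Mem.write, hi, sem_of_not_mem_writes p ha]

/-- Unlike in `loopState_of_not_mem`, the bank `a` may be the counter bank. -/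
theorem loopState_eq_write {p : LP} {a : ℕ} (ha : a ∉ p.writes) (i : ℕ) (s : Mem) (k : ℕ) :
    loopState p.sem i s k a = s.write i 0 k a := by
  induction k with
  | zero => rfl
  | succ k ih =>
    funext j
    have := congrFun ih j
    by_cases h : a = i ∧ j = 0
    · simp [loopState, Mem.write, h]
    · simp only [loopState, Mem.write, h, if_false] at this ⊢
      rw [sem_of_not_mem_writes p ha, this]

theorem loopState_counter (f : Mem → Mem) (i : ℕ) (s : Mem) (k : ℕ) :
    loopState f i s k i 0 = k := by
  cases k <;> simp [loopState, Mem.write]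

open Polynomial in
/-- A bound on the growth of the binary length of the numbers in the memory, as a polynomial
in `n`. -/
noncomputable def grow : LP → Polynomial ℕ
  | skip => 0
  | store _ _ e => C e.len
  | seq p q => p.grow + q.grow
  | ite _ p q => p.grow + q.grow
  | loop _ p => X * p.grow

open Polynomial in
/-- A bound on the running time when the numbers in the memory initially have binary length at
most `L`. -/
noncomputable def time : LP → Polynomial ℕ → Polynomial ℕ
  | skip, _ => 1
  | store _ addr e, L => C (addr.len ^ 2 + e.len ^ 2) * (L + 2) + 1
  | seq p q, L => p.time L + q.time (L + p.grow)
  | ite b p q, L => C (b.len ^ 2) * (L + 2) + 1 + (p.time L + q.time L)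
  -- The initial store costs `3`. The factor `X + 1` includes the final failing test, and `60`
  -- generously covers one test and one increment of the counter.
  | loop _ p, L => 3 + (X + 1) * (p.time (L + X * p.grow) + 60 * (L + X * p.grow + 2))

/-- Each round adds at most `g` bits. The counter adds none, since it never exceeds the number of
rounds, which is already in memory. -/
theorem sizeLE_loopState {p : LP} {i : ℕ} (hi : 0 ≠ i) (h0 : 0 ∉ p.writes) {s : Mem} {L g : ℕ}
    (hs : s.SizeLE L) (hg : ∀ (s' : Mem) (L' : ℕ), s' 0 0 = s 0 0 → L ≤ L' → s'.SizeLE L' →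
      (p.sem s').SizeLE (L' + g)) {k : ℕ} (hk : k ≤ s 0 0) :
    (loopState p.sem i s k).SizeLE (L + k * g) := by
  induction k with
  | zero => simpa [loopState] using hs.write (by simp)
  | succ k ih =>
    have h := hg (loopState p.sem i s k) _ (by rw [loopState_of_not_mem hi h0])
      (Nat.le_add_right _ _) (ih (by omega))
    refine (h.mono (le_of_eq (by ring))).write ?_
    exact (Nat.size_le_size hk).trans ((hs 0 0).trans (Nat.le_add_right _ _))

theorem sizeLE_sem {p : LP} (hp : p.ok = true) {s : Mem} {x L : ℕ} (hx : s 0 0 ≤ x)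
    (hxL : Nat.size (s 0 0) ≤ L) (hs : s.SizeLE L) : (p.sem s).SizeLE (L + p.grow.eval x) := by
  induction p generalizing s L with
  | skip => exact hs.mono (Nat.le_add_right _ _)
  | store a addr e =>
    simp only [ok, Bool.and_eq_true] at hp
    simp only [grow, Polynomial.eval_C, sem]
    exact (hs.mono (Nat.le_add_right _ _)).write (e.size_eval_le_of_isLinear hs hp.2)
  | seq p q ihp ihq =>
    simp only [ok, Bool.and_eq_true] at hp
    have h0 := p.sem_of_not_mem_writes (ok.zero_not_mem_writes hp.1) s
    have := ihq hp.2 (s := p.sem s) (L := L + p.grow.eval x) (by rwa [h0])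
      (by rw [h0]; omega) (ihp hp.1 hx hxL hs)
    simpa only [sem, grow, Polynomial.eval_add, add_assoc] using this
  | ite b p q ihp ihq =>
    simp only [ok, Bool.and_eq_true] at hp
    simp only [sem, grow, Polynomial.eval_add]
    split_ifs
    · exact (ihp hp.1 hx hxL hs).mono (by omega)
    · exact (ihq hp.2 hx hxL hs).mono (by omega)
  | loop i p ih =>
    have hp0 := ok.zero_not_mem_writes hp
    simp only [writes, List.mem_cons, not_or] at hp0
    simp only [ok, Bool.and_eq_true] at hp
    have key := sizeLE_loopState hp0.1 hp0.2 hs (fun s' L' h1 h2 h3 => ih hp.2 (by omega)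
      (h1 ▸ hxL.trans h2) h3) (le_refl (s 0 0))
    simp only [sem, grow, Polynomial.eval_mul, Polynomial.eval_X]
    exact key.mono (by gcongr)

/-- The length bound `L` is a polynomial so that it can be passed on to later parts of the program;
everything is evaluated at one `x` that bounds the number of rounds. -/
theorem exec_compile {p : LP} (hp : p.ok = true) {s : Mem} {x : ℕ} {L : Polynomial ℕ}
    (hx : s 0 0 ≤ x) (hs : s.SizeLE (L.eval x)) :
    ∃ t, Exec p.compile s (p.sem s) t ∧ t ≤ (p.time L).eval x := by
  induction p generalizing s L with
  | skip => exact ⟨1, Exec.skip s, by simp [time]⟩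
  | store a addr e =>
    refine ⟨_, Exec.store s a addr e, ?_⟩
    have h1 := addr.cost_le hs
    have h2 := e.cost_le hs
    simp only [time, Polynomial.eval_add, Polynomial.eval_mul, Polynomial.eval_C,
      Polynomial.eval_ofNat, Polynomial.eval_one]
    rw [add_mul]
    omega
  | seq p q ihp ihq =>
    simp only [ok, Bool.and_eq_true] at hp
    have h0 := p.sem_of_not_mem_writes (ok.zero_not_mem_writes hp.1) s
    obtain ⟨t, ht, htl⟩ := ihp hp.1 hx hs
    obtain ⟨t', ht', htl'⟩ := ihq hp.2 (s := p.sem s) (L := L + p.grow) (by rwa [h0])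
      (by rw [Polynomial.eval_add]; exact sizeLE_sem hp.1 hx (hs 0 0) hs)
    refine ⟨t + t', Exec.seq ht ht', ?_⟩
    simp only [time, Polynomial.eval_add]
    omega
  | ite b p q ihp ihq =>
    simp only [ok, Bool.and_eq_true] at hp
    have hb := b.cost_le hs
    simp only [sem, time, Polynomial.eval_add, Polynomial.eval_mul, Polynomial.eval_C,
      Polynomial.eval_ofNat, Polynomial.eval_one]
    by_cases h : b.eval s = 0
    · obtain ⟨t, ht, htl⟩ := ihq hp.2 hx hs
      refine ⟨_, by simpa only [h, ne_eq, not_true, if_false, compile] using Exec.iteFalse h ht, ?_⟩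
      omega
    · obtain ⟨t, ht, htl⟩ := ihp hp.1 hx hs
      refine ⟨_, by simpa only [h, ne_eq, not_false_iff, if_true, compile] using Exec.iteTrue h ht, ?_⟩
      omega
  | loop i p ih =>
    have hp0 := ok.zero_not_mem_writes hp
    simp only [writes, List.mem_cons, not_or] at hp0
    simp only [ok, Bool.and_eq_true] at hp
    set n := s 0 0 with hn
    set b : Expr := Expr.sub (Expr.cell 0 (Expr.lit 0)) (Expr.cell i (Expr.lit 0)) with hb
    set e : Expr := Expr.add (Expr.cell i (Expr.lit 0)) (Expr.lit 1) with he
    set M := (L + Polynomial.X * p.grow).eval x with hM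
    have hstate : ∀ k ≤ n, (loopState p.sem i s k).SizeLE M := by
      intro k hk
      refine (sizeLE_loopState hp0.1 hp0.2 hs (fun s' L' h1 h2 h3 => sizeLE_sem hp.2
        (h1.le.trans hx) (h1 ▸ (hs 0 0).trans h2) h3) hk).mono ?_
      rw [hM, Polynomial.eval_add, Polynomial.eval_mul, Polynomial.eval_X]
      have : k ≤ x := hk.trans hx
      gcongr
    have hblen : b.len = 5 := by simp [hb, Expr.len]
    have helen : e.len = 5 := by simp [he, Expr.len]
    have hguard : ∀ k, b.eval (loopState p.sem i s k) = n - k := by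
      intro k
      simp only [hb, Expr.eval, loopState_counter]
      rw [loopState_of_not_mem hp0.1 hp0.2 s k]
    -- Here `j` counts the remaining rounds.
    have key : ∀ j k, k + j = n → ∃ t,
        Exec (Prog.loop b (Prog.seq p.compile (Prog.store i (Expr.lit 0) e)))
          (loopState p.sem i s k) (loopState p.sem i s n) t ∧
        t ≤ (j + 1) * ((p.time (L + Polynomial.X * p.grow)).eval x + 60 * (M + 2)) := by
      intro j
      induction j with
      | zero =>
        intro k hk
        obtain rfl : k = n := by omega
        have hc := b.cost_le (hstate _ le_rfl)
        rw [hblen] at hc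
        exact ⟨_, Exec.loopFalse (by rw [hguard, Nat.sub_self]), by omega⟩
      | succ j ihj =>
        intro k hk
        have hk' : k ≤ n := by omega
        have hc := b.cost_le (hstate k hk')
        rw [hblen] at hc
        obtain ⟨t', ht', htl'⟩ := ihj (k + 1) (by omega)
        obtain ⟨t, ht, htl⟩ := ih hp.2 (s := loopState p.sem i s k)
          (L := L + Polynomial.X * p.grow)
          (by rw [loopState_of_not_mem hp0.1 hp0.2 s k]; exact hx) (hstate k hk')
        have hi : p.sem (loopState p.sem i s k) i 0 = k := by
          rw [sem_of_not_mem_writes, loopState_counter]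
          simpa using hp.1.2
        have hst := Exec.store (p.sem (loopState p.sem i s k)) i (Expr.lit 0) e
        have hs1 : (p.sem (loopState p.sem i s k)).write i ((Expr.lit 0).eval
            (p.sem (loopState p.sem i s k))) (e.eval (p.sem (loopState p.sem i s k))) =
            loopState p.sem i s (k + 1) := by
          simp [loopState, Expr.eval, he, hi]
        rw [hs1] at hst
        have hcost : (Expr.lit 0).cost (p.sem (loopState p.sem i s k)) +
            e.cost (p.sem (loopState p.sem i s k)) + 1 ≤ 20 + 20 * M := by
          have h1 : Nat.size k ≤ M := by
            have := hstate k hk' i 0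
            rwa [loopState_counter] at this
          have h2 : Nat.size (k + 1) ≤ M + 2 :=
            (size_add_le (m := M + 1) (by omega) (by simp)).trans (by omega)
          simp only [he, Expr.cost, Expr.eval, hi, Nat.size_zero, Nat.size_one]
          omega
        refine ⟨_, Exec.loopTrue (by rw [hguard]; omega) (Exec.seq ht hst) ht', ?_⟩
        rw [add_mul (j + 1) 1, one_mul]
        omega
    obtain ⟨t, ht, htl⟩ := key n 0 (by omega)
    refine ⟨_, Exec.seq (Exec.store s i (Expr.lit 0) (Expr.lit 0)) ht, ?_⟩
    simp only [time, Polynomial.eval_add, Polynomial.eval_mul, Polynomial.eval_X,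
      Polynomial.eval_ofNat, Polynomial.eval_one]
    simp only [hM, Polynomial.eval_add, Polynomial.eval_mul, Polynomial.eval_X] at htl
    simp only [Expr.cost, Nat.size_zero]
    have : (n + 1) * ((p.time (L + Polynomial.X * p.grow)).eval x +
        60 * (L.eval x + x * p.grow.eval x + 2)) ≤
        (x + 1) * ((p.time (L + Polynomial.X * p.grow)).eval x +
        60 * (L.eval x + x * p.grow.eval x + 2)) := by
      gcongr
    omega

theorem sem_ite_pos {b : Expr} {p q : LP} {s : Mem} (h : b.eval s ≠ 0) :
    (ite b p q).sem s = p.sem s := if_pos h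

theorem sem_ite_neg {b : Expr} {p q : LP} {s : Mem} (h : ¬ b.eval s ≠ 0) :
    (ite b p q).sem s = q.sem s := if_neg h

/-- Invariant rule for bounded loops. -/
theorem loop_induction {i : ℕ} {p : LP} (s : Mem) (I : ℕ → Mem → Prop)
    (h0 : I 0 (s.write i 0 0))
    (hstep : ∀ k < s 0 0, ∀ s', s' i 0 = k → (∀ a ∉ p.writes, s' a = s.write i 0 k a) →
      I k s' → I (k + 1) ((p.sem s').write i 0 (k + 1))) :
    I (s 0 0) ((loop i p).sem s) := by
  have key : ∀ k ≤ s 0 0, I k (loopState p.sem i s k) := by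
    intro k hk
    induction k with
    | zero => exact h0
    | succ k ih =>
      exact hstep k hk _ (loopState_counter _ _ _ _)
        (fun a h => loopState_eq_write h i s k) (ih (by omega))
  exact key _ le_rfl

theorem _root_.WED.Mem.write_of_ne {s : Mem} {a b i x : ℕ} (h : a ≠ b) :
    s.write b i x a = s a := by
  funext j
  simp [Mem.write, h]

open Classical in
/-- A loop whose body in round `k` assigns `c j` to the cells `j` of bank `a` with `Q k j`. -/
theorem sem_loop_assign {i a : ℕ} {p : LP} (hia : a ≠ i) (s : Mem) (c : ℕ → ℕ)
    (Q : ℕ → ℕ → Prop)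
    (hp : ∀ k < s 0 0, ∀ s', s' i 0 = k → (∀ b ∉ p.writes, s' b = s.write i 0 k b) →
      (∀ j, s' a j = if ∃ k' < k, Q k' j then c j else s a j) →
      ∀ j, p.sem s' a j = if Q k j then c j else s' a j) (j : ℕ) :
    (loop i p).sem s a j = if ∃ k < s 0 0, Q k j then c j else s a j := by
  refine loop_induction s (fun k s' => ∀ j, s' a j = if ∃ k' < k, Q k' j then c j else s a j)
    (by simp [Mem.write_of_ne hia]) ?_ j
  intro k hk s' h1 h2 h3 j
  rw [Mem.write_of_ne hia, hp k hk s' h1 h2 h3 j, h3]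
  by_cases hQ : Q k j
  · rw [if_pos hQ, if_pos ⟨k, by omega, hQ⟩]
  · rw [if_neg hQ]
    congr 1
    refine propext ⟨fun ⟨k', h, h'⟩ => ⟨k', by omega, h'⟩, fun ⟨k', h, h'⟩ => ⟨k', ?_, h'⟩⟩
    have : k' ≠ k := by
      rintro rfl
      exact hQ h'
    omega

/-- A loop whose body in round `k` adds `f k j` to each cell `j` of bank `a`. -/
theorem sem_loop_sum {i a : ℕ} {p : LP} (hia : a ≠ i) (s : Mem) (f : ℕ → ℕ → ℕ)
    (hp : ∀ k < s 0 0, ∀ s', s' i 0 = k → (∀ b ∉ p.writes, s' b = s.write i 0 k b) →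
      ∀ j, p.sem s' a j = s' a j + f k j) (j : ℕ) :
    (loop i p).sem s a j = s a j + ∑ k ∈ Finset.range (s 0 0), f k j := by
  refine loop_induction s (fun k s' => ∀ j, s' a j = s a j + ∑ k ∈ Finset.range k, f k j)
    (by simp [Mem.write_of_ne hia]) ?_ j
  intro k hk s' h1 h2 h3 j
  rw [Mem.write_of_ne hia, hp k hk s' h1 h2 j, h3, Finset.sum_range_succ, add_assoc]

end LP

theorem length_le_inputLength (l : List ℕ) : l.length ≤ inputLength l := by
  induction l with
  | nil => simp
  | cons x l ih => simp only [inputLength, List.map_cons, List.sum_cons, List.length_cons] at *; omega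

theorem size_le_inputLength {l : List ℕ} {x : ℕ} (h : x ∈ l) : Nat.size x ≤ inputLength l := by
  have : Nat.size x + 1 ≤ inputLength l :=
    List.single_le_sum (by simp) _ (List.mem_map.2 ⟨x, h, rfl⟩)
  omega

theorem initMem_sizeLE (l : List ℕ) : (initMem l).SizeLE (inputLength l) := by
  intro a i
  unfold initMem
  split_ifs
  · by_cases h : i < l.length
    · rw [List.getD_eq_getElem _ _ h]
      exact size_le_inputLength (List.getElem_mem h)
    · rw [List.getD_eq_default _ _ (by omega)]
      simp
  · simp

/-- A program with bounded loops that answers all instances of a graph class correctly solves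
WED in polynomial time on this class. -/
theorem solvableInPolyTime_of_sem {C : ∀ n : ℕ, SimpleGraph (Fin n) → Prop} (p : LP)
    (hp : p.ok = true)
    (h : ∀ I : Instance, C I.n I.graph → I.IsAnswer (answer I.n (p.sem (initMem I.encode)))) :
    SolvableInPolyTime C := by
  refine ⟨p.compile, p.time Polynomial.X, fun I hI => ?_⟩
  have hn : initMem I.encode 0 0 ≤ inputLength I.encode := by
    -- The input contains one weight entry per vertex, so its length bounds the number of rounds of
    -- each loop.
    refine le_trans ?_ (length_le_inputLength _)
    simp [initMem, Instance.encode]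
    omega
  obtain ⟨t, ht, htl⟩ := LP.exec_compile hp (L := Polynomial.X) hn
    (by simpa using initMem_sizeLE I.encode)
  exact ⟨_, t, ht, htl, h I hI⟩

end WED

namespace WED

/-! ### Maximum weight independent sets in the square -/

section Square

variable {V : Type*} {G : SimpleGraph V}

/-- The state of the backward phase of Frank's algorithm after the stack entries with indices at
least `m` have been processed. -/
structure FrankSelection (G : SimpleGraph V) (n m : ℕ) (st : ℕ → Option V) (C : ℕ → Finset V)
    (J : Finset V) : Prop where
  indep : ∀ a ∈ J, ∀ b ∈ J, Close G a b → a = b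
  mem_stack : ∀ a ∈ J, ∃ i < n, m ≤ i ∧ st i = some a
  hit : ∀ i < n, m ≤ i → ∀ v, st i = some v → ∃ u ∈ J, u ∈ C i

theorem FrankSelection.init (G : SimpleGraph V) (n : ℕ) (st : ℕ → Option V)
    (C : ℕ → Finset V) : FrankSelection G n n st C ∅ where
  indep := by simp
  mem_stack := by simp
  hit := by intro i h1 h2; omega

theorem FrankSelection.skip {n m : ℕ} {st : ℕ → Option V} {C : ℕ → Finset V} {J : Finset V}
    (h : FrankSelection G n (m + 1) st C J)
    (hm : ∀ v, st m = some v → ∃ u ∈ J, u ∈ C m) : FrankSelection G n m st C J where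
  indep := h.indep
  mem_stack a ha := by
    obtain ⟨i, h1, h2, h3⟩ := h.mem_stack a ha
    exact ⟨i, h1, by omega, h3⟩
  hit i hi hmi v hv := by
    by_cases him : i = m
    · exact him ▸ hm v (him ▸ hv)
    · exact h.hit i hi (by omega) v hv

variable [DecidableEq V]

/-- The total value at `v` of the first `k` cliques. -/
def cover (C : ℕ → Finset V) (y : ℕ → ℕ) (k : ℕ) (v : V) : ℕ :=
  ∑ j ∈ Finset.range k, if v ∈ C j then y j else 0

/-- The state of Frank's algorithm on the square of `G` after `k` rounds: `A` is the set of
remaining vertices, `R` are their residual weights, `st` is the stack of the vertices that were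
eliminated with positive residual weight, `C` and `y` are the cliques and their values that form
a dual solution. -/
structure FrankState (G : SimpleGraph V) (W : V → ℕ) (S : Finset V) (k : ℕ) (A : Finset V)
    (R : V → ℕ) (st : ℕ → Option V) (C : ℕ → Finset V) (y : ℕ → ℕ) : Prop where
  subset : A ⊆ S
  clique : ∀ j < k, ∀ a ∈ C j, ∀ b ∈ C j, Close G a b
  le : ∀ v ∈ S, W v ≤ (if v ∈ A then R v else 0) + cover C y k v
  eq : ∀ v ∈ A, R v ≠ 0 → W v = R v + cover C y k v
  top : ∀ j < k, y j ≠ 0 → ∃ v, st j = some v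
  mem : ∀ j < k, ∀ v, st j = some v → v ∈ S ∧ v ∉ A ∧ v ∈ C j ∧ W v = cover C y k v
  mem_of_alive : ∀ j < k, ∀ v, st j = some v → ∀ u ∈ A, Close G v u → u ∈ C j
  mem_of_stack : ∀ i < k, ∀ j < i, ∀ u v, st j = some v → st i = some u → Close G v u → u ∈ C j

theorem FrankState.init (G : SimpleGraph V) (S : Finset V) (W : V → ℕ) (st : ℕ → Option V) :
    FrankState G W S 0 S W st (fun _ => ∅) fun _ => 0 where
  subset := subset_rfl
  clique := by simp
  le v hv := by simp [hv, cover]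
  eq := by simp [cover]
  top := by simp
  mem := by simp
  mem_of_alive := by simp
  mem_of_stack := by simp

theorem cover_succ (C : ℕ → Finset V) (y : ℕ → ℕ) (k : ℕ) (B : Finset V) (x : ℕ) (v : V) :
    cover (fun j => if j = k then B else C j) (fun j => if j = k then x else y j) (k + 1) v =
      cover C y k v + if v ∈ B then x else 0 := by
  unfold cover
  rw [Finset.sum_range_succ]
  simp only [if_true]
  congr 1
  refine Finset.sum_congr rfl fun j hj => ?_
  rw [if_neg (Finset.mem_range.1 hj).ne, if_neg (Finset.mem_range.1 hj).ne]

theorem FrankState.congr_stack {W : V → ℕ} {S A : Finset V} {k : ℕ} {R : V → ℕ}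
    {st st' : ℕ → Option V} {C : ℕ → Finset V} {y : ℕ → ℕ} (h : FrankState G W S k A R st C y)
    (hst : ∀ j < k, st' j = st j) : FrankState G W S k A R st' C y where
  subset := h.subset
  clique := h.clique
  le := h.le
  eq := h.eq
  top j hj := by rw [hst j hj]; exact h.top j hj
  mem j hj := by rw [hst j hj]; exact h.mem j hj
  mem_of_alive j hj := by rw [hst j hj]; exact h.mem_of_alive j hj
  mem_of_stack i hi j hj := by
    rw [hst j (hj.trans hi), hst i hi]
    exact h.mem_of_stack i hi j hj

/-- The forward phase always runs `n` rounds; an idle round records an empty clique of value zero.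
-/
theorem FrankState.skip {W : V → ℕ} {S A : Finset V} {k : ℕ} {R : V → ℕ} {st : ℕ → Option V}
    {C : ℕ → Finset V} {y : ℕ → ℕ} (h : FrankState G W S k A R st C y) (hst : st k = none) :
    ∃ C' y', FrankState G W S (k + 1) A R st C' y' := by
  have hcov : ∀ v, cover (fun j => if j = k then ∅ else C j) (fun j => if j = k then 0 else y j)
      (k + 1) v = cover C y k v := by
    intro v
    rw [cover_succ]
    simp
  have hlt : ∀ {j}, j < k + 1 → ¬ j = k → j < k := by omega
  refine ⟨fun j => if j = k then ∅ else C j, fun j => if j = k then 0 else y j,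
    h.subset, ?_, ?_, ?_, ?_, ?_, ?_, ?_⟩
  · intro j hj
    by_cases hjk : j = k
    · simp [hjk]
    · simpa [hjk] using h.clique j (hlt hj hjk)
  · intro v hv
    rw [hcov]
    exact h.le v hv
  · intro v hv hR
    rw [hcov]
    exact h.eq v hv hR
  · intro j hj
    by_cases hjk : j = k
    · simp [hjk]
    · simpa [hjk] using h.top j (hlt hj hjk)
  · intro j hj v hv
    have hjk : ¬ j = k := by
      rintro rfl
      simp [hst] at hv
    rw [hcov, if_neg hjk]
    exact h.mem j (hlt hj hjk) v hv
  · intro j hj v hv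
    have hjk : ¬ j = k := by
      rintro rfl
      simp [hst] at hv
    rw [if_neg hjk]
    exact h.mem_of_alive j (hlt hj hjk) v hv
  · intro i hi j hj u v hv hu
    have hik : ¬ i = k := by
      rintro rfl
      simp [hst] at hu
    rw [if_neg (by omega)]
    exact h.mem_of_stack i (hlt hi hik) j hj u v hv hu

open Classical in
-- The new clique is the set of remaining vertices close to `v`, valued by the residual weight of
-- `v`; simpliciality makes it a clique. Truncated subtraction may overcover a vertex, but its
-- residual weight is then zero, so it is never stacked, and tightness is claimed only for nonzero
-- residuals.
theorem FrankState.step {W : V → ℕ} {S A : Finset V} {k : ℕ} {R R' : V → ℕ} {st : ℕ → Option V}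
    {C : ℕ → Finset V} {y : ℕ → ℕ} (h : FrankState G W S k A R st C y) {v : V}
    (hv : SimplicialIn G A v) (hst : st k = if R v ≠ 0 then some v else none)
    (hR : ∀ u ∈ A.erase v, R' u = if Close G v u then R u - R v else R u) :
    ∃ C' y', FrankState G W S (k + 1) (A.erase v) R' st C' y' := by
  have hvA := hv.1
  have hmemB : ∀ u, u ∈ A.filter (Close G v) ↔ u ∈ A ∧ Close G v u := fun u => Finset.mem_filter
  generalize A.filter (Close G v) = B at hmemB
  have hcov : ∀ u, cover (fun j => if j = k then B else C j)
      (fun j => if j = k then R v else y j) (k + 1) u =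
      cover C y k u + if u ∈ A ∧ Close G v u then R v else 0 := by
    intro u
    rw [cover_succ]
    simp only [hmemB]
  have hlt : ∀ {j}, j < k + 1 → ¬ j = k → j < k := by omega
  have hstk : ∀ u, st k = some u → u = v ∧ R v ≠ 0 := by
    intro u hu
    rw [hst] at hu
    split_ifs at hu with h0
    exact ⟨(Option.some.inj hu).symm, h0⟩
  refine ⟨fun j => if j = k then B else C j, fun j => if j = k then R v else y j,
    (Finset.erase_subset _ _).trans h.subset, ?_, ?_, ?_, ?_, ?_, ?_, ?_⟩
  · intro j hj
    by_cases hjk : j = k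
    · simp only [hjk, if_true, hmemB]
      exact fun a ha b hb => hv.2 a ha.1 b hb.1 ha.2 hb.2
    · simpa [hjk] using h.clique j (hlt hj hjk)
  · intro u hu
    rw [hcov]
    have := h.le u hu
    by_cases huA : u ∈ A
    · by_cases huv : u = v
      · subst huv
        simpa [huA, Close.refl, add_comm] using this
      · have hue : u ∈ A.erase v := Finset.mem_erase.2 ⟨huv, huA⟩
        rw [if_pos hue, hR u hue]
        simp only [huA, if_true, true_and] at this ⊢
        split_ifs <;> omega
    · have hue : u ∉ A.erase v := fun h => huA (Finset.mem_of_mem_erase h)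
      simp only [huA, hue, if_false, false_and] at this ⊢
      omega
  · intro u hue hRu
    have huA := Finset.mem_of_mem_erase hue
    rw [hcov]
    rw [hR u hue] at hRu ⊢
    simp only [huA, true_and]
    by_cases hc : Close G v u
    · simp only [hc, if_true] at hRu ⊢
      have := h.eq u huA (by omega)
      omega
    · simp only [hc, if_false] at hRu ⊢
      have := h.eq u huA hRu
      omega
  · intro j hj
    by_cases hjk : j = k
    · subst hjk
      intro h0
      simp only [if_true] at h0
      exact ⟨v, by rw [hst, if_pos h0]⟩
    · simpa [hjk] using h.top j (hlt hj hjk)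
  · intro j hj u hu
    rw [hcov]
    by_cases hjk : j = k
    · subst hjk
      obtain ⟨rfl, h0⟩ := hstk u hu
      refine ⟨h.subset hvA, by simp, by simp [hmemB, hvA, Close.refl], ?_⟩
      have := h.eq u hvA h0
      simp only [hvA, Close.refl, and_self, if_true]
      omega
    · obtain ⟨h1, h2, h3, h4⟩ := h.mem j (hlt hj hjk) u hu
      refine ⟨h1, fun h => h2 (Finset.mem_of_mem_erase h), by rwa [if_neg hjk], ?_⟩
      simp [h2, h4]
  · intro j hj w hw u hu hc
    have huA := Finset.mem_of_mem_erase hu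
    by_cases hjk : j = k
    · subst hjk
      obtain ⟨rfl, -⟩ := hstk w hw
      rw [if_pos rfl, hmemB]
      exact ⟨huA, hc⟩
    · rw [if_neg hjk]
      exact h.mem_of_alive j (hlt hj hjk) w hw u huA hc
  · intro i hi j hj u w hw hu hc
    rw [if_neg (by omega)]
    by_cases hik : i = k
    · subst hik
      obtain ⟨rfl, -⟩ := hstk u hu
      exact h.mem_of_alive j hj w hw u hvA hc
    · exact h.mem_of_stack i (hlt hi hik) j hj u w hw hu hc

theorem FrankSelection.insert {n m : ℕ} (hmn : m < n) {st : ℕ → Option V} {C : ℕ → Finset V}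
    {J : Finset V} (h : FrankSelection G n (m + 1) st C J) {v : V} (hv : st m = some v)
    (hvC : v ∈ C m) (hJ : ∀ u ∈ J, ¬ Close G v u) : FrankSelection G n m st C (insert v J) where
  indep a ha b hb hab := by
    rw [Finset.mem_insert] at ha hb
    rcases ha with rfl | ha <;> rcases hb with rfl | hb
    · rfl
    · exact absurd hab (hJ b hb)
    · exact absurd hab.symm (hJ a ha)
    · exact h.indep a ha b hb hab
  mem_stack a ha := by
    rcases Finset.mem_insert.1 ha with rfl | ha
    · exact ⟨m, hmn, le_rfl, hv⟩
    · obtain ⟨i, h1, h2, h3⟩ := h.mem_stack a ha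
      exact ⟨i, h1, by omega, h3⟩
  hit i hi hmi w hw := by
    by_cases him : i = m
    · exact ⟨v, by simp, him ▸ hvC⟩
    · obtain ⟨u, hu, huC⟩ := h.hit i hi (by omega) w hw
      exact ⟨u, by simp [hu], huC⟩

/-- Double counting of pairs of a vertex and a clique containing it. -/
theorem sum_cover (C : ℕ → Finset V) (y : ℕ → ℕ) (n : ℕ) (I : Finset V) :
    ∑ v ∈ I, cover C y n v = ∑ j ∈ Finset.range n, (I.filter (· ∈ C j)).card * y j := by
  unfold cover
  rw [Finset.sum_comm]
  refine Finset.sum_congr rfl fun j _ => ?_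
  rw [← Finset.sum_filter, Finset.sum_const, smul_eq_mul]

/-- If all vertices have been eliminated, then the selected set is independent in the square and
has maximum weight. -/
theorem FrankSelection.sum_le {W : V → ℕ} {S : Finset V} {n : ℕ} {R : V → ℕ} {st : ℕ → Option V}
    {C : ℕ → Finset V} {y : ℕ → ℕ} {J : Finset V} (h : FrankState G W S n ∅ R st C y)
    (hJ : FrankSelection G n 0 st C J) {I : Finset V} (hIS : I ⊆ S)
    (hI : ∀ a ∈ I, ∀ b ∈ I, Close G a b → a = b) : ∑ v ∈ I, W v ≤ ∑ v ∈ J, W v := by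
  calc ∑ v ∈ I, W v ≤ ∑ v ∈ I, cover C y n v :=
        Finset.sum_le_sum fun v hv => by simpa using h.le v (hIS hv)
    _ = ∑ j ∈ Finset.range n, (I.filter (· ∈ C j)).card * y j := sum_cover C y n I
    -- Complementary slackness: a clique of nonzero value contains at most one vertex of `I` and at
    -- least one of `J`.
    _ ≤ ∑ j ∈ Finset.range n, (J.filter (· ∈ C j)).card * y j := by
        refine Finset.sum_le_sum fun j hj => ?_
        by_cases hy : y j = 0
        · simp [hy]
        have hj := Finset.mem_range.1 hj
        refine Nat.mul_le_mul_right _ (le_trans (b := 1) ?_ ?_)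
        · refine Finset.card_le_one.2 fun a ha b hb => ?_
          rw [Finset.mem_filter] at ha hb
          exact hI a ha.1 b hb.1 (h.clique j hj a ha.2 b hb.2)
        · obtain ⟨v, hv⟩ := h.top j hj hy
          obtain ⟨u, hu, huC⟩ := hJ.hit j hj (Nat.zero_le _) v hv
          exact Finset.card_pos.2 ⟨u, Finset.mem_filter.2 ⟨hu, huC⟩⟩
    _ = ∑ v ∈ J, cover C y n v := (sum_cover C y n J).symm
    -- Selected vertices come from the stack, where the dual constraint is tight.
    _ = ∑ v ∈ J, W v := by
        refine Finset.sum_congr rfl fun v hv => ?_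
        obtain ⟨i, hi, -, hiv⟩ := hJ.mem_stack v hv
        exact (h.mem i hi v hiv).2.2.2.symm

end Square

/-! ### Efficient domination as an independent set problem -/

section Weights

variable {V : Type*} {G : SimpleGraph V}

theorem IsEDS.eq_of_close {D : Finset V} (hD : IsEDS G D) :
    ∀ a ∈ D, ∀ b ∈ D, Close G a b → a = b := by
  rintro a ha b hb ⟨w, h1, h2⟩
  exact hD.eq ha hb (h1.imp Eq.symm SimpleGraph.Adj.symm) (h2.imp Eq.symm SimpleGraph.Adj.symm)

theorem isEDS_iff {D : Finset V} : IsEDS G D ↔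
    (∀ a ∈ D, ∀ b ∈ D, Close G a b → a = b) ∧ ∀ w, ∃ v ∈ D, v = w ∨ G.Adj v w := by
  constructor
  · intro h
    refine ⟨h.eq_of_close, fun w => ?_⟩
    obtain ⟨d, ⟨hd, hdw⟩, -⟩ := h w
    exact ⟨d, hd, hdw⟩
  · rintro ⟨h1, h2⟩ w
    obtain ⟨v, hv, hvw⟩ := h2 w
    exact ⟨v, ⟨hv, hvw⟩, fun u ⟨hu, huw⟩ => h1 u hu v hv
      ⟨w, huw.imp Eq.symm SimpleGraph.Adj.symm, hvw.imp Eq.symm SimpleGraph.Adj.symm⟩⟩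

variable [Fintype V]

open Classical in
/-- The closed neighbourhood. -/
noncomputable def closedNbhd (G : SimpleGraph V) (v : V) : Finset V :=
  Finset.univ.filter fun w => v = w ∨ G.Adj v w

theorem mem_closedNbhd {v w : V} : w ∈ closedNbhd G v ↔ v = w ∨ G.Adj v w := by
  simp [closedNbhd]

/-- The closed neighbourhoods are disjoint, so the sum counts dominated vertices. -/
theorem sum_card_closedNbhd {D : Finset V} (hD : ∀ a ∈ D, ∀ b ∈ D, Close G a b → a = b) :
    ∑ v ∈ D, (closedNbhd G v).card ≤ Fintype.card V ∧
      ((∑ v ∈ D, (closedNbhd G v).card = Fintype.card V) ↔ ∀ w, ∃ v ∈ D, v = w ∨ G.Adj v w) := by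
  classical
  have h : (D.biUnion (closedNbhd G)).card = ∑ v ∈ D, (closedNbhd G v).card := by
    refine Finset.card_biUnion fun a ha b hb hab => ?_
    rw [Function.onFun, Finset.disjoint_left]
    intro w hwa hwb
    rw [mem_closedNbhd] at hwa hwb
    exact hab (hD a ha b hb
      ⟨w, hwa.imp Eq.symm SimpleGraph.Adj.symm, hwb.imp Eq.symm SimpleGraph.Adj.symm⟩)
  rw [← h]
  refine ⟨Finset.card_le_univ _, ?_⟩
  rw [Finset.card_eq_iff_eq_univ, Finset.eq_univ_iff_forall]
  simp [mem_closedNbhd]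

end Weights

/-- A set of vertices of finite weight that is independent in the square and has maximum total
weight `|N[v]| * M - ω(v)` among such sets yields the answer of the instance. -/
theorem Instance.isAnswer_of_sum_le (I : Instance) (M : ℕ)
    (hM : M = 1 + ∑ v, if I.weight v = ⊤ then 0 else (I.weight v).toNat + 1)
    (J : Finset (Fin I.n)) (hJ : ∀ v ∈ J, I.weight v ≠ ⊤)
    (hind : ∀ a ∈ J, ∀ b ∈ J, Close I.graph a b → a = b)
    (hmax : ∀ D : Finset (Fin I.n), IsEDS I.graph D → (∀ v ∈ D, I.weight v ≠ ⊤) →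
      ∑ v ∈ D, ((closedNbhd I.graph v).card * M - (I.weight v).toNat) ≤
        ∑ v ∈ J, ((closedNbhd I.graph v).card * M - (I.weight v).toNat)) :
    (IsEDS I.graph J → I.IsAnswer (some J)) ∧ (¬ IsEDS I.graph J → I.IsAnswer none) := by
  have hlt : ∀ D : Finset (Fin I.n), (∀ v ∈ D, I.weight v ≠ ⊤) →
      ∑ v ∈ D, (I.weight v).toNat < M := by
    intro D hD
    rw [hM, Nat.lt_one_add_iff]
    calc ∑ v ∈ D, (I.weight v).toNat
        ≤ ∑ v ∈ D, if I.weight v = ⊤ then 0 else (I.weight v).toNat + 1 :=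
          Finset.sum_le_sum fun v hv => by rw [if_neg (hD v hv)]; omega
      _ ≤ _ := Finset.sum_le_sum_of_subset (Finset.subset_univ D)
  have htot : ∀ D : Finset (Fin I.n), (∀ v ∈ D, I.weight v ≠ ⊤) →
      I.total D = ((∑ v ∈ D, (I.weight v).toNat : ℕ) : ℕ∞) := by
    intro D hD
    rw [Instance.total, Nat.cast_sum]
    exact Finset.sum_congr rfl fun v hv => (ENat.natCast_toNat (hD v hv)).symm
  have hfin : ∀ D : Finset (Fin I.n), I.total D ≠ ⊤ → ∀ v ∈ D, I.weight v ≠ ⊤ := by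
    intro D hD v hv htop
    refine hD (top_le_iff.1 ?_)
    rw [← htop]
    exact Finset.single_le_sum (f := I.weight) (fun _ _ => zero_le) hv
  have hsum : ∀ D : Finset (Fin I.n), (∀ v ∈ D, I.weight v ≠ ⊤) →
      ∑ v ∈ D, ((closedNbhd I.graph v).card * M - (I.weight v).toNat) +
        ∑ v ∈ D, (I.weight v).toNat = (∑ v ∈ D, (closedNbhd I.graph v).card) * M := by
    intro D hD
    -- No subtraction truncates, because each finite weight is below `M` and `|N[v]| ≥ 1`.
    rw [← Finset.sum_add_distrib, Finset.sum_mul]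
    refine Finset.sum_congr rfl fun v hv => Nat.sub_add_cancel ?_
    have h1 : (I.weight v).toNat < M := by
      have := hlt {v} (by simpa using hD v hv)
      simpa using this
    have h2 : 1 ≤ (closedNbhd I.graph v).card :=
      Finset.card_pos.2 ⟨v, mem_closedNbhd.2 (Or.inl rfl)⟩
    nlinarith
  have hJn := sum_card_closedNbhd hind
  have key : ∀ D : Finset (Fin I.n), IsEDS I.graph D → (∀ v ∈ D, I.weight v ≠ ⊤) →
      IsEDS I.graph J ∧ ∑ v ∈ J, (I.weight v).toNat ≤ ∑ v ∈ D, (I.weight v).toNat := by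
    intro D hD hDw
    have h1 := hmax D hD hDw
    have h2 := hsum D hDw
    have h3 := hsum J hJ
    have h4 := hlt D hDw
    rw [(sum_card_closedNbhd hD.eq_of_close).2.2 (isEDS_iff.1 hD).2] at h2
    -- Leaving a vertex undominated loses at least `M`, more than the total weight of `D`.
    have h5 : ∑ v ∈ J, (closedNbhd I.graph v).card = Fintype.card (Fin I.n) := by
      refine le_antisymm hJn.1 ?_
      by_contra! h6
      have : (∑ v ∈ J, (closedNbhd I.graph v).card + 1) * M ≤ Fintype.card (Fin I.n) * M :=
        Nat.mul_le_mul_right _ h6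
      rw [add_mul, one_mul] at this
      omega
    refine ⟨isEDS_iff.2 ⟨hind, hJn.2.1 h5⟩, ?_⟩
    rw [h5] at h3
    omega
  constructor
  · intro hE
    refine ⟨hE, ?_, fun D hD => ?_⟩
    · rw [htot J hJ]
      exact ENat.natCast_ne_top _
    · by_cases hDt : I.total D = ⊤
      · rw [hDt]
        exact le_top
      · have hDw := hfin D hDt
        rw [htot J hJ, htot D hDw]
        exact_mod_cast (key D hD hDw).2
  · intro hE D hD
    by_contra hDt
    exact hE (key D hD (hfin D hDt)).1

end WED

namespace WED

/-! ### The program -/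

/-- Address arithmetic for a matrix stored row by row and followed by further data. -/
theorem getElem?_flatMap_append {α β : Type*} (f : α → List β) (n : ℕ) (r : List β) (l : List α)
    (hf : ∀ a ∈ l, (f a).length = n) :
    (∀ i (hi : i < l.length), ∀ j < n, (l.flatMap f ++ r)[i * n + j]? = (f l[i])[j]?) ∧
      ∀ j, (l.flatMap f ++ r)[l.length * n + j]? = r[j]? := by
  induction l with
  | nil => simp
  | cons a l ih =>
    obtain ⟨h1, h2⟩ := ih fun b hb => hf b (List.mem_cons_of_mem _ hb)
    have ha := hf a List.mem_cons_self
    constructor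
    · intro i hi j hj
      cases i with
      | zero =>
        simp only [List.flatMap_cons, List.append_assoc, zero_mul, zero_add,
          List.getElem_cons_zero]
        rw [List.getElem?_append_left (by omega)]
      | succ i =>
        simp only [List.flatMap_cons, List.append_assoc, List.getElem_cons_succ]
        rw [List.getElem?_append_right (by rw [ha, add_mul]; omega), ← h1 i (by simpa using hi) j hj]
        congr 1
        rw [ha, add_mul]
        omega
    · intro j
      simp only [List.flatMap_cons, List.append_assoc, List.length_cons]
      rw [List.getElem?_append_right (by rw [ha, add_mul]; omega), ← h2 j]
      congr 1
      rw [ha, add_mul]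
      omega

namespace Instance

variable (I : Instance)

theorem initMem_n : initMem I.encode 0 0 = I.n := by
  simp [initMem, encode]

open Classical in
theorem initMem_adj (u v : Fin I.n) :
    initMem I.encode 0 (1 + (u.val * I.n + v.val)) = if I.graph.Adj u v then 1 else 0 := by
  have h := (getElem?_flatMap_append
    (fun u => (List.finRange I.n).map fun v => if I.graph.Adj u v then 1 else 0) I.n
    ((List.finRange I.n).map fun v => if I.weight v = ⊤ then 0 else (I.weight v).toNat + 1)
    (List.finRange I.n) (by simp)).1 u (by simp) v v.isLt
  simp only [initMem, encode, if_true, List.getD_eq_getElem?_getD, List.cons_append]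
  rw [add_comm 1, List.getElem?_cons_succ, h]
  simp

open Classical in
theorem initMem_weight (v : Fin I.n) :
    initMem I.encode 0 (1 + (I.n * I.n + v.val)) =
      if I.weight v = ⊤ then 0 else (I.weight v).toNat + 1 := by
  have h := (getElem?_flatMap_append
    (fun u => (List.finRange I.n).map fun v => if I.graph.Adj u v then 1 else 0) I.n
    ((List.finRange I.n).map fun v => if I.weight v = ⊤ then 0 else (I.weight v).toNat + 1)
    (List.finRange I.n) (by simp)).2 v
  rw [List.length_finRange] at h
  simp only [initMem, encode, if_true, List.getD_eq_getElem?_getD, List.cons_append]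
  rw [add_comm 1, List.getElem?_cons_succ, h]
  simp

end Instance

namespace Frank

open WED.Expr WED.LP

/-- The scalar variable in bank `b`. -/
def sc (b : ℕ) : Expr := cell b (lit 0)

/-- The number of vertices. -/
def nE : Expr := sc 0

/-- The encoded weight of a vertex. -/
def wtE (v : Expr) : Expr := cell 0 (add (lit 1) (add (mul nE nE) v))

/-- Nonzero if and only if `u` and `v` are equal or adjacent. -/
def nbE (u v : Expr) : Expr :=
  add (cell 0 (add (lit 1) (add (mul u nE) v))) (sub (lit 1) (add (sub u v) (sub v u)))

/-- The entry of the table in bank `2` for the vertices `u` and `v`. -/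
def clE (u v : Expr) : Expr := cell 2 (add (mul u nE) v)

/-- Computes the adjacency matrix of the square in bank `2`. -/
def closeLP : LP :=
  loop 10 (loop 11 (loop 12 (ite (mul (nbE (sc 12) (sc 10)) (nbE (sc 12) (sc 11)))
    (store 2 (add (mul (sc 10) nE) (sc 11)) (lit 1)) skip)))

/-- Computes a number larger than the sum of the finite weights in bank `3`. -/
def totalLP : LP :=
  seq (store 3 (lit 0) (lit 1)) (loop 10 (store 3 (lit 0) (add (sc 3) (wtE (sc 10)))))

/-- Adds the number in bank `3` to the weight of a vertex for each vertex that it dominates. -/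
def weightLP : LP :=
  loop 11 (ite (nbE (sc 10) (sc 11)) (store 4 (sc 10) (add (cell 4 (sc 10)) (sc 3))) skip)

/-- Marks the vertices of finite weight in bank `5` and computes the weights for the independent
set problem in bank `4`. -/
def initLP : LP :=
  loop 10 (ite (wtE (sc 10))
    -- The initial `1` in bank `4` cancels the shift in the encoding of finite weights.
    (seq (store 5 (sc 10) (lit 1)) (seq (store 4 (sc 10) (lit 1))
      (seq weightLP (store 4 (sc 10) (sub (cell 4 (sc 10)) (wtE (sc 10)))))))
    skip)

/-- Sets bank `8` to a nonzero number if the remaining vertices that are close to the vertex in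
bank `11` are not pairwise close. -/
def badLP : LP :=
  loop 13 (loop 14 (ite
    (mul (mul (mul (cell 5 (sc 13)) (cell 5 (sc 14))) (mul (clE (sc 11) (sc 13)) (clE (sc 11) (sc 14))))
      (sub (lit 1) (clE (sc 13) (sc 14))))
    (store 8 (lit 0) (lit 1)) skip))

/-- Finds a simplicial vertex of the remaining graph. -/
def pickLP : LP :=
  loop 11 (ite (cell 5 (sc 11))
    (seq (store 8 (lit 0) (lit 0)) (seq badLP
      (ite (sub (lit 1) (sc 8)) (store 7 (lit 0) (add (sc 11) (lit 1))) skip)))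
    skip)

/-- Subtracts the number in bank `9` from the weights of the remaining vertices that are close to
the current vertex. -/
def updateLP : LP :=
  loop 13 (ite (mul (cell 5 (sc 13)) (clE (sub (sc 7) (lit 1)) (sc 13)))
    (store 4 (sc 13) (sub (cell 4 (sc 13)) (sc 9))) skip)

/-- Eliminates the vertex that has been found. -/
def eliminateLP : LP :=
  ite (sc 7)
    (seq (store 9 (lit 0) (cell 4 (sub (sc 7) (lit 1))))
      (seq (ite (sc 9) (store 6 (sc 15) (sc 7)) skip)
        (seq (store 5 (sub (sc 7) (lit 1)) (lit 0)) updateLP)))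
    skip

/-- The forward phase of Frank's algorithm, with the stack in bank `6`. -/
def forwardLP : LP :=
  loop 15 (seq (store 7 (lit 0) (lit 0)) (seq pickLP eliminateLP))

/-- Sets bank `8` to a nonzero number if a selected vertex is close to the current vertex. -/
def conflictLP : LP :=
  loop 13 (ite (mul (cell 1 (add (sc 13) (lit 1))) (clE (sub (sc 7) (lit 1)) (sc 13)))
    (store 8 (lit 0) (lit 1)) skip)

/-- The backward phase of Frank's algorithm. -/
def backwardLP : LP :=
  loop 15 (seq (store 7 (lit 0) (cell 6 (sub (sub nE (sc 15)) (lit 1))))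
    (ite (sc 7)
      (seq (store 8 (lit 0) (lit 0)) (seq conflictLP
        (ite (sub (lit 1) (sc 8)) (store 1 (sc 7) (lit 1)) skip)))
      skip))

/-- Sets bank `8` to a nonzero number if the vertex in bank `10` is dominated. -/
def dominatedLP : LP :=
  loop 13 (ite (mul (cell 1 (add (sc 13) (lit 1))) (nbE (sc 13) (sc 10)))
    (store 8 (lit 0) (lit 1)) skip)

/-- Checks that all vertices are dominated. -/
def checkLP : LP :=
  seq (store 1 (lit 0) (lit 1))
    (loop 10 (seq (store 8 (lit 0) (lit 0)) (seq dominatedLP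
      (ite (sc 8) skip (store 1 (lit 0) (lit 0))))))

/-- The whole program. -/
def wedLP : LP :=
  seq closeLP (seq totalLP (seq initLP (seq forwardLP (seq backwardLP checkLP))))

theorem wedLP_ok : wedLP.ok = true := by decide

/-! ### Correctness of the preprocessing -/

variable {I : Instance} {s : Mem}

theorem nbE_eval_ne_zero (hs : s 0 = initMem I.encode 0) {e f : Expr} {u v : Fin I.n}
    (he : e.eval s = u.val) (hf : f.eval s = v.val) :
    (nbE e f).eval s ≠ 0 ↔ u = v ∨ I.graph.Adj u v := by
  simp only [nbE, nE, sc, eval, he, hf, hs, I.initMem_n, I.initMem_adj]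
  by_cases huv : u = v
  · simp [huv]
  · have : u.val ≠ v.val := fun h => huv (Fin.ext h)
    have h1 : 1 - (u.val - v.val + (v.val - u.val)) = 0 := by omega
    rw [h1]
    by_cases h : I.graph.Adj u v <;> simp [h, huv]

theorem wtE_eval (hs : s 0 = initMem I.encode 0) {e : Expr} {v : Fin I.n}
    (he : e.eval s = v.val) :
    (wtE e).eval s = if I.weight v = ⊤ then 0 else (I.weight v).toNat + 1 := by
  simp only [wtE, nE, sc, eval, he, hs, I.initMem_n, I.initMem_weight]

theorem closeLP_sem (hs : s 0 = initMem I.encode 0) (h2 : ∀ j, s 2 j = 0) (u v : Fin I.n) :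
    closeLP.sem s 2 (u.val * I.n + v.val) ≠ 0 ↔ Close I.graph u v := by
  classical
  have hn : ∀ {s' : Mem}, s' 0 = s 0 → s' 0 0 = I.n := fun h => by rw [h, hs, I.initMem_n]
  have inner : ∀ (s' : Mem) (u v : Fin I.n), s' 0 = s 0 → s' 10 0 = u.val → s' 11 0 = v.val →
      ∀ j, (loop 12 (ite (mul (nbE (sc 12) (sc 10)) (nbE (sc 12) (sc 11)))
        (store 2 (add (mul (sc 10) nE) (sc 11)) (lit 1)) skip)).sem s' 2 j =
      if Close I.graph u v ∧ j = u.val * I.n + v.val then 1 else s' 2 j := by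
    intro s' u v h0 h10 h11 j
    rw [sem_loop_assign (by decide) s' (fun _ => 1) (fun k j =>
      (∃ w : Fin I.n, w.val = k ∧ (w = u ∨ I.graph.Adj w u) ∧ (w = v ∨ I.graph.Adj w v)) ∧
        j = u.val * I.n + v.val)]
    · congr 1
      rw [hn h0]
      refine propext ⟨?_, ?_⟩
      · rintro ⟨k, hk, ⟨w, -, hw⟩, hj⟩
        exact ⟨⟨w, hw⟩, hj⟩
      · rintro ⟨⟨w, hw⟩, hj⟩
        exact ⟨w, w.isLt, ⟨w, rfl, hw⟩, hj⟩
    · intro k hk t h12 hfr _ j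
      rw [hn h0] at hk
      have t0 : t 0 = s 0 := by rw [hfr 0 (by decide), Mem.write_of_ne (by decide), h0]
      have t10 : t 10 0 = u.val := by rw [hfr 10 (by decide), Mem.write_of_ne (by decide), h10]
      have t11 : t 11 0 = v.val := by rw [hfr 11 (by decide), Mem.write_of_ne (by decide), h11]
      have e1 := nbE_eval_ne_zero (t0.trans hs) (e := sc 12) (f := sc 10) (u := ⟨k, hk⟩) (v := u)
        h12 t10
      have e2 := nbE_eval_ne_zero (t0.trans hs) (e := sc 12) (f := sc 11) (u := ⟨k, hk⟩) (v := v)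
        h12 t11
      have e3 : (add (mul (sc 10) nE) (sc 11)).eval t = u.val * I.n + v.val := by
        simp only [sc, nE, eval, t10, t11, hn t0]
      have hw : (∃ w : Fin I.n, w.val = k ∧ (w = u ∨ I.graph.Adj w u) ∧
          (w = v ∨ I.graph.Adj w v)) ↔ (nbE (sc 12) (sc 10)).eval t ≠ 0 ∧
            (nbE (sc 12) (sc 11)).eval t ≠ 0 := by
        rw [e1, e2]
        constructor
        · rintro ⟨w, rfl, hw⟩
          exact hw
        · exact fun h => ⟨_, rfl, h⟩
      rw [hw, ← e3]
      by_cases hc : (nbE (sc 12) (sc 10)).eval t ≠ 0 ∧ (nbE (sc 12) (sc 11)).eval t ≠ 0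
      · rw [sem_ite_pos (by simpa only [eval, mul_ne_zero_iff] using hc)]
        simp [hc, Mem.write, LP.sem, eval]
      · rw [sem_ite_neg (by simpa only [eval, mul_ne_zero_iff] using hc), if_neg fun h => hc h.1]
        rfl
  have middle : ∀ (s' : Mem) (u : Fin I.n), s' 0 = s 0 → s' 10 0 = u.val → ∀ j,
      (loop 11 (loop 12 (ite (mul (nbE (sc 12) (sc 10)) (nbE (sc 12) (sc 11)))
        (store 2 (add (mul (sc 10) nE) (sc 11)) (lit 1)) skip))).sem s' 2 j =
      if ∃ v : Fin I.n, Close I.graph u v ∧ j = u.val * I.n + v.val then 1 else s' 2 j := by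
    intro s' u h0 h10 j
    rw [sem_loop_assign (by decide) s' (fun _ => 1) (fun k j =>
      ∃ v : Fin I.n, v.val = k ∧ Close I.graph u v ∧ j = u.val * I.n + v.val)]
    · congr 1
      rw [hn h0]
      refine propext ⟨?_, ?_⟩
      · rintro ⟨k, hk, v, -, hv⟩
        exact ⟨v, hv⟩
      · rintro ⟨v, hv⟩
        exact ⟨v, v.isLt, v, rfl, hv⟩
    · intro k hk t h11 hfr _ j
      rw [hn h0] at hk
      rw [inner t u ⟨k, hk⟩ (by rw [hfr 0 (by decide), Mem.write_of_ne (by decide), h0])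
        (by rw [hfr 10 (by decide), Mem.write_of_ne (by decide), h10]) h11]
      congr 1
      refine propext ⟨fun h => ⟨_, rfl, h⟩, ?_⟩
      rintro ⟨v, rfl, h⟩
      exact h
  have outer : ∀ j, closeLP.sem s 2 j =
      if ∃ u v : Fin I.n, Close I.graph u v ∧ j = u.val * I.n + v.val then 1 else s 2 j := by
    intro j
    rw [closeLP, sem_loop_assign (by decide) s (fun _ => 1) (fun k j =>
      ∃ u v : Fin I.n, u.val = k ∧ Close I.graph u v ∧ j = u.val * I.n + v.val)]
    · congr 1
      rw [hn rfl]
      refine propext ⟨?_, ?_⟩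
      · rintro ⟨k, hk, u, v, -, hv⟩
        exact ⟨u, v, hv⟩
      · rintro ⟨u, v, hv⟩
        exact ⟨u, u.isLt, u, v, rfl, hv⟩
    · intro k hk t h10 hfr _ j
      rw [hn rfl] at hk
      rw [middle t ⟨k, hk⟩ (by rw [hfr 0 (by decide), Mem.write_of_ne (by decide)]) h10]
      congr 1
      refine propext ⟨fun ⟨v, h⟩ => ⟨_, v, rfl, h⟩, ?_⟩
      rintro ⟨u, v, rfl, h⟩
      exact ⟨v, h⟩
  rw [outer, h2]
  constructor
  · intro h
    split_ifs at h with h'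
    · obtain ⟨u', v', hc, he⟩ := h'
      -- Since `v < n`, the address `u * n + v` determines `u` and `v`.
      have hpos : 0 < I.n := u.pos
      have e1 : u.val = u'.val := by
        have := congrArg (· / I.n) he
        simpa [mul_comm _ I.n, Nat.mul_add_div hpos, Nat.div_eq_of_lt] using this
      have e2 : v.val = v'.val := by
        rw [e1] at he
        omega
      rwa [Fin.ext e1, Fin.ext e2]
    · exact absurd rfl h
  · intro h
    rw [if_pos ⟨u, v, h, rfl⟩]
    decide

theorem totalLP_sem (hs : s 0 = initMem I.encode 0) :
    totalLP.sem s 3 0 = 1 + ∑ v, if I.weight v = ⊤ then 0 else (I.weight v).toNat + 1 := by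
  have hn : s 0 0 = I.n := by rw [hs, I.initMem_n]
  let f : ℕ → ℕ := fun k => if h : k < I.n then
    (if I.weight ⟨k, h⟩ = ⊤ then 0 else (I.weight ⟨k, h⟩).toNat + 1) else 0
  have key := sem_loop_sum (i := 10) (a := 3)
    (p := store 3 (lit 0) (add (sc 3) (wtE (sc 10)))) (by decide)
    (s.write 3 0 1) (fun k j => if j = 0 then f k else 0) ?_ 0
  · have h1 : (s.write 3 0 1) 0 0 = I.n := by rw [Mem.write_of_ne (by decide), hn]
    change (loop 10 _).sem (s.write 3 0 1) 3 0 = _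
    rw [key, h1]
    simp only [if_true]
    rw [← Fin.sum_univ_eq_sum_range f]
    simp [Mem.write, f]
  · intro k hk t h10 hfr j
    rw [Mem.write_of_ne (by decide), hn] at hk
    have t0 : t 0 = s 0 := by
      rw [hfr 0 (by decide), Mem.write_of_ne (by decide), Mem.write_of_ne (by decide)]
    have e1 := wtE_eval (t0.trans hs) (e := sc 10) (v := ⟨k, hk⟩) h10
    simp only [LP.sem, eval, e1, f, dif_pos hk]
    by_cases hj : j = 0
    · simp [hj, Mem.write, sc, eval]
    · simp [hj, Mem.write]

theorem initLP_sem (hs : s 0 = initMem I.encode 0) (h5 : ∀ j, s 5 j = 0) (v : Fin I.n) :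
    (initLP.sem s 5 v ≠ 0 ↔ I.weight v ≠ ⊤) ∧ (I.weight v ≠ ⊤ →
      initLP.sem s 4 v = (closedNbhd I.graph v).card * s 3 0 - (I.weight v).toNat) := by
  classical
  have hn : s 0 0 = I.n := by rw [hs, I.initMem_n]
  -- The product `|N[u]| * M` arises by repeated addition, as stored expressions must be linear.
  have hloop : ∀ (t : Mem) (u : Fin I.n), t 0 = s 0 → t 3 = s 3 → t 10 0 = u.val → ∀ j,
      weightLP.sem t 4 j =
      t 4 j + if j = u.val then (closedNbhd I.graph u).card * s 3 0 else 0 := by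
    intro t u t0 t3 t10 j
    let f : ℕ → ℕ := fun k => if h : k < I.n then
      (if u = ⟨k, h⟩ ∨ I.graph.Adj u ⟨k, h⟩ then s 3 0 else 0) else 0
    rw [weightLP, sem_loop_sum (by decide) t (fun k j => if j = u.val then f k else 0)]
    · congr 1
      rw [t0, hn]
      by_cases hj : j = u.val
      · simp only [hj, if_true]
        rw [← Fin.sum_univ_eq_sum_range f]
        simp only [f, Fin.is_lt, dif_pos, Fin.eta]
        rw [← Finset.sum_filter, Finset.sum_const, smul_eq_mul]
        congr
      · simp [hj]
    · intro k hk r h11 hfr j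
      rw [t0, hn] at hk
      have r0 : r 0 = s 0 := by rw [hfr 0 (by decide), Mem.write_of_ne (by decide), t0]
      have r3 : r 3 = s 3 := by rw [hfr 3 (by decide), Mem.write_of_ne (by decide), t3]
      have r10 : r 10 0 = u.val := by rw [hfr 10 (by decide), Mem.write_of_ne (by decide), t10]
      have e1 := nbE_eval_ne_zero (r0.trans hs) (e := sc 10) (f := sc 11) (u := u) (v := ⟨k, hk⟩)
        r10 h11
      simp only [f, dif_pos hk]
      by_cases hc : u = ⟨k, hk⟩ ∨ I.graph.Adj u ⟨k, hk⟩
      · rw [sem_ite_pos (e1.2 hc)]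
        by_cases hj : j = u.val
        · simp [hc, hj, Mem.write, sc, eval, r10, r3, LP.sem]
        · simp [hj, Mem.write, sc, eval, r10, LP.sem]
      · rw [sem_ite_neg (fun h => hc (e1.1 h))]
        simp [hc, LP.sem]
  have hex : ∀ (k : ℕ) (hk : k < I.n) (j : ℕ),
      (∃ u : Fin I.n, u.val = k ∧ j = k ∧ I.weight u ≠ ⊤) ↔ j = k ∧ I.weight ⟨k, hk⟩ ≠ ⊤ := by
    intro k hk j
    constructor
    · rintro ⟨u, rfl, h⟩
      exact h
    · exact fun h => ⟨_, rfl, h⟩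
  constructor
  · rw [initLP, sem_loop_assign (by decide) s (fun _ => 1)
      (fun k j => ∃ u : Fin I.n, u.val = k ∧ j = k ∧ I.weight u ≠ ⊤), h5, hn]
    · constructor
      · intro h
        split_ifs at h with h'
        · obtain ⟨k, hk, u, rfl, hj, hu⟩ := h'
          rwa [Fin.ext hj]
        · exact absurd rfl h
      · intro h
        rw [if_pos ⟨v, v.isLt, v, rfl, rfl, h⟩]
        decide
    · intro k hk t h10 hfr _ j
      rw [hn] at hk
      have t0 : t 0 = s 0 := by rw [hfr 0 (by decide), Mem.write_of_ne (by decide)]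
      have e1 := wtE_eval (t0.trans hs) (e := sc 10) (v := ⟨k, hk⟩) h10
      rw [hex k hk]
      by_cases hw : I.weight ⟨k, hk⟩ = ⊤
      · rw [sem_ite_neg (by simp [e1, hw])]
        simp [hw, LP.sem]
      · rw [sem_ite_pos (by simp [e1, hw]), LP.sem,
          LP.sem_of_not_mem_writes (seq _ _) (by decide)]
        simp [Mem.write, sc, eval, h10, LP.sem, hw]
  · intro hv
    let c : ℕ → ℕ := fun j => if h : j < I.n then
      (closedNbhd I.graph ⟨j, h⟩).card * s 3 0 - (I.weight ⟨j, h⟩).toNat else 0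
    rw [initLP, sem_loop_assign (by decide) s c
      (fun k j => ∃ u : Fin I.n, u.val = k ∧ j = k ∧ I.weight u ≠ ⊤), hn,
      if_pos ⟨v, v.isLt, v, rfl, rfl, hv⟩]
    · simp [c]
    · intro k hk t h10 hfr _ j
      rw [hn] at hk
      have t0 : t 0 = s 0 := by rw [hfr 0 (by decide), Mem.write_of_ne (by decide)]
      have t3 : t 3 = s 3 := by rw [hfr 3 (by decide), Mem.write_of_ne (by decide)]
      have e1 := wtE_eval (t0.trans hs) (e := sc 10) (v := ⟨k, hk⟩) h10
      rw [hex k hk]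
      by_cases hw : I.weight ⟨k, hk⟩ = ⊤
      · rw [sem_ite_neg (by simp [e1, hw])]
        simp [hw, LP.sem]
      · rw [sem_ite_pos (by simp [e1, hw])]
        simp only [LP.sem]
        have k1 : (sc 10).eval t = k := h10
        have k2 : (sc 10).eval (t.write 5 k 1) = k := h10
        simp only [k1, k2, eval]
        set t' := (t.write 5 k 1).write 4 k 1 with ht'
        have t'0 : t' 0 = s 0 := by
          rw [ht', Mem.write_of_ne (by decide), Mem.write_of_ne (by decide), t0]
        have t'3 : t' 3 = s 3 := by
          rw [ht', Mem.write_of_ne (by decide), Mem.write_of_ne (by decide), t3]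
        have t'10 : t' 10 0 = k := by
          rw [ht', Mem.write_of_ne (by decide), Mem.write_of_ne (by decide), h10]
        have hl := hloop t' ⟨k, hk⟩ t'0 t'3 t'10
        have r0 : weightLP.sem t' 0 = s 0 := by rw [LP.sem_of_not_mem_writes _ (by decide), t'0]
        have r10 : (sc 10).eval (weightLP.sem t') = k := by
          simp only [sc, eval]
          rw [LP.sem_of_not_mem_writes _ (by decide), t'10]
        have e2 := wtE_eval (r0.trans hs) (e := sc 10) (v := ⟨k, hk⟩) r10
        rw [e2, if_neg hw, r10]
        by_cases hj : j = k
        · subst hj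
          simp only [Mem.write, and_self, if_true, hw, not_false_iff, ne_eq, c, dif_pos hk, hl]
          simp only [ht', Mem.write, and_self, if_true]
          omega
        · simp only [Mem.write, hj, and_false, if_false, false_and, hl, add_zero]
          simp only [ht', Mem.write, hj, and_false, if_false]

end Frank

end WED

/-! ### Correctness of both phases of Frank's algorithm and of the final check -/

namespace WED

namespace Frank

open WED.Expr WED.LP

variable {I : Instance} {s : Mem}

/-- The memory holds the input in bank `0` and the adjacency matrix of the square in bank `2`. -/
structure Ready (I : Instance) (s : Mem) : Prop where
  input : s 0 = initMem I.encode 0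
  close : ∀ u v : Fin I.n, s 2 (u.val * I.n + v.val) ≠ 0 ↔ Close I.graph u v

theorem Ready.n (h : Ready I s) : s 0 0 = I.n := by rw [h.input, I.initMem_n]

theorem Ready.congr {t : Mem} (h : Ready I s) (h0 : t 0 = s 0) (h2 : t 2 = s 2) : Ready I t :=
  ⟨h0.trans h.input, fun u v => by rw [h2]; exact h.close u v⟩

theorem Ready.sem {p : LP} (h : Ready I s) (h0 : 0 ∉ p.writes) (h2 : 2 ∉ p.writes) :
    Ready I (p.sem s) :=
  h.congr (p.sem_of_not_mem_writes h0 s) (p.sem_of_not_mem_writes h2 s)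

theorem Ready.write {a i x : ℕ} (h : Ready I s) (h0 : 0 ≠ a) (h2 : 2 ≠ a) :
    Ready I (s.write a i x) :=
  h.congr (Mem.write_of_ne h0) (Mem.write_of_ne h2)

theorem Ready.of_frame {t : Mem} {W : List ℕ} {i k : ℕ} (h : Ready I s) (h0 : 0 ∉ W)
    (h2 : 2 ∉ W) (hi0 : 0 ≠ i) (hi2 : 2 ≠ i) (hfr : ∀ b ∉ W, t b = s.write i 0 k b) :
    Ready I t :=
  h.congr (by rw [hfr 0 h0, Mem.write_of_ne hi0]) (by rw [hfr 2 h2, Mem.write_of_ne hi2])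

theorem clE_eval_ne_zero (hs : Ready I s) {e f : Expr} {u v : Fin I.n} (he : e.eval s = u.val)
    (hf : f.eval s = v.val) : (clE e f).eval s ≠ 0 ↔ Close I.graph u v := by
  simp only [clE, nE, sc, eval, he, hf, hs.n]
  exact hs.close u v

/-- The vertices that have not been eliminated. -/
def alive (I : Instance) (s : Mem) : Finset (Fin I.n) :=
  Finset.univ.filter fun v => s 5 v.val ≠ 0

theorem mem_alive {v : Fin I.n} : v ∈ alive I s ↔ s 5 v.val ≠ 0 := by simp [alive]

theorem alive_congr {t : Mem} (h : t 5 = s 5) : alive I t = alive I s := by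
  simp [alive, h]

/-- The vertices that have been selected. -/
def selected (I : Instance) (s : Mem) : Finset (Fin I.n) :=
  Finset.univ.filter fun v => s 1 (v.val + 1) ≠ 0

theorem mem_selected {v : Fin I.n} : v ∈ selected I s ↔ s 1 (v.val + 1) ≠ 0 := by
  simp [selected]

theorem exists_fin_iff {n k : ℕ} (hk : k < n) {P : Fin n → Prop} :
    (∃ u : Fin n, u.val = k ∧ P u) ↔ P ⟨k, hk⟩ := by
  constructor
  · rintro ⟨u, rfl, h⟩
    exact h
  · exact fun h => ⟨_, rfl, h⟩

open Classical in
theorem badLP_sem (hs : Ready I s) {v : Fin I.n} (hv : s 11 0 = v.val) (h8 : s 8 0 = 0) :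
    badLP.sem s 8 0 = 0 ↔ ∀ a ∈ alive I s, ∀ b ∈ alive I s, Close I.graph v a →
      Close I.graph v b → Close I.graph a b := by
  let Q : Fin I.n → Fin I.n → Prop := fun a b => ((a ∈ alive I s ∧ b ∈ alive I s) ∧
    Close I.graph v a ∧ Close I.graph v b) ∧ ¬ Close I.graph a b
  have inner : ∀ (t : Mem) (a : Fin I.n), Ready I t → t 11 = s 11 → t 5 = s 5 → t 13 0 = a.val →
      ∀ j, (loop 14 (ite (mul (mul (mul (cell 5 (sc 13)) (cell 5 (sc 14)))
        (mul (clE (sc 11) (sc 13)) (clE (sc 11) (sc 14))))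
        (sub (lit 1) (clE (sc 13) (sc 14)))) (store 8 (lit 0) (lit 1)) skip)).sem t 8 j =
      if (∃ b, Q a b) ∧ j = 0 then 1 else t 8 j := by
    intro t a ht t11 t5 t13 j
    rw [sem_loop_assign (by decide) t (fun _ => 1)
      (fun k j => (∃ b : Fin I.n, b.val = k ∧ Q a b) ∧ j = 0)]
    · congr 1
      rw [ht.n]
      refine propext ⟨?_, ?_⟩
      · rintro ⟨k, -, ⟨b, -, h⟩, hj⟩
        exact ⟨⟨b, h⟩, hj⟩
      · rintro ⟨⟨b, h⟩, hj⟩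
        exact ⟨b, b.isLt, ⟨b, rfl, h⟩, hj⟩
    · intro k hk r h14 hfr _ j
      rw [ht.n] at hk
      have hr : Ready I r := ht.of_frame (by decide) (by decide) (by decide) (by decide) hfr
      have r5 : r 5 = s 5 := by rw [hfr 5 (by decide), Mem.write_of_ne (by decide), t5]
      have r11 : r 11 0 = v.val := by rw [hfr 11 (by decide), Mem.write_of_ne (by decide), t11, hv]
      have r13 : r 13 0 = a.val := by rw [hfr 13 (by decide), Mem.write_of_ne (by decide), t13]
      have e1 := clE_eval_ne_zero hr (e := sc 11) (f := sc 13) r11 r13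
      have e2 := clE_eval_ne_zero hr (e := sc 11) (f := sc 14) (v := ⟨k, hk⟩) r11 h14
      have e3 := clE_eval_ne_zero hr (e := sc 13) (f := sc 14) (v := ⟨k, hk⟩) r13 h14
      have e4 : (sub (lit 1) (clE (sc 13) (sc 14))).eval r ≠ 0 ↔
          ¬ Close I.graph a ⟨k, hk⟩ := by
        rw [← e3]
        simp only [eval]
        omega
      have e5 : (cell 5 (sc 13)).eval r ≠ 0 ↔ a ∈ alive I s := by
        simp only [sc, eval, r13, r5, mem_alive]
      have e6 : (cell 5 (sc 14)).eval r ≠ 0 ↔ ⟨k, hk⟩ ∈ alive I s := by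
        simp only [sc, eval, h14, r5, mem_alive]
      have hc : (mul (mul (mul (cell 5 (sc 13)) (cell 5 (sc 14)))
          (mul (clE (sc 11) (sc 13)) (clE (sc 11) (sc 14))))
          (sub (lit 1) (clE (sc 13) (sc 14)))).eval r ≠ 0 ↔ Q a ⟨k, hk⟩ := by
        have : ∀ e f : Expr, (mul e f).eval r ≠ 0 ↔ e.eval r ≠ 0 ∧ f.eval r ≠ 0 :=
          fun e f => mul_ne_zero_iff
        rw [this, this, this, this, e1, e2, e4, e5, e6]
      rw [exists_fin_iff hk]
      by_cases h : Q a ⟨k, hk⟩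
      · rw [sem_ite_pos (hc.2 h)]
        simp [h, LP.sem, Mem.write, eval]
      · rw [sem_ite_neg fun h' => h (hc.1 h'), if_neg fun h' => h h'.1]
        rfl
  have outer : badLP.sem s 8 0 = if ∃ a b, Q a b then 1 else s 8 0 := by
    rw [badLP, sem_loop_assign (by decide) s (fun _ => 1)
      (fun k j => (∃ a : Fin I.n, a.val = k ∧ ∃ b, Q a b) ∧ j = 0)]
    · congr 1
      rw [hs.n]
      refine propext ⟨?_, ?_⟩
      · rintro ⟨k, -, ⟨a, -, h⟩, -⟩
        exact ⟨a, h⟩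
      · rintro ⟨a, h⟩
        exact ⟨a, a.isLt, ⟨a, rfl, h⟩, rfl⟩
    · intro k hk t h13 hfr _ j
      rw [hs.n] at hk
      simp only [exists_fin_iff hk]
      rw [inner t ⟨k, hk⟩
        (hs.of_frame (by decide) (by decide) (by decide) (by decide) hfr)
        (by rw [hfr 11 (by decide), Mem.write_of_ne (by decide)])
        (by rw [hfr 5 (by decide), Mem.write_of_ne (by decide)]) h13]
  rw [outer, h8]
  constructor
  · intro h a ha b hb hva hvb
    by_contra hab
    rw [if_pos ⟨a, b, ⟨⟨ha, hb⟩, hva, hvb⟩, hab⟩] at h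
    exact absurd h (by decide)
  · intro h
    rw [if_neg]
    rintro ⟨a, b, ⟨⟨ha, hb⟩, hva, hvb⟩, hab⟩
    exact hab (h a ha b hb hva hvb)

/-- Bank `7` stores the vertex plus one, so that zero means that none was found. Later finds
overwrite earlier ones. -/
theorem pickLP_sem (hs : Ready I s) (h7 : s 7 0 = 0) :
    (pickLP.sem s 7 0 = 0 ∧ ∀ v, ¬ SimplicialIn I.graph (alive I s) v) ∨
      ∃ v : Fin I.n, pickLP.sem s 7 0 = v.val + 1 ∧ SimplicialIn I.graph (alive I s) v := by
  have key := loop_induction (i := 11) (p := ite (cell 5 (sc 11))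
    (seq (store 8 (lit 0) (lit 0)) (seq badLP
      (ite (sub (lit 1) (sc 8)) (store 7 (lit 0) (add (sc 11) (lit 1))) skip))) skip) s
    (fun k t => (t 7 0 = 0 ∧ ∀ v : Fin I.n, v.val < k → ¬ SimplicialIn I.graph (alive I s) v) ∨
      ∃ v : Fin I.n, t 7 0 = v.val + 1 ∧ SimplicialIn I.graph (alive I s) v) ?_ ?_
  · rw [hs.n] at key
    rcases key with ⟨h1, h2⟩ | h
    · exact Or.inl ⟨h1, fun v => h2 v v.isLt⟩
    · exact Or.inr h
  · exact Or.inl ⟨by rw [Mem.write_of_ne (by decide), h7], fun v hv => absurd hv (by omega)⟩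
  · intro k hk t h11 hfr hI
    rw [hs.n] at hk
    have ht : Ready I t := hs.of_frame (by decide) (by decide) (by decide) (by decide) hfr
    have t5 : t 5 = s 5 := by rw [hfr 5 (by decide), Mem.write_of_ne (by decide)]
    rw [Mem.write_of_ne (by decide)]
    have hnot : ¬ SimplicialIn I.graph (alive I s) ⟨k, hk⟩ →
        (t 7 0 = 0 ∧ ∀ v : Fin I.n, v.val < k + 1 → ¬ SimplicialIn I.graph (alive I s) v) ∨
        ∃ v : Fin I.n, t 7 0 = v.val + 1 ∧ SimplicialIn I.graph (alive I s) v := by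
      intro hno
      rcases hI with ⟨h1, h2⟩ | h
      · refine Or.inl ⟨h1, fun v hv => ?_⟩
        by_cases hvk : v.val = k
        · have : v = ⟨k, hk⟩ := Fin.ext hvk
          rwa [this]
        · exact h2 v (by omega)
      · exact Or.inr h
    have e5 : (cell 5 (sc 11)).eval t ≠ 0 ↔ ⟨k, hk⟩ ∈ alive I s := by
      simp only [sc, eval, h11, t5, mem_alive]
    by_cases ha : (⟨k, hk⟩ : Fin I.n) ∈ alive I s
    · rw [sem_ite_pos (e5.2 ha)]
      set t' := t.write 8 0 0 with ht'
      have t'R : Ready I t' := ht.write (by decide) (by decide)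
      have t'5 : alive I t' = alive I s := alive_congr (by rw [ht', Mem.write_of_ne (by decide), t5])
      have t'11 : t' 11 0 = k := by rw [ht', Mem.write_of_ne (by decide), h11]
      have hbad := badLP_sem t'R (v := ⟨k, hk⟩) t'11 (by simp [ht', Mem.write])
      rw [t'5] at hbad
      have b11 : badLP.sem t' 11 0 = k := by
        rw [LP.sem_of_not_mem_writes _ (by decide), t'11]
      have b7 : badLP.sem t' 7 = t 7 := by
        rw [LP.sem_of_not_mem_writes _ (by decide), ht', Mem.write_of_ne (by decide)]
      have hseq : (seq (store 8 (lit 0) (lit 0)) (seq badLP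
          (ite (sub (lit 1) (sc 8)) (store 7 (lit 0) (add (sc 11) (lit 1))) skip))).sem t =
          (ite (sub (lit 1) (sc 8)) (store 7 (lit 0) (add (sc 11) (lit 1))) skip).sem
            (badLP.sem t') := rfl
      rw [hseq]
      by_cases hb : badLP.sem t' 8 0 = 0
      · rw [sem_ite_pos (by simp [sc, eval, hb])]
        exact Or.inr ⟨⟨k, hk⟩, by simp [LP.sem, Mem.write, sc, eval, b11], ha, hbad.1 hb⟩
      · rw [sem_ite_neg (by simp only [sc, eval]; omega), LP.sem, b7]
        exact hnot fun h => hb (hbad.2 h.2)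
    · rw [sem_ite_neg fun h => ha (e5.1 h)]
      exact hnot fun h => ha h.1

open Classical in
theorem updateLP_sem (hs : Ready I s) {v : Fin I.n} (hv : s 7 0 = v.val + 1) (u : Fin I.n) :
    updateLP.sem s 4 u.val =
      if u ∈ alive I s ∧ Close I.graph v u then s 4 u.val - s 9 0 else s 4 u.val := by
  rw [updateLP, sem_loop_assign (by decide) s (fun j => s 4 j - s 9 0)
    (fun k j => (∃ u : Fin I.n, u.val = k ∧ u ∈ alive I s ∧ Close I.graph v u) ∧ j = k)]
  · congr 1
    rw [hs.n]
    refine propext ⟨?_, ?_⟩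
    · rintro ⟨k, hk, ⟨w, rfl, h⟩, hj⟩
      rwa [Fin.ext hj]
    · exact fun h => ⟨u, u.isLt, ⟨u, rfl, h⟩, rfl⟩
  · intro k hk t h13 hfr ht4 j
    rw [hs.n] at hk
    have ht : Ready I t := hs.of_frame (by decide) (by decide) (by decide) (by decide) hfr
    have t5 : t 5 = s 5 := by rw [hfr 5 (by decide), Mem.write_of_ne (by decide)]
    have t9 : t 9 = s 9 := by rw [hfr 9 (by decide), Mem.write_of_ne (by decide)]
    have t7 : (sub (sc 7) (lit 1)).eval t = v.val := by
      simp only [sc, eval]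
      rw [hfr 7 (by decide), Mem.write_of_ne (by decide), hv, Nat.add_sub_cancel]
    -- Earlier rounds changed only cells below `k`, so the subtraction acts on the original value.
    have t4 : t 4 k = s 4 k := by
      rw [ht4, if_neg]
      rintro ⟨k', hk', -, h⟩
      omega
    have e1 := clE_eval_ne_zero ht (e := sub (sc 7) (lit 1)) (f := sc 13) (v := ⟨k, hk⟩) t7 h13
    have hc : (mul (cell 5 (sc 13)) (clE (sub (sc 7) (lit 1)) (sc 13))).eval t ≠ 0 ↔
        ⟨k, hk⟩ ∈ alive I s ∧ Close I.graph v ⟨k, hk⟩ := by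
      rw [← e1, mem_alive, ← t5]
      simp only [eval, mul_ne_zero_iff, sc, h13]
    rw [exists_fin_iff hk]
    by_cases h : ⟨k, hk⟩ ∈ alive I s ∧ Close I.graph v ⟨k, hk⟩
    · rw [sem_ite_pos (hc.2 h)]
      by_cases hj : j = k
      · simp [h, hj, LP.sem, Mem.write, sc, eval, h13, t4, t9]
      · simp [hj, LP.sem, Mem.write, sc, eval, h13]
    · rw [sem_ite_neg fun h' => h (hc.1 h'), if_neg fun h' => h h'.1]
      rfl

open Classical in
theorem eliminateLP_sem (hs : Ready I s) {v : Fin I.n} (hv : s 7 0 = v.val + 1) :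
    alive I (eliminateLP.sem s) = (alive I s).erase v ∧
      (∀ j, eliminateLP.sem s 6 j =
        if j = s 15 0 ∧ s 4 v.val ≠ 0 then v.val + 1 else s 6 j) ∧
      ∀ u ∈ (alive I s).erase v, eliminateLP.sem s 4 u.val =
        if Close I.graph v u then s 4 u.val - s 4 v.val else s 4 u.val := by
  have h7 : (sc 7).eval s ≠ 0 := by simp [sc, eval, hv]
  rw [eliminateLP, sem_ite_pos h7]
  set t₁ := s.write 9 0 (s 4 v.val) with ht₁
  set t₂ := (ite (sc 9) (store 6 (sc 15) (sc 7)) skip).sem t₁ with ht₂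
  set t₃ := t₂.write 5 v.val 0 with ht₃
  have a7 : t₁ 7 0 = v.val + 1 := by rw [ht₁, Mem.write_of_ne (by decide), hv]
  have b7 : t₂ 7 0 = v.val + 1 := by rw [ht₂, LP.sem_of_not_mem_writes _ (by decide), a7]
  have hsem : (seq (store 9 (lit 0) (cell 4 (sub (sc 7) (lit 1))))
      (seq (ite (sc 9) (store 6 (sc 15) (sc 7)) skip)
        (seq (store 5 (sub (sc 7) (lit 1)) (lit 0)) updateLP))).sem s = updateLP.sem t₃ := by
    have e1 : (store 9 (lit 0) (cell 4 (sub (sc 7) (lit 1)))).sem s = t₁ := by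
      simp [LP.sem, sc, eval, hv, ht₁]
    have e2 : (store 5 (sub (sc 7) (lit 1)) (lit 0)).sem t₂ = t₃ := by
      simp [LP.sem, sc, eval, b7, ht₃]
    rw [← e2, ht₂, ← e1]
    rfl
  rw [hsem]
  have hR1 : Ready I t₁ := hs.write (by decide) (by decide)
  have hR2 : Ready I t₂ := hR1.sem (by decide) (by decide)
  have hR3 : Ready I t₃ := hR2.write (by decide) (by decide)
  have c7 : t₃ 7 0 = v.val + 1 := by rw [ht₃, Mem.write_of_ne (by decide), b7]
  have c4 : t₃ 4 = s 4 := by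
    rw [ht₃, Mem.write_of_ne (by decide), ht₂, LP.sem_of_not_mem_writes _ (by decide), ht₁,
      Mem.write_of_ne (by decide)]
  have c9 : t₃ 9 0 = s 4 v.val := by
    rw [ht₃, Mem.write_of_ne (by decide), ht₂, LP.sem_of_not_mem_writes _ (by decide), ht₁]
    simp [Mem.write]
  have b5 : t₂ 5 = s 5 := by
    rw [ht₂, LP.sem_of_not_mem_writes _ (by decide), ht₁, Mem.write_of_ne (by decide)]
  have c5 : alive I t₃ = (alive I s).erase v := by
    ext u
    simp only [Finset.mem_erase, mem_alive, ht₃, Mem.write, true_and, b5]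
    by_cases huv : u = v
    · simp [huv]
    · have : u.val ≠ v.val := fun h => huv (Fin.ext h)
      simp [huv, this]
  refine ⟨?_, ?_, ?_⟩
  · rw [← c5]
    exact alive_congr (LP.sem_of_not_mem_writes _ (by decide) _)
  · intro j
    rw [LP.sem_of_not_mem_writes _ (by decide), ht₃, Mem.write_of_ne (by decide), ht₂]
    have e9 : (sc 9).eval t₁ = s 4 v.val := by simp [sc, eval, ht₁, Mem.write]
    have e6 : t₁ 6 = s 6 := by rw [ht₁, Mem.write_of_ne (by decide)]
    have e15 : t₁ 15 = s 15 := by rw [ht₁, Mem.write_of_ne (by decide)]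
    by_cases h0 : s 4 v.val = 0
    · rw [sem_ite_neg (by simp [e9, h0])]
      simp [LP.sem, h0, e6]
    · rw [sem_ite_pos (by rw [e9]; exact h0)]
      simp [LP.sem, sc, eval, a7, e15, h0, Mem.write, e6]
  · intro u hu
    rw [updateLP_sem hR3 c7 u, c4, c9, c5]
    simp only [hu, true_and]

/-- The vertex that is encoded by a stack entry. -/
def decode (n x : ℕ) : Option (Fin n) :=
  if h : 0 < x ∧ x - 1 < n then some ⟨x - 1, h.2⟩ else none

theorem decode_zero (n : ℕ) : decode n 0 = none := by simp [decode]

theorem decode_succ {n : ℕ} (v : Fin n) : decode n (v.val + 1) = some v := by simp [decode]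

/-- The invariant `FrankState` holds for every graph. Chordality of the square is needed only to
eliminate a vertex in each round until none remains. -/
theorem forwardLP_sem (hs : Ready I s) (h6 : ∀ j, s 6 j = 0) :
    ∃ C y, FrankState I.graph (fun v : Fin I.n => s 4 v.val) (alive I s) I.n
        (alive I (forwardLP.sem s)) (fun v => forwardLP.sem s 4 v.val)
        (fun j => decode I.n (forwardLP.sem s 6 j)) C y ∧
      (∀ j, forwardLP.sem s 6 j ≤ I.n) ∧
      (SquareChordal I.graph → alive I (forwardLP.sem s) = ∅) := by
  have key := loop_induction (i := 15)
    (p := seq (store 7 (lit 0) (lit 0)) (seq pickLP eliminateLP)) s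
    (fun k t => ∃ C y, FrankState I.graph (fun v : Fin I.n => s 4 v.val) (alive I s) k
        (alive I t) (fun v => t 4 v.val) (fun j => decode I.n (t 6 j)) C y ∧
      (∀ j, t 6 j ≤ I.n) ∧ (∀ j, k ≤ j → t 6 j = 0) ∧
      (SquareChordal I.graph → (alive I t).card ≤ I.n - k)) ?_ ?_
  · rw [hs.n] at key
    obtain ⟨C, y, h1, h2, -, h4⟩ := key
    exact ⟨C, y, h1, h2, fun h => Finset.card_eq_zero.1
      (Nat.le_zero.1 ((h4 h).trans_eq (Nat.sub_self _)))⟩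
  · refine ⟨fun _ => ∅, fun _ => 0, ?_, ?_, ?_, ?_⟩
    · rw [alive_congr (s := s) (Mem.write_of_ne (by decide)), Mem.write_of_ne (by decide)]
      exact FrankState.init _ _ _ _
    · intro j
      rw [Mem.write_of_ne (by decide), h6]
      exact Nat.zero_le _
    · intro j _
      rw [Mem.write_of_ne (by decide), h6]
    · intro _
      simpa using Finset.card_le_univ (alive I (s.write 15 0 0))
  · rintro k hk t h15 hfr ⟨C, y, hF, hle, hzero, hcard⟩
    have ht : Ready I t := hs.of_frame (by decide) (by decide) (by decide) (by decide) hfr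
    set t₁ := t.write 7 0 0 with ht₁
    set t₂ := pickLP.sem t₁ with ht₂
    have hsem : (seq (store 7 (lit 0) (lit 0)) (seq pickLP eliminateLP)).sem t =
        eliminateLP.sem t₂ := rfl
    rw [hsem]
    have hR1 : Ready I t₁ := ht.write (by decide) (by decide)
    have hR2 : Ready I t₂ := hR1.sem (by decide) (by decide)
    have a1 : alive I t₁ = alive I t := alive_congr (Mem.write_of_ne (by decide))
    have hb : ∀ b, b ≠ 7 → b ∉ pickLP.writes → t₂ b = t b := by
      intro b hb hb'
      rw [ht₂, LP.sem_of_not_mem_writes _ hb', ht₁, Mem.write_of_ne hb]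
    have b5 : alive I t₂ = alive I t := alive_congr (hb 5 (by decide) (by decide))
    have b4 := hb 4 (by decide) (by decide)
    have b6 := hb 6 (by decide) (by decide)
    have b15 : t₂ 15 0 = k := by rw [hb 15 (by decide) (by decide), h15]
    have hw : ∀ r : Mem, alive I (r.write 15 0 (k + 1)) = alive I r := fun r =>
      alive_congr (Mem.write_of_ne (by decide))
    simp only [hw, Mem.write_of_ne (show 4 ≠ 15 by decide), Mem.write_of_ne (show 6 ≠ 15 by decide)]
    rcases pickLP_sem hR1 (by simp [ht₁, Mem.write]) with ⟨h7, hno⟩ | ⟨v, h7, hv⟩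
    · have hel : eliminateLP.sem t₂ = t₂ := by
        rw [eliminateLP, sem_ite_neg (by simpa [sc, eval] using h7)]
        rfl
      rw [hel, b5, b4, b6]
      obtain ⟨C', y', hF'⟩ := hF.skip (by simp [hzero k le_rfl, decode_zero])
      refine ⟨C', y', hF', hle, fun j hj => hzero j (by omega), fun hsq => ?_⟩
      have : alive I t = ∅ := by
        by_contra hne
        obtain ⟨v, hv⟩ := hsq _ (Finset.nonempty_iff_ne_empty.2 hne)
        exact hno v (a1 ▸ hv)
      simp [this]
    · rw [a1] at hv
      obtain ⟨h1, h2, h3⟩ := eliminateLP_sem hR2 h7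
      rw [b5] at h1 h3
      rw [b4] at h3
      rw [b15, b4, b6] at h2
      rw [h1]
      have hst : ∀ j < k, decode I.n (eliminateLP.sem t₂ 6 j) = decode I.n (t 6 j) := by
        intro j hj
        rw [h2, if_neg fun h => by omega]
      obtain ⟨C', y', hF'⟩ := (hF.congr_stack hst).step hv
        (R' := fun v => eliminateLP.sem t₂ 4 v.val) (by
          rw [h2]
          by_cases h0 : t 4 v.val = 0
          · simp [h0, hzero k le_rfl, decode_zero]
          · simp [h0, decode_succ]) h3
      refine ⟨C', y', hF', fun j => ?_, fun j hj => ?_, fun hsq => ?_⟩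
      · rw [h2]
        split_ifs
        · omega
        · exact hle j
      · rw [h2, if_neg fun h => by omega]
        exact hzero j (by omega)
      · rw [Finset.card_erase_of_mem hv.1]
        have := hcard hsq
        omega

theorem conflictLP_sem (hs : Ready I s) {v : Fin I.n} (hv : s 7 0 = v.val + 1)
    (h8 : s 8 0 = 0) :
    conflictLP.sem s 8 0 = 0 ↔ ∀ u ∈ selected I s, ¬ Close I.graph v u := by
  classical
  have key : conflictLP.sem s 8 0 =
      if ∃ u : Fin I.n, u ∈ selected I s ∧ Close I.graph v u then 1 else s 8 0 := by
    rw [conflictLP, sem_loop_assign (by decide) s (fun _ => 1)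
      (fun k j => (∃ u : Fin I.n, u.val = k ∧ u ∈ selected I s ∧ Close I.graph v u) ∧ j = 0)]
    · congr 1
      rw [hs.n]
      refine propext ⟨?_, ?_⟩
      · rintro ⟨k, -, ⟨u, -, h⟩, -⟩
        exact ⟨u, h⟩
      · rintro ⟨u, h⟩
        exact ⟨u, u.isLt, ⟨u, rfl, h⟩, rfl⟩
    · intro k hk t h13 hfr _ j
      rw [hs.n] at hk
      have ht : Ready I t := hs.of_frame (by decide) (by decide) (by decide) (by decide) hfr
      have t1 : t 1 = s 1 := by rw [hfr 1 (by decide), Mem.write_of_ne (by decide)]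
      have t7 : (sub (sc 7) (lit 1)).eval t = v.val := by
        simp only [sc, eval]
        rw [hfr 7 (by decide), Mem.write_of_ne (by decide), hv, Nat.add_sub_cancel]
      have e1 := clE_eval_ne_zero ht (e := sub (sc 7) (lit 1)) (f := sc 13) (v := ⟨k, hk⟩) t7 h13
      have hc : (mul (cell 1 (add (sc 13) (lit 1))) (clE (sub (sc 7) (lit 1)) (sc 13))).eval t ≠ 0 ↔
          ⟨k, hk⟩ ∈ selected I s ∧ Close I.graph v ⟨k, hk⟩ := by
        rw [← e1, mem_selected, ← t1]
        simp only [eval, mul_ne_zero_iff, sc, h13]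
      rw [exists_fin_iff hk]
      by_cases h : ⟨k, hk⟩ ∈ selected I s ∧ Close I.graph v ⟨k, hk⟩
      · rw [sem_ite_pos (hc.2 h)]
        simp [h, LP.sem, Mem.write, eval]
      · rw [sem_ite_neg fun h' => h (hc.1 h'), if_neg fun h' => h h'.1]
        rfl
  rw [key, h8]
  simp

/-- Round `k` treats the stack entry `n - k - 1`, so selection goes from the top of the stack
downwards. -/
theorem backwardLP_sem (hs : Ready I s) (h6 : ∀ j, s 6 j ≤ I.n) (h1 : ∀ j, s 1 j = 0)
    {W : Fin I.n → ℕ} {S A : Finset (Fin I.n)} {R : Fin I.n → ℕ} {C : ℕ → Finset (Fin I.n)}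
    {y : ℕ → ℕ}
    (hF : FrankState I.graph W S I.n A R (fun j => decode I.n (s 6 j)) C y) :
    FrankSelection I.graph I.n 0 (fun j => decode I.n (s 6 j)) C
      (selected I (backwardLP.sem s)) := by
  have key := loop_induction (i := 15) (p := seq
    (store 7 (lit 0) (cell 6 (sub (sub nE (sc 15)) (lit 1))))
    (ite (sc 7)
      (seq (store 8 (lit 0) (lit 0)) (seq conflictLP
        (ite (sub (lit 1) (sc 8)) (store 1 (sc 7) (lit 1)) skip)))
      skip)) s
    (fun k t => FrankSelection I.graph I.n (I.n - k) (fun j => decode I.n (s 6 j)) C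
      (selected I t)) ?_ ?_
  · rw [hs.n, Nat.sub_self] at key
    exact key
  · have : selected I (s.write 15 0 0) = ∅ := by
      ext v
      simp [mem_selected, Mem.write, h1]
    rw [this]
    exact FrankSelection.init _ _ _ _
  · intro k hk t h15 hfr hJ
    rw [hs.n] at hk
    have ht : Ready I t := hs.of_frame (by decide) (by decide) (by decide) (by decide) hfr
    have t6 : t 6 = s 6 := by rw [hfr 6 (by decide), Mem.write_of_ne (by decide)]
    obtain ⟨m, hm⟩ : ∃ m, I.n - k = m + 1 := ⟨I.n - k - 1, by omega⟩
    have hm' : I.n - (k + 1) = m := by omega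
    have hmn : m < I.n := by omega
    rw [hm] at hJ
    rw [hm']
    set t₁ := t.write 7 0 (s 6 m) with ht₁
    have hstore : (store 7 (lit 0) (cell 6 (sub (sub nE (sc 15)) (lit 1)))).sem t = t₁ := by
      simp only [LP.sem, eval, sc, nE, ht.n, h15, t6, hm, Nat.add_sub_cancel, ht₁]
    have hR1 : Ready I t₁ := ht.write (by decide) (by decide)
    have hsel : ∀ r r' : Mem, r 1 = r' 1 → selected I r = selected I r' := by
      intro r r' h
      simp [selected, h]
    have s1 : selected I t₁ = selected I t := hsel _ _ (Mem.write_of_ne (by decide))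
    rw [LP.sem, hstore, hsel _ _ (Mem.write_of_ne (by decide))]
    have a7 : (sc 7).eval t₁ = s 6 m := by simp [sc, eval, ht₁, Mem.write]
    by_cases h0 : s 6 m = 0
    · rw [sem_ite_neg (by rw [a7]; simpa using h0)]
      rw [LP.sem, s1]
      exact hJ.skip (by simp [h0, decode_zero])
    · obtain ⟨v, hv⟩ : ∃ v : Fin I.n, s 6 m = v.val + 1 :=
        ⟨⟨s 6 m - 1, by have := h6 m; omega⟩, by simp only; omega⟩
      have hdec : decode I.n (s 6 m) = some v := by rw [hv, decode_succ]
      rw [sem_ite_pos (by rw [a7]; exact h0)]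
      set t₂ := t₁.write 8 0 0 with ht₂
      have hR2 : Ready I t₂ := hR1.write (by decide) (by decide)
      have b7 : t₂ 7 0 = v.val + 1 := by
        rw [ht₂, Mem.write_of_ne (by decide), ← hv]
        exact a7
      have s2 : selected I t₂ = selected I t := by
        rw [← s1]
        exact hsel _ _ (Mem.write_of_ne (by decide))
      have hconf := conflictLP_sem hR2 b7 (by simp [ht₂, Mem.write])
      rw [s2] at hconf
      have c7 : conflictLP.sem t₂ 7 0 = v.val + 1 := by
        rw [LP.sem_of_not_mem_writes _ (by decide), b7]
      have c1 : conflictLP.sem t₂ 1 = t 1 := by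
        rw [LP.sem_of_not_mem_writes _ (by decide), ht₂, Mem.write_of_ne (by decide), ht₁,
          Mem.write_of_ne (by decide)]
      have hseq : (seq (store 8 (lit 0) (lit 0)) (seq conflictLP
          (ite (sub (lit 1) (sc 8)) (store 1 (sc 7) (lit 1)) skip))).sem t₁ =
          (ite (sub (lit 1) (sc 8)) (store 1 (sc 7) (lit 1)) skip).sem (conflictLP.sem t₂) := rfl
      rw [hseq]
      obtain ⟨-, -, hvC, -⟩ := hF.mem m hmn v hdec
      by_cases h8 : conflictLP.sem t₂ 8 0 = 0
      · rw [sem_ite_pos (by simp [sc, eval, h8])]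
        have : selected I ((store 1 (sc 7) (lit 1)).sem (conflictLP.sem t₂)) =
            insert v (selected I t) := by
          ext u
          simp only [mem_selected, Finset.mem_insert, LP.sem, sc, eval, c7, Mem.write, true_and, c1]
          by_cases huv : u = v
          · simp [huv]
          · have : u.val ≠ v.val := fun h => huv (Fin.ext h)
            simp [huv, this]
        rw [this]
        exact hJ.insert hmn hdec hvC (hconf.1 h8)
      · rw [sem_ite_neg (by simp only [sc, eval]; omega), LP.sem, hsel _ _ c1]
        -- The conflicting vertex `u` sits higher on the stack, so it was still present when `v` was
        -- eliminated and belongs to the clique of `v`.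
        refine hJ.skip fun w hw => ?_
        obtain rfl : v = w := Option.some.inj (hdec.symm.trans hw)
        have hnot := mt hconf.2 h8
        push Not at hnot
        obtain ⟨u, hu, hvu⟩ := hnot
        obtain ⟨i, hi, hmi, hiu⟩ := hJ.mem_stack u hu
        exact ⟨u, hu, hF.mem_of_stack i hi m (by omega) u v hdec hiu hvu⟩

theorem dominatedLP_sem (hs : s 0 = initMem I.encode 0) {v : Fin I.n} (hv : s 10 0 = v.val)
    (h8 : s 8 0 = 0) :
    dominatedLP.sem s 8 0 ≠ 0 ↔ ∃ u ∈ selected I s, u = v ∨ I.graph.Adj u v := by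
  classical
  have hn : s 0 0 = I.n := by rw [hs, I.initMem_n]
  have key : dominatedLP.sem s 8 0 =
      if ∃ u : Fin I.n, u ∈ selected I s ∧ (u = v ∨ I.graph.Adj u v) then 1 else s 8 0 := by
    rw [dominatedLP, sem_loop_assign (by decide) s (fun _ => 1)
      (fun k j => (∃ u : Fin I.n, u.val = k ∧ u ∈ selected I s ∧ (u = v ∨ I.graph.Adj u v)) ∧
        j = 0)]
    · congr 1
      rw [hn]
      refine propext ⟨?_, ?_⟩
      · rintro ⟨k, -, ⟨u, -, h⟩, -⟩
        exact ⟨u, h⟩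
      · rintro ⟨u, h⟩
        exact ⟨u, u.isLt, ⟨u, rfl, h⟩, rfl⟩
    · intro k hk t h13 hfr _ j
      rw [hn] at hk
      have t0 : t 0 = s 0 := by rw [hfr 0 (by decide), Mem.write_of_ne (by decide)]
      have t1 : t 1 = s 1 := by rw [hfr 1 (by decide), Mem.write_of_ne (by decide)]
      have t10 : t 10 0 = v.val := by rw [hfr 10 (by decide), Mem.write_of_ne (by decide), hv]
      have e1 := nbE_eval_ne_zero (t0.trans hs) (e := sc 13) (f := sc 10) (u := ⟨k, hk⟩) h13 t10
      have hc : (mul (cell 1 (add (sc 13) (lit 1))) (nbE (sc 13) (sc 10))).eval t ≠ 0 ↔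
          ⟨k, hk⟩ ∈ selected I s ∧ (⟨k, hk⟩ = v ∨ I.graph.Adj ⟨k, hk⟩ v) := by
        rw [← e1, mem_selected, ← t1]
        simp only [eval, mul_ne_zero_iff, sc, h13]
      rw [exists_fin_iff hk]
      by_cases h : ⟨k, hk⟩ ∈ selected I s ∧ (⟨k, hk⟩ = v ∨ I.graph.Adj ⟨k, hk⟩ v)
      · rw [sem_ite_pos (hc.2 h)]
        simp [h, LP.sem, Mem.write, eval]
      · rw [sem_ite_neg fun h' => h (hc.1 h'), if_neg fun h' => h h'.1]
        rfl
  rw [key, h8]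
  split_ifs with h <;> simp [h]

theorem checkLP_sem (hs : s 0 = initMem I.encode 0) :
    selected I (checkLP.sem s) = selected I s ∧ (checkLP.sem s 1 0 ≠ 0 ↔
      ∀ v, ∃ u ∈ selected I s, u = v ∨ I.graph.Adj u v) := by
  classical
  set t := s.write 1 0 1 with ht
  have t0 : t 0 = initMem I.encode 0 := by rw [ht, Mem.write_of_ne (by decide), hs]
  have hn : t 0 0 = I.n := by rw [t0, I.initMem_n]
  have key : ∀ j, checkLP.sem s 1 j = if (∃ v : Fin I.n, ¬ ∃ u ∈ selected I s,
      u = v ∨ I.graph.Adj u v) ∧ j = 0 then 0 else t 1 j := by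
    intro j
    have h := sem_loop_assign (i := 10) (a := 1) (p := seq (store 8 (lit 0) (lit 0))
      (seq dominatedLP (ite (sc 8) skip (store 1 (lit 0) (lit 0))))) (by decide) t (fun _ => 0)
      (fun k j => (∃ v : Fin I.n, v.val = k ∧ ¬ ∃ u ∈ selected I s, u = v ∨ I.graph.Adj u v) ∧
        j = 0) ?_ j
    · refine h.trans ?_
      congr 1
      rw [hn]
      refine propext ⟨?_, ?_⟩
      · rintro ⟨k, -, ⟨u, -, h⟩, hj⟩
        exact ⟨⟨u, h⟩, hj⟩
      · rintro ⟨⟨u, h⟩, hj⟩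
        exact ⟨u, u.isLt, ⟨u, rfl, h⟩, hj⟩
    · intro k hk r h10 hfr hr1 j
      rw [hn] at hk
      have r0 : r 0 = initMem I.encode 0 := by
        rw [hfr 0 (by decide), Mem.write_of_ne (by decide), t0]
      have hrsel : selected I r = selected I s := by
        ext v
        simp [mem_selected, hr1, ht, Mem.write]
      set r₁ := r.write 8 0 0 with hr₁
      have hsel1 : selected I r₁ = selected I s := by
        rw [← hrsel]
        ext v
        simp [mem_selected, hr₁, Mem.write]
      have hd := dominatedLP_sem (s := r₁) (v := ⟨k, hk⟩)
        (by rw [hr₁, Mem.write_of_ne (by decide), r0])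
        (by rw [hr₁, Mem.write_of_ne (by decide), h10]) (by simp [hr₁, Mem.write])
      rw [hsel1] at hd
      have c1 : dominatedLP.sem r₁ 1 = r 1 := by
        rw [LP.sem_of_not_mem_writes _ (by decide), hr₁, Mem.write_of_ne (by decide)]
      have hseq : (seq (store 8 (lit 0) (lit 0)) (seq dominatedLP
          (ite (sc 8) skip (store 1 (lit 0) (lit 0))))).sem r =
          (ite (sc 8) skip (store 1 (lit 0) (lit 0))).sem (dominatedLP.sem r₁) := rfl
      rw [hseq, exists_fin_iff hk]
      by_cases h : ∃ u ∈ selected I s, u = ⟨k, hk⟩ ∨ I.graph.Adj u ⟨k, hk⟩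
      · rw [sem_ite_pos (b := sc 8) (s := dominatedLP.sem r₁) (hd.2 h), LP.sem, c1, if_neg fun h' => h'.1 h]
      · rw [sem_ite_neg (b := sc 8) (s := dominatedLP.sem r₁) fun h' => h (hd.1 h')]
        simp [h, LP.sem, Mem.write, eval, c1]
  constructor
  · ext v
    rw [mem_selected, mem_selected, key, if_neg (by simp), ht]
    simp [Mem.write]
  · rw [key]
    by_cases h : ∃ v : Fin I.n, ¬ ∃ u ∈ selected I s, u = v ∨ I.graph.Adj u v
    · rw [if_pos ⟨h, rfl⟩]
      obtain ⟨v, hv⟩ := h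
      exact ⟨fun h' => absurd rfl h', fun h' => absurd (h' v) hv⟩
    · rw [if_neg fun h' => h h'.1]
      push Not at h
      refine ⟨fun _ => h, fun _ => ?_⟩
      simp [ht, Mem.write]

/-- Optimality is needed only against an actual e.d.s. `D` of finite weight, and the existence of
`D` supplies the hypothesis on the square. Independence of the selected set holds in any case, so
testing domination decides whether it is an e.d.s. -/
theorem wedLP_isAnswer (I : Instance) (hI : ∀ D, IsEDS I.graph D → SquareChordal I.graph) :
    I.IsAnswer (answer I.n (wedLP.sem (initMem I.encode))) := by
  classical
  set s₀ := initMem I.encode with hs₀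
  set s₁ := closeLP.sem s₀ with hs₁
  set s₂ := totalLP.sem s₁ with hs₂
  set s₃ := initLP.sem s₂ with hs₃
  set s₄ := forwardLP.sem s₃ with hs₄
  set s₅ := backwardLP.sem s₄ with hs₅
  have hsem : wedLP.sem s₀ = checkLP.sem s₅ := rfl
  rw [hsem]
  have hzero : ∀ a, a ≠ 0 → ∀ j, s₀ a j = 0 := by
    intro a ha j
    simp [hs₀, initMem, ha]
  have hR1 : Ready I s₁ := ⟨closeLP.sem_of_not_mem_writes (by decide) _,
    closeLP_sem rfl (hzero 2 (by decide))⟩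
  have hR2 : Ready I s₂ := hR1.sem (by decide) (by decide)
  have hR3 : Ready I s₃ := hR2.sem (by decide) (by decide)
  have hR4 : Ready I s₄ := hR3.sem (by decide) (by decide)
  have hR5 : Ready I s₅ := hR4.sem (by decide) (by decide)
  have hinit := initLP_sem hR2.input (I := I) (by
    intro j
    rw [hs₂, LP.sem_of_not_mem_writes _ (by decide), hs₁, LP.sem_of_not_mem_writes _ (by decide),
      hzero 5 (by decide)])
  have htotal : s₂ 3 0 = _ := totalLP_sem hR1.input
  rw [htotal] at hinit
  obtain ⟨C, y, hF, hst, hempty⟩ := forwardLP_sem hR3 (by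
    intro j
    rw [hs₃, LP.sem_of_not_mem_writes _ (by decide), hs₂, LP.sem_of_not_mem_writes _ (by decide),
      hs₁, LP.sem_of_not_mem_writes _ (by decide), hzero 6 (by decide)])
  have hJ := backwardLP_sem hR4 hst (by
    intro j
    rw [hs₄, LP.sem_of_not_mem_writes _ (by decide), hs₃, LP.sem_of_not_mem_writes _ (by decide),
      hs₂, LP.sem_of_not_mem_writes _ (by decide), hs₁, LP.sem_of_not_mem_writes _ (by decide),
      hzero 1 (by decide)]) hF
  rw [← hs₅] at hJ
  obtain ⟨hsel, hcheck⟩ := checkLP_sem hR5.input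
  have halive : ∀ v, v ∈ alive I s₃ ↔ I.weight v ≠ ⊤ := fun v => mem_alive.trans (hinit v).1
  have hJw : ∀ v ∈ selected I s₅, I.weight v ≠ ⊤ := by
    intro v hv
    obtain ⟨i, hi, -, hiv⟩ := hJ.mem_stack v hv
    exact (halive v).1 (hF.mem i hi v hiv).1
  have hW : ∀ D : Finset (Fin I.n), (∀ v ∈ D, I.weight v ≠ ⊤) →
      ∑ v ∈ D, ((closedNbhd I.graph v).card * (1 + ∑ v, if I.weight v = ⊤ then 0 else
        (I.weight v).toNat + 1) - (I.weight v).toNat) = ∑ v ∈ D, s₃ 4 v.val :=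
    fun D hD => Finset.sum_congr rfl fun v hv => ((hinit v).2 (hD v hv)).symm
  have hans := I.isAnswer_of_sum_le _ rfl (selected I s₅) hJw hJ.indep (by
    intro D hD hDw
    rw [hW D hDw, hW _ hJw]
    rw [hempty (hI D hD)] at hF
    exact hJ.sum_le hF (fun v hv => (halive v).2 (hDw v hv)) hD.eq_of_close)
  rw [isEDS_iff] at hans
  unfold answer
  by_cases h : checkLP.sem s₅ 1 0 = 0
  · rw [if_pos h]
    exact hans.2 fun h' => hcheck.2 h'.2 h
  · rw [if_neg h]
    have : (Finset.univ.filter fun v : Fin I.n => checkLP.sem s₅ 1 (v.val + 1) ≠ 0) =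
        selected I s₅ := hsel
    rw [this]
    exact hans.1 ⟨hJ.indep, hcheck.1 h⟩

end Frank

/-- WED can be solved in polynomial time on each graph class in which the squares of the graphs
with efficient dominating sets are chordal. -/
theorem solvableInPolyTime_of_squareChordal {C : ∀ n : ℕ, SimpleGraph (Fin n) → Prop}
    (h : ∀ (n : ℕ) (G : SimpleGraph (Fin n)), C n G → ∀ D, IsEDS G D → SquareChordal G) :
    SolvableInPolyTime C :=
  solvableInPolyTime_of_sem Frank.wedLP Frank.wedLP_ok fun I hI =>
    Frank.wedLP_isAnswer I (h I.n I.graph hI)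

end WED

theorem lemma3 :
    WED.SolvableInPolyTime (fun _ G => WED.IsChordal G ∧ WED.HFree WED.K3P2 G) ∧
      WED.SolvableInPolyTime (fun _ G => WED.IsChordal G ∧ WED.HFree WED.coP G) :=
  ⟨WED.solvableInPolyTime_of_squareChordal fun _ _ hG _ hD =>
      WED.K3P2Free.squareChordal hG.1 hG.2 hD,
    WED.solvableInPolyTime_of_squareChordal fun _ _ hG _ hD =>
      WED.CoPFree.squareChordal hG.1 hG.2 hD⟩
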